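/- Let $X\in\{B,C,D\}$, let $\beta$ be a formal parameter, $x\oplus y=x+y+\beta xy$ and $x\ominus y=(x-y)/(1+\beta y)$ (so $\ominus y=-y/(1+\beta y)$). Let $\mathcal R=\mathbb Z[\beta][b_1,b_2,\dots,b_{\bar1},b_{\bar2},\dots]/\langle b_i\oplus b_{\bar i}\rangle$, so that $b_{\bar i}=\ominus b_i$. Let $W=W(X_\infty)$ be the Weyl group, realised by signed permutations of $\mathbb N\cup\overline{\mathbb N}$, with simple reflections $s_i$, $i\in I$ ($I=\{0,1,2,\dots\}$ for $B,C$ and $I=\{\hat1,1,2,\dots\}$ for $D$); it acts on $\mathcal R$ by $w(b_i)=b_{w(i)}$. Let $\mathcal{SP}$ be the set of strict partitions, with the action of $W$ and the order $\le$ that come from the bijection of $\mathcal{SP}$ with the Grassmannian elements of $W$, that is, with $W/S_\infty$ (the order is the Bruhat–Chevalley order). Let $e$ be the map from the root lattice $\bigoplus_i\mathbb Z t_i$ to $\mathcal R$ with $e(t_i)=b_i$, $e(-t_i)=b_{\bar i}$ and $e(\alpha+\gamma)=e(\alpha)\oplus e(\gamma)$. The GKM ring $\Psi$ consists of the functions $\psi:\mathcal{SP}\to\mathcal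 R$ with $\psi(s_\alpha\mu)-\psi(\mu)\in e(\alpha)\mathcal R$ for all $\mu\in\mathcal{SP}$ and all positive roots $\alpha$ of type $X_\infty$. The left divided difference operators are $$(\pi_i\psi)(\mu)=\frac{s_i(\psi(s_i\mu))-(1+\beta e(\alpha_i))\psi(\mu)}{e(\alpha_i)}.$$ A family $\{\psi_\lambda\}_{\lambda\in\mathcal{SP}}\subset\Psi$ is a family of Schubert classes if, for all $i\in I$ and all $\lambda$, $\pi_i\psi_\lambda=\psi_{s_i\lambda}$ when $s_i\lambda<\lambda$, $\pi_i\psi_\lambda=-\beta\psi_\lambda$ when $s_i\lambda\ge\lambda$, and $\psi_\lambda(\emptyset)=\delta_{\lambda,\emptyset}$. For a strict partition $\lambda$ of length $r\le n$ put $$GP_\lambda(x_1,\dots,x_n|b)=\frac1{(n-r)!}\sum_{w\in S_n}w\Big[\prod_{i=1}^r\Big(\prod_{k=1}^{\lambda_i}(x_i\oplus b_k)\prod_{j=i+1}^n\frac{x_i\oplus x_j}{x_i\ominus x_j}\Big)\Big],$$ and let $GQ_\lambda(x_1,\dots,x_n|b)$ be the same sum with $\prod_{k=1}^{\lambda_i}(x_i\oplus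 b_k)$ replaced by $(x_i\oplus x_i)\prod_{k=1}^{\lambda_i-1}(x_i\oplus b_k)$. Put $GB^{(n)}_\lambda=GP_\lambda(x_1,\dots,x_n|0,b_1,b_2,\dots)$, $GC^{(n)}_\lambda=GQ_\lambda(x_1,\dots,x_n|b)$, and $GD^{(n)}_\lambda=GP_\lambda(x_1,\dots,x_n|b)$ for even $n$, $GD^{(n)}_\lambda=GP_\lambda(x_1,\dots,x_n,0|b)$ for odd $n$. Let $G\Gamma_n$ be the ring of symmetric $f\in\mathbb Z[\beta][x_1,\dots,x_n]$ such that, for all $i<j$, the substitution $x_i=t$, $x_j=\ominus t$ gives a rational function that does not depend on $t$; let $G\Gamma_{n,+}$ be the subring of those $f$ for which $f(t,x_2,\dots,x_n)-f(0,x_2,\dots,x_n)$ is divisible by $t\oplus t$; let $G\Gamma$ and $G\Gamma_+$ be their inverse limits along $x_{n+1}=0$. Put $G\Gamma^C_{\mathcal R}=\mathcal R\otimes_{\mathbb Z[\beta]}G\Gamma_+$ and $G\Gamma^B_{\mathcal R}=G\Gamma^D_{\mathcal R}=\mathcal R\otimes_{\mathbb Z[\beta]}G\Gamma$. For $\mu\in\mathcal{SP}$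 of length $r$ let $b_\mu=(\ominus b_{\mu_1},\dots,\ominus b_{\mu_r},0,0,\dots)$ for $X=B,C$; for $X=D$ let $b_\mu=(\ominus b_{\mu_1+1},\dots,\ominus b_{\mu_r+1},0,0,\dots)$ if $r$ is even and $b_\mu=(\ominus b_{\mu_1+1},\dots,\ominus b_{\mu_r+1},\ominus b_1,0,0,\dots)$ if $r$ is odd. The algebraic localization map is the $\mathcal R$-algebra homomorphism $\Phi:G\Gamma^X_{\mathcal R}\to\mathrm{Fun}(\mathcal{SP},\mathcal R)$, $\Phi(F)(\mu)=F(b_\mu)$. **Theorem.** For every strict partition $\lambda$ there is a unique element $GX_\lambda(x|b)$ of $G\Gamma^X_{\mathcal R}$ whose image in $\mathcal R[x_1,\dots,x_n]$ is $GX^{(n)}_\lambda$ for every $n$ not smaller than the length of $\lambda$. The image of $\Phi$ is contained in $\Psi$. The family $\{\Phi(GX_\lambda(x|b))\}_{\lambda\in\mathcal{SP}}$ is a family of Schubert classes in $\Psi$, and it is the only family of Schubert classes in $\Psi$. Moreover $\Phi$ is injective. -/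

import Mathlib

namespace KGKM

noncomputable section

/-! ### Coefficient rings and the operations `⊕`, `⊖` -/

/-- The ring `ℤ[β]`; the parameter `β` is the polynomial variable. -/
abbrev ZBeta : Type := Polynomial ℤ

/-- The image of `β` in a `ℤ[β]`-algebra. -/
def beta (S : Type*) [CommRing S] [Algebra ZBeta S] : S := algebraMap ZBeta S Polynomial.X

/-- `x ⊕ y = x + y + β x y`. -/
def oplus {S : Type*} [CommRing S] [Algebra ZBeta S] (x y : S) : S := x + y + beta S * x * y

/-- `x ⊖ y = (x - y) / (1 + β y)`. -/
def ominus {K : Type*} [Field K] [Algebra ZBeta K] (x y : K) : K := (x - y) / (1 + beta K * y)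

/-- The classical types `B_∞`, `C_∞`, `D_∞`. -/
inductive ClType : Type
  | B
  | C
  | D

/-- The set `ℕ ∪ ℕ̄` of nonzero integers, `-i` standing for `ī`; its order is
`⋯ < 2̄ < 1̄ < 1 < 2 < ⋯`. -/
abbrev SNum : Type := {z : ℤ // z ≠ 0}

/-- The involution `i ↦ ī`. -/
def bar (z : SNum) : SNum := ⟨-z.1, neg_ne_zero.2 z.2⟩

/-- A positive integer as an element of `ℕ ∪ ℕ̄`. -/
def pos (i : ℕ+) : SNum := ⟨((i : ℕ) : ℤ), by exact_mod_cast i.ne_zero⟩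

theorem bar_bar (z : SNum) : bar (bar z) = z := Subtype.ext (neg_neg _)

/-- The ideal generated by the elements `b_z ⊕ b_{z̄}`. -/
def relIdeal : Ideal (MvPolynomial SNum ZBeta) :=
  Ideal.span (Set.range fun z : SNum =>
    oplus (MvPolynomial.X z : MvPolynomial SNum ZBeta) (MvPolynomial.X (bar z)))

/-- The ring `𝓡 = ℤ[β][b₁, b₂, …, b_1̄, b_2̄, …] / ⟨b_i ⊕ b_ī⟩`. -/
def CoefRing : Type := MvPolynomial SNum ZBeta ⧸ relIdeal

instance : CommRing CoefRing := inferInstanceAs (CommRing (MvPolynomial SNum ZBeta ⧸ relIdeal))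

instance : Algebra ZBeta CoefRing :=
  inferInstanceAs (Algebra ZBeta (MvPolynomial SNum ZBeta ⧸ relIdeal))

/-- The quotient map onto `𝓡`. -/
def toCoef : MvPolynomial SNum ZBeta →ₐ[ZBeta] CoefRing := Ideal.Quotient.mkₐ ZBeta relIdeal

/-- The element `b_z` of `𝓡`, for `z` in `ℕ ∪ ℕ̄`. -/
def b (z : SNum) : CoefRing := toCoef (MvPolynomial.X z)

theorem b_oplus_b_bar (z : SNum) : oplus (b z) (b (bar z)) = 0 := by
  have h : toCoef
      (oplus (MvPolynomial.X z : MvPolynomial SNum ZBeta) (MvPolynomial.X (bar z))) = 0 :=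
    Ideal.Quotient.eq_zero_iff_mem.2 (Ideal.subset_span ⟨z, rfl⟩)
  simpa only [b, oplus, beta, map_add, map_mul, AlgHom.commutes] using h

/-! ### Signed permutations and Weyl groups -/

/-- The group `S̄_∞` of signed permutations. -/
def signedPerm : Subgroup (Equiv.Perm SNum) where
  carrier := {w | (∀ z, w (bar z) = bar (w z)) ∧ ∃ n : ℕ, ∀ z : SNum, (n : ℤ) < z.1 → w z = z}
  one_mem' := ⟨fun _ => rfl, 0, fun _ _ => rfl⟩
  mul_mem' := by
    rintro u v ⟨hu, m, hm⟩ ⟨hv, n, hn⟩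
    refine ⟨fun z => by simp [hu, hv], max m n, fun z hz => ?_⟩
    have h1 : (m : ℤ) < z.1 := lt_of_le_of_lt (by exact_mod_cast le_max_left m n) hz
    have h2 : (n : ℤ) < z.1 := lt_of_le_of_lt (by exact_mod_cast le_max_right m n) hz
    simp [hn z h2, hm z h1]
  inv_mem' := by
    rintro u ⟨hu, m, hm⟩
    refine ⟨fun z => ?_, m, fun z hz => ?_⟩
    · rw [Equiv.Perm.inv_eq_iff_eq, hu]
      exact congrArg bar (u.apply_symm_apply z).symm
    · rw [Equiv.Perm.inv_eq_iff_eq, hm z hz]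

/-- The signed permutation given by an involutive map. -/
def ofInvolutive (f : SNum → SNum) (hf : ∀ z, f (f z) = z) (hbar : ∀ z, f (bar z) = bar (f z))
    (n : ℕ) (hn : ∀ z : SNum, (n : ℤ) < z.1 → f z = z) : signedPerm :=
  ⟨⟨f, f, hf, hf⟩, hbar, n, hn⟩

/-- The underlying map of `s₀`: it exchanges `1` and `1̄`. -/
def sFunZero (z : SNum) : SNum := if z.1 = 1 ∨ z.1 = -1 then bar z else z

theorem sFunZero_val (z : SNum) :
    (sFunZero z).1 = if z.1 = 1 ∨ z.1 = -1 then -z.1 else z.1 := by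
  simp only [sFunZero, bar]
  split_ifs <;> rfl

/-- The signed permutation `s₀`. -/
def s0 : signedPerm :=
  ofInvolutive sFunZero
    (fun z => Subtype.ext (by rw [sFunZero_val, sFunZero_val]; split_ifs <;> omega))
    (fun z => Subtype.ext (by simp only [bar, sFunZero_val]; split_ifs <;> omega))
    1 (fun z h => Subtype.ext (by rw [sFunZero_val]; push_cast at h; split_ifs <;> omega))

/-- The underlying map of `s_i`, `i ≥ 1`: it exchanges `i` with `i + 1` and `ī` with the bar of
`i + 1`. -/
def sFun (i : ℕ+) (z : SNum) : SNum :=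
  if z = pos i then pos (i + 1)
  else if z = pos (i + 1) then pos i
  else if z = bar (pos i) then bar (pos (i + 1))
  else if z = bar (pos (i + 1)) then bar (pos i)
  else z

theorem sFun_val (i : ℕ+) (z : SNum) : (sFun i z).1 =
    if z.1 = (i : ℕ) then ((i : ℕ) : ℤ) + 1
    else if z.1 = (i : ℕ) + 1 then ((i : ℕ) : ℤ)
    else if z.1 = -(i : ℕ) then -((i : ℕ) : ℤ) - 1
    else if z.1 = -(i : ℕ) - 1 then -((i : ℕ) : ℤ)
    else z.1 := by
  simp only [sFun, Subtype.ext_iff, pos, bar, PNat.add_coe, PNat.one_coe, Nat.cast_add,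
    Nat.cast_one]
  split_ifs <;> simp <;> omega

/-- The signed permutation `s_i`, `i ≥ 1`. -/
def sPos (i : ℕ+) : signedPerm :=
  ofInvolutive (sFun i)
    (fun z => Subtype.ext (by
      have hi := i.pos
      rw [sFun_val, sFun_val]
      split_ifs <;> omega))
    (fun z => Subtype.ext (by
      have hi := i.pos
      have hz := z.2
      simp only [bar, sFun_val]
      split_ifs <;> omega))
    (i + 1) (fun z h => Subtype.ext (by
      have hi := i.pos
      rw [sFun_val]
      push_cast at h
      split_ifs <;> omega))

/-- The simple reflections. The index set is `ℕ`; in type `D` the index `0` stands for `1̂`, with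
`s_1̂ = s₀ s₁ s₀`. -/
def simpleRefl : ClType → ℕ → signedPerm
  | .D, 0 => s0 * sPos 1 * s0
  | _, 0 => s0
  | _, i + 1 => sPos i.succPNat

/-- The Weyl group `W(X_∞)`, as the subgroup of the signed permutations generated by the simple
reflections. -/
def weyl (X : ClType) : Subgroup signedPerm := Subgroup.closure (Set.range (simpleRefl X))

/-- The action of a signed permutation on `𝓡`: `w(b_z) = b_{w(z)}` and `w(β) = β`. -/
def actCoef (w : signedPerm) : CoefRing →ₐ[ZBeta] CoefRing :=
  Ideal.Quotient.liftₐ relIdeal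
    (MvPolynomial.aeval fun z : SNum => b (w.1 z))
    (by
      intro a ha
      have hle : relIdeal ≤ RingHom.ker
          (MvPolynomial.aeval (R := ZBeta) fun z : SNum => b (w.1 z)) := by
        refine Ideal.span_le.2 ?_
        rintro _ ⟨z, rfl⟩
        have h := b_oplus_b_bar (w.1 z)
        rw [← w.2.1 z] at h
        simpa [oplus, beta, RingHom.mem_ker, MvPolynomial.algebraMap_eq] using h
      exact hle ha)

/-! ### Strict partitions and the action of the Weyl group on them -/

/-- A strict partition `λ₁ > λ₂ > ⋯ > λ_r > 0`, given by its finite set of parts. -/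
abbrev SP : Type := Finset ℕ+

/-- The part `λ_{i+1}` (and `0` if `i` is at least the length). -/
def part (la : SP) (i : ℕ) : ℕ := ((la.sort (· ≥ ·)).map (fun p : ℕ+ => (p : ℕ))).getD i 0

/-- For a set `A ⊆ ℕ ∪ ℕ̄`, the positive integers `i` with `ī ∈ A`. -/
def negPart (A : Set SNum) : Set ℕ+ := {i | bar (pos i) ∈ A}

/-- The set `{ī : i ∈ λ} ∪ {j ∈ ℕ : j ∉ λ}`. It is the set `w(ℕ)` for every signed permutation `w`
with `λ(w) = λ`. -/
def halfSet (la : SP) : Set SNum :=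
  {z | (∃ i ∈ la, z = bar (pos i)) ∨ (∃ j, j ∉ la ∧ z = pos j)}

theorem bar_pos_ne_pos (i j : ℕ+) : bar (pos i) ≠ pos j := by
  intro h
  have := congrArg Subtype.val h
  have hi := i.pos
  simp only [bar, pos] at this
  omega

theorem pos_injective : Function.Injective pos := by
  intro i j h
  have := congrArg Subtype.val h
  simp only [pos] at this
  exact PNat.eq (by exact_mod_cast this)

theorem bar_injective : Function.Injective bar := by
  intro i j h
  rw [← bar_bar i, h, bar_bar]

theorem bar_pos_mem_halfSet (la : SP) (i : ℕ+) : bar (pos i) ∈ halfSet la ↔ i ∈ la := by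
  constructor
  · rintro (⟨j, hj, h⟩ | ⟨j, _, h⟩)
    · rwa [pos_injective (bar_injective h)]
    · exact absurd h (bar_pos_ne_pos i j)
  · exact fun h => Or.inl ⟨i, h, rfl⟩

theorem pos_mem_halfSet (la : SP) (i : ℕ+) : pos i ∈ halfSet la ↔ i ∉ la := by
  constructor
  · rintro (⟨j, _, h⟩ | ⟨j, hj, h⟩)
    · exact absurd h.symm (bar_pos_ne_pos j i)
    · rwa [pos_injective h]
  · exact fun h => Or.inr ⟨i, h, rfl⟩

theorem pos_or_bar_pos (z : SNum) : (∃ i, z = pos i) ∨ ∃ i, z = bar (pos i) := by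
  obtain ⟨z, hz⟩ := z
  rcases lt_or_gt_of_ne hz with h | h
  · refine Or.inr ⟨⟨z.natAbs, Int.natAbs_pos.2 hz⟩, Subtype.ext ?_⟩
    simp only [bar, pos, PNat.mk_coe]
    omega
  · refine Or.inl ⟨⟨z.natAbs, Int.natAbs_pos.2 hz⟩, Subtype.ext ?_⟩
    simp only [pos, PNat.mk_coe]
    omega

theorem finite_negPart (w : signedPerm) (la : SP) : (negPart (w.1 '' halfSet la)).Finite := by
  obtain ⟨n, hn⟩ := w.2.2
  refine ((la.finite_toSet).union (Set.finite_Iic (n.succPNat))).subset ?_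
  intro i hi
  by_cases h : i ≤ n.succPNat
  · exact Or.inr h
  · left
    have hlt : (n : ℤ) < (pos i).1 := by
      have : n.succPNat < i := not_le.1 h
      have h' : (n + 1 : ℕ) < (i : ℕ) := by simpa using PNat.coe_lt_coe _ _ |>.2 this
      simp only [pos]
      omega
    obtain ⟨z, hz, hzi⟩ := hi
    have hfix : w.1 (bar (pos i)) = bar (pos i) := by rw [w.2.1, hn _ hlt]
    rw [← hfix] at hzi
    rw [w.1.injective hzi] at hz
    exact (bar_pos_mem_halfSet la i).1 hz

/-- The strict partition `λ(w)`, whose set of parts is `ℕ̄ ∩ w(ℕ)` with bars removed. -/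
def lam (w : signedPerm) : SP := (finite_negPart w ∅).toFinset

/-- The strict partition of even length attached to `λ` in type `D`: it has one more box in each
row, and a further row of length `1` if the length of `λ` is odd. -/
def toEven (la : SP) : SP := la.image (· + 1) ∪ if Odd la.card then {1} else ∅

/-- Removing the diagonal boxes of a shifted diagram. -/
def dropDiag (la : SP) : SP := (la.filter (1 < ·)).image (· - 1)

/-- The map `λ : W(X_∞) → SP` for types `B`, `C` and `λ₊` for type `D`. -/
def shape (X : ClType) (w : signedPerm) : SP :=
  match X with
  | .D => dropDiag (lam w)
  | _ => lam w

/-- The set of parts of `λ(v)`, for `v` in `W(X_∞)` with `shape X v = λ`. -/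
def rep (X : ClType) (la : SP) : SP :=
  match X with
  | .D => toEven la
  | _ => la

/-- The action of a signed permutation on strict partitions (of types `B` and `C`), induced by left
multiplication on `S̄_∞ / S_∞ ≅ SP`. -/
def actBC (w : signedPerm) (la : SP) : SP := (finite_negPart w la).toFinset

/-- The action of `W(X_∞)` on strict partitions. -/
def act (X : ClType) (w : signedPerm) (la : SP) : SP :=
  match X with
  | .D => dropDiag (actBC w (toEven la))
  | _ => actBC w la

/-- The set `w(ℕ)` is determined by `λ(w)`. -/
theorem halfSet_lam (w : signedPerm) : halfSet (lam w) = w.1 '' halfSet ∅ := by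
  have key : ∀ i, bar (pos i) ∈ w.1 '' halfSet ∅ ↔ pos i ∉ w.1 '' halfSet ∅ := by
    intro i
    have e : ∀ z, z ∈ halfSet ∅ ↔ bar z ∉ halfSet ∅ := by
      intro z
      rcases pos_or_bar_pos z with ⟨j, rfl⟩ | ⟨j, rfl⟩
      · simp [pos_mem_halfSet, bar_pos_mem_halfSet]
      · simp [pos_mem_halfSet, bar_pos_mem_halfSet, bar_bar]
    have c : ∀ z, z ∈ w.1 '' halfSet ∅ ↔ w.1.symm z ∈ halfSet ∅ := fun z => by
      rw [Equiv.image_eq_preimage_symm]; rfl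
    have hs : w.1.symm (bar (pos i)) = bar (w.1.symm (pos i)) := by
      rw [Equiv.symm_apply_eq, w.2.1, Equiv.apply_symm_apply]
    rw [c, c, hs, e (w.1.symm (pos i)), not_not]
  ext z
  rcases pos_or_bar_pos z with ⟨j, rfl⟩ | ⟨j, rfl⟩
  · rw [pos_mem_halfSet, lam, Set.Finite.mem_toFinset]
    exact not_iff_comm.1 (key j).symm
  · rw [bar_pos_mem_halfSet, lam, Set.Finite.mem_toFinset]
    rfl

/-- `actBC` is the action by left multiplication through the map `w ↦ λ(w)`. -/
theorem actBC_lam (w v : signedPerm) : actBC w (lam v) = lam (w * v) := by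
  ext i
  have h : i ∈ actBC w (lam v) ↔ bar (pos i) ∈ w.1 '' halfSet (lam v) := by
    rw [actBC, Set.Finite.mem_toFinset]; rfl
  have h' : i ∈ lam (w * v) ↔ bar (pos i) ∈ (w * v).1 '' halfSet ∅ := by
    rw [lam, Set.Finite.mem_toFinset]; rfl
  rw [h, h', halfSet_lam, ← Set.image_comp]
  rfl

/-! ### The Bruhat order on strict partitions -/

/-- `w` is Grassmannian: `w(1) < w(2) < ⋯`. -/
def IsGrassmannian (w : signedPerm) : Prop := ∀ i j : ℕ+, i < j → w.1 (pos i) < w.1 (pos j)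

/-- The length of `w` with respect to the simple reflections. -/
def length (X : ClType) (w : signedPerm) : ℕ :=
  sInf {n | ∃ l : List ℕ, l.length = n ∧ (l.map (simpleRefl X)).prod = w}

/-- `t` is a reflection of `W(X_∞)`, that is, a conjugate of a simple reflection. -/
def IsReflection (X : ClType) (t : signedPerm) : Prop :=
  ∃ u ∈ weyl X, ∃ i, t = u * simpleRefl X i * u⁻¹

/-- The Bruhat–Chevalley order on `W(X_∞)`. -/
def bruhat (X : ClType) : signedPerm → signedPerm → Prop :=
  Relation.ReflTransGen fun u v => ∃ t, IsReflection X t ∧ v = u * t ∧ length X u < length X v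

/-- The order on strict partitions induced by the Bruhat–Chevalley order on the Grassmannian
elements of `W(X_∞)`. -/
def SPle (X : ClType) (la mu : SP) : Prop :=
  ∃ u ∈ weyl X, ∃ v ∈ weyl X, IsGrassmannian u ∧ IsGrassmannian v ∧
    shape X u = la ∧ shape X v = mu ∧ bruhat X u v

/-- The strict order: `λ ≤ μ` and `λ ≠ μ`. -/
def SPlt (X : ClType) (la mu : SP) : Prop := SPle X la mu ∧ la ≠ mu

/-! ### Roots -/

/-- The lattice `L`, the free `ℤ`-module with basis `t_i`, `i ≥ 1`. -/
abbrev Lat : Type := ℕ+ →₀ ℤ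

/-- `t_z`, where `t_ī = -t_i`. -/
def t (z : SNum) : Lat := Finsupp.single ⟨z.1.natAbs, Int.natAbs_pos.2 z.2⟩ z.1.sign

/-- The action of a signed permutation on `L`: `w(t_i) = t_{w(i)}`. -/
def actLat (w : signedPerm) : Lat →ₗ[ℤ] Lat :=
  Finsupp.linearCombination ℤ fun i : ℕ+ => t (w.1 (pos i))

/-- The positive roots of type `X_∞`. -/
def posRoots (X : ClType) : Set Lat :=
  (match X with
    | .B => {a | ∃ i : ℕ+, a = t (pos i)}
    | .C => {a | ∃ i : ℕ+, a = 2 • t (pos i)}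
    | .D => ∅) ∪
  {a | ∃ i j : ℕ+, i < j ∧ (a = t (pos j) + t (pos i) ∨ a = t (pos j) - t (pos i))}

/-- The simple roots; in type `D` the index `0` stands for `1̂`. -/
def simpleRoot : ClType → ℕ → Lat
  | .B, 0 => t (pos 1)
  | .C, 0 => 2 • t (pos 1)
  | .D, 0 => t (pos 1) + t (pos 2)
  | _, i + 1 => t (pos (i.succPNat + 1)) - t (pos i.succPNat)

/-- The elements `x` of a `ℤ[β]`-algebra that are invertible for `⊕`, with the inverse `⊖ x`.
They form a commutative group under `⊕`. -/
@[ext]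
structure OplusGroup (S : Type*) [CommRing S] [Algebra ZBeta S] where
  val : S
  inv : S
  val_inv : oplus val inv = 0

theorem oplus_comm {S : Type*} [CommRing S] [Algebra ZBeta S] (x y : S) :
    oplus x y = oplus y x := by unfold oplus; ring

theorem oplus_assoc {S : Type*} [CommRing S] [Algebra ZBeta S] (x y z : S) :
    oplus (oplus x y) z = oplus x (oplus y z) := by unfold oplus; ring

theorem oplus_zero {S : Type*} [CommRing S] [Algebra ZBeta S] (x : S) :
    oplus x 0 = x := by unfold oplus; ring

theorem oplus_cancel {S : Type*} [CommRing S] [Algebra ZBeta S] {x y z : S}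
    (h : oplus x y = 0) (h' : oplus x z = 0) : y = z := by
  rw [← oplus_zero y, ← h', ← oplus_assoc, oplus_comm y x, h, oplus_comm, oplus_zero]

theorem OplusGroup.ext_val {S : Type*} [CommRing S] [Algebra ZBeta S] {x y : OplusGroup S}
    (h : x.val = y.val) : x = y :=
  OplusGroup.ext h (oplus_cancel x.val_inv (by rw [h]; exact y.val_inv))

namespace OplusGroup

variable {S : Type*} [CommRing S] [Algebra ZBeta S]

instance : Add (OplusGroup S) where
  add x y := ⟨oplus x.val y.val, oplus x.inv y.inv, by
    rw [oplus_assoc, ← oplus_assoc y.val, oplus_comm y.val, oplus_assoc x.inv, y.val_inv,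
      oplus_zero, x.val_inv]⟩

instance : Zero (OplusGroup S) where
  zero := ⟨0, 0, oplus_zero 0⟩

instance : Neg (OplusGroup S) where
  neg x := ⟨x.inv, x.val, (oplus_comm _ _).trans x.val_inv⟩

instance : AddCommGroup (OplusGroup S) where
  add_assoc x y z := ext_val (oplus_assoc x.val y.val z.val)
  zero_add x := ext_val ((oplus_comm _ _).trans (oplus_zero x.val))
  add_zero x := ext_val (oplus_zero x.val)
  nsmul := nsmulRec
  zsmul := zsmulRec
  neg_add_cancel x := ext_val ((oplus_comm _ _).trans x.val_inv)
  add_comm x y := ext_val (oplus_comm x.val y.val)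

end OplusGroup

/-- The map `e : L → 𝓡` with `e(t_i) = b_i`, `e(-t_i) = b_ī` and `e(α + γ) = e(α) ⊕ e(γ)`. -/
def e (a : Lat) : CoefRing :=
  (Finsupp.linearCombination ℤ
    (fun i : ℕ+ => (⟨b (pos i), b (bar (pos i)), b_oplus_b_bar _⟩ : OplusGroup CoefRing)) a).val

/-! ### The GKM ring, divided differences and Schubert classes -/

/-- The GKM ring `Ψ`: the functions `ψ : SP → 𝓡` such that `ψ(s_α μ) - ψ(μ) ∈ e(α) 𝓡` for every
`μ` and every positive root `α`; here `s_α = w s_i w⁻¹` if `α = w(α_i)`. -/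
def gkmRing (X : ClType) : Subalgebra CoefRing (SP → CoefRing) where
  carrier := {psi | ∀ w ∈ weyl X, ∀ i, actLat w (simpleRoot X i) ∈ posRoots X → ∀ mu : SP,
    e (actLat w (simpleRoot X i)) ∣ psi (act X (w * simpleRefl X i * w⁻¹) mu) - psi mu}
  mul_mem' := by
    intro f g hf hg w hw i hi mu
    have h1 := hf w hw i hi mu
    have h2 := hg w hw i hi mu
    have : (f * g) (act X (w * simpleRefl X i * w⁻¹) mu) - (f * g) mu =
        (f (act X (w * simpleRefl X i * w⁻¹) mu) - f mu) * g (act X (w * simpleRefl X i * w⁻¹) mu) +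
        f mu * (g (act X (w * simpleRefl X i * w⁻¹) mu) - g mu) := by
      simp only [Pi.mul_apply]; ring
    rw [this]
    exact dvd_add (h1.mul_right _) (h2.mul_left _)
  add_mem' := by
    intro f g hf hg w hw i hi mu
    have : (f + g) (act X (w * simpleRefl X i * w⁻¹) mu) - (f + g) mu =
        (f (act X (w * simpleRefl X i * w⁻¹) mu) - f mu) +
        (g (act X (w * simpleRefl X i * w⁻¹) mu) - g mu) := by
      simp only [Pi.add_apply]; ring
    rw [this]
    exact dvd_add (hf w hw i hi mu) (hg w hw i hi mu)
  algebraMap_mem' := by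
    intro r w _ i _ mu
    simp

/-- `π_i ψ = φ` for the left divided difference operator
`(π_i ψ)(μ) = (s_i(ψ(s_i μ)) - (1 + β e(α_i)) ψ(μ)) / e(α_i)`. -/
def DividedDiff (X : ClType) (i : ℕ) (psi phi : SP → CoefRing) : Prop :=
  ∀ mu : SP, e (simpleRoot X i) * phi mu =
    actCoef (simpleRefl X i) (psi (act X (simpleRefl X i) mu)) -
      (1 + beta CoefRing * e (simpleRoot X i)) * psi mu

/-- `{ψ_λ}` is a family of Schubert classes. If `s_i λ < λ` then `s_i λ` is the strict partition
`λ^{(i)}` obtained from `λ` by removing a box. -/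
structure IsSchubertFamily (X : ClType) (psi : SP → SP → CoefRing) : Prop where
  mem_gkm : ∀ la, psi la ∈ gkmRing X
  divided_lt : ∀ i la, SPlt X (act X (simpleRefl X i) la) la →
    DividedDiff X i (psi la) (psi (act X (simpleRefl X i) la))
  divided_ge : ∀ i la, SPle X la (act X (simpleRefl X i) la) →
    DividedDiff X i (psi la) (-beta CoefRing • psi la)
  initial : ∀ la, psi la ∅ = if la = ∅ then 1 else 0

/-! ### The rings `GΓ` and `GΓ₊` -/

/-- `f(x₁, …, x_n)` has the `K`-theoretic `Q`-cancellation property: for `i < j`, the rational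
function obtained by `x_i = t`, `x_j = ⊖ t` does not depend on `t`, that is, it agrees with its
value at `t = 0`. The variable `x_i`, which the substitution frees, plays the role of `t`. -/
def QCancel {n : ℕ} (f : MvPolynomial (Fin n) ZBeta) : Prop :=
  ∀ i j : Fin n, i < j →
    MvPolynomial.aeval (R := ZBeta) (fun k : Fin n =>
      let x := fun k : Fin n => algebraMap (MvPolynomial (Fin n) ZBeta)
        (FractionRing (MvPolynomial (Fin n) ZBeta)) (MvPolynomial.X k)
      if k = j then ominus 0 (x i) else x k) f =
    MvPolynomial.aeval (R := ZBeta) (fun k : Fin n =>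
      let x := fun k : Fin n => algebraMap (MvPolynomial (Fin n) ZBeta)
        (FractionRing (MvPolynomial (Fin n) ZBeta)) (MvPolynomial.X k)
      if k = j ∨ k = i then 0 else x k) f

/-- The ring `GΓ_n`. -/
def GGammaFin (n : ℕ) : Subalgebra ZBeta (MvPolynomial (Fin n) ZBeta) where
  carrier := {f | f.IsSymmetric ∧ QCancel f}
  mul_mem' := fun hf hg => ⟨hf.1.mul hg.1, fun i j h => by
    rw [map_mul, map_mul, hf.2 i j h, hg.2 i j h]⟩
  add_mem' := fun hf hg => ⟨hf.1.add hg.1, fun i j h => by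
    rw [map_add, map_add, hf.2 i j h, hg.2 i j h]⟩
  algebraMap_mem' := fun r => ⟨MvPolynomial.IsSymmetric.C r, fun i j _ => by
    rw [AlgHom.commutes, AlgHom.commutes]⟩

/-- The substitution `x_i = 0`. -/
def setZero {n : ℕ} (i : Fin n) :
    MvPolynomial (Fin n) ZBeta →ₐ[ZBeta] MvPolynomial (Fin n) ZBeta :=
  MvPolynomial.aeval fun k => if k = i then 0 else MvPolynomial.X k

/-- The ring `GΓ_{n,+}`: the `f` in `GΓ_n` such that `f(t, x₂, …) - f(0, x₂, …)` is divisible by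
`t ⊕ t`; by symmetry the condition may be put on every variable. -/
def GGammaPlusFin (n : ℕ) : Subalgebra ZBeta (MvPolynomial (Fin n) ZBeta) where
  carrier := {f | f ∈ GGammaFin n ∧ ∀ i : Fin n,
    oplus (MvPolynomial.X i : MvPolynomial (Fin n) ZBeta) (MvPolynomial.X i) ∣ f - setZero i f}
  mul_mem' := by
    rintro f g ⟨hf, hf'⟩ ⟨hg, hg'⟩
    refine ⟨mul_mem hf hg, fun i => ?_⟩
    have : f * g - setZero i (f * g) =
        (f - setZero i f) * g + setZero i f * (g - setZero i g) := by rw [map_mul]; ring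
    rw [this]
    exact dvd_add ((hf' i).mul_right _) ((hg' i).mul_left _)
  add_mem' := by
    rintro f g ⟨hf, hf'⟩ ⟨hg, hg'⟩
    refine ⟨add_mem hf hg, fun i => ?_⟩
    have : f + g - setZero i (f + g) =
        (f - setZero i f) + (g - setZero i g) := by rw [map_add]; ring
    rw [this]
    exact dvd_add (hf' i) (hg' i)
  algebraMap_mem' := fun r => ⟨Subalgebra.algebraMap_mem _ r, fun i => by
    rw [AlgHom.commutes, sub_self]; exact dvd_zero _⟩

/-- The specialization `x_{n+1} = 0`. -/
def dropLast (n : ℕ) : MvPolynomial (Fin (n + 1)) ZBeta →ₐ[ZBeta] MvPolynomial (Fin n) ZBeta :=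
  MvPolynomial.aeval fun k => if h : k.1 < n then MvPolynomial.X ⟨k.1, h⟩ else 0

/-- The inverse limit, along the specializations `x_{n+1} = 0`, of subalgebras `G n` of
`ℤ[β][x₁, …, x_n]`. -/
def invLimit (G : ∀ n : ℕ, Subalgebra ZBeta (MvPolynomial (Fin n) ZBeta)) :
    Subalgebra ZBeta (∀ n : ℕ, MvPolynomial (Fin n) ZBeta) where
  carrier := {f | (∀ n, f n ∈ G n) ∧ ∀ n, dropLast n (f (n + 1)) = f n}
  mul_mem' := fun hf hg => ⟨fun n => mul_mem (hf.1 n) (hg.1 n), fun n => by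
    rw [Pi.mul_apply, map_mul, hf.2, hg.2]; rfl⟩
  add_mem' := fun hf hg => ⟨fun n => add_mem (hf.1 n) (hg.1 n), fun n => by
    rw [Pi.add_apply, map_add, hf.2, hg.2]; rfl⟩
  algebraMap_mem' := fun r => ⟨fun n => Subalgebra.algebraMap_mem _ r, fun n =>
    AlgHom.commutes (dropLast n) r⟩

/-- The ring `GΓ₊` for type `C` and `GΓ` for types `B` and `D`. -/
def GGamma : ClType → Subalgebra ZBeta (∀ n : ℕ, MvPolynomial (Fin n) ZBeta)
  | .C => invLimit GGammaPlusFin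
  | _ => invLimit GGammaFin

/-- The ring `GΓ_𝓡^X`: it is `𝓡 ⊗ GΓ₊` for type `C` and `𝓡 ⊗ GΓ` for types `B` and `D`. -/
abbrev GGammaR (X : ClType) : Type := TensorProduct ZBeta CoefRing (GGamma X)

/-- The substitution of the values `x : Fin n → S` for `x₁, …, x_n`, and of `0` for the other
variables: `r ⊗ f ↦ r · f_n(x)`. -/
def evalAt (X : ClType) {S : Type} [CommRing S] [Algebra ZBeta S] [Algebra CoefRing S]
    [IsScalarTower ZBeta CoefRing S] (n : ℕ) (x : Fin n → S) : GGammaR X →ₐ[CoefRing] S :=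
  Algebra.TensorProduct.lift (Algebra.ofId CoefRing S)
    ((MvPolynomial.aeval x).comp
      ((Pi.evalAlgHom ZBeta (fun n : ℕ => MvPolynomial (Fin n) ZBeta) n).comp (GGamma X).val))
    (fun _ _ => Commute.all _ _)

/-- The image of an element of `GΓ_𝓡^X` in `𝓡[x₁, …, x_n]`. -/
def level (X : ClType) (n : ℕ) : GGammaR X →ₐ[CoefRing] MvPolynomial (Fin n) CoefRing :=
  evalAt X n MvPolynomial.X

/-! ### The functions `GB_λ(x|b)`, `GC_λ(x|b)`, `GD_λ(x|b)` -/

/-- `[x|b]^k = (x ⊕ b₁) ⋯ (x ⊕ b_k)`. -/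
def factPow {K : Type*} [Field K] [Algebra ZBeta K] (c : ℕ+ → K) (x : K) (k : ℕ) : K :=
  ∏ j ∈ Finset.range k, oplus x (c j.succPNat)

/-- `[[x|b]]^k = (x ⊕ x)(x ⊕ b₁) ⋯ (x ⊕ b_{k-1})`, for `k ≥ 1`. -/
def factPowQ {K : Type*} [Field K] [Algebra ZBeta K] (c : ℕ+ → K) (x : K) (k : ℕ) : K :=
  oplus x x * factPow c x (k - 1)

/-- For a strict partition `λ` of length `r ≤ n`, the sum
`1/(n-r)! ∑_{w ∈ S_n} w [ ∏_{i ≤ r} pw(x_i, λ_i) ∏_{i ≤ r} ∏_{i < j ≤ n} (x_i ⊕ x_j)/(x_i ⊖ x_j) ]`. -/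
def symSum {K : Type*} [Field K] [Algebra ZBeta K] (pw : K → ℕ → K) (la : SP) (n : ℕ)
    (x : Fin n → K) : K :=
  (((n - la.card).factorial : ℕ) : K)⁻¹ * ∑ w : Equiv.Perm (Fin n),
    ∏ i : Fin n with i.1 < la.card, (pw (x (w i)) (part la i) *
      ∏ j : Fin n with i < j, oplus (x (w i)) (x (w j)) / ominus (x (w i)) (x (w j)))

/-- The ring `ℤ[β][b₁, b₂, …][x₁, …, x_n]`. -/
abbrev PolyRing (n : ℕ) : Type := MvPolynomial (Fin n) (MvPolynomial ℕ+ ZBeta)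

/-- The function `GQ_λ(x₁, …, x_n|b)` for type `C` and `GP_λ(x₁, …, x_n|b)` for types `B` and `D`, as
a rational function of the `x_i` and `b_i`. -/
def GPQ (X : ClType) (la : SP) (n : ℕ) : FractionRing (PolyRing n) :=
  let x : Fin n → FractionRing (PolyRing n) := fun i => algebraMap (PolyRing n) _ (MvPolynomial.X i)
  let c : ℕ+ → FractionRing (PolyRing n) := fun i =>
    algebraMap (PolyRing n) _ (MvPolynomial.C (MvPolynomial.X i))
  match X with
  | .C => symSum (factPowQ c) la n x
  | _ => symSum (factPow c) la n x

/-- The sequence substituted for `b`: it is `(0, b₁, b₂, …)` for type `B` and `(b₁, b₂, …)` for types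
`C` and `D`. -/
def params (X : ClType) (j : ℕ+) : CoefRing :=
  match X with
  | .B => if j = 1 then 0 else b (pos (j - 1))
  | _ => b (pos j)

/-- The number of variables of the polynomial that defines `GX_λ^{(n)}`: it is `n + 1` for type `D`
and odd `n`, and `n` otherwise. -/
def numVars (X : ClType) (n : ℕ) : ℕ :=
  match X with
  | .D => if Odd n then n + 1 else n
  | _ => n

/-- The substitution that turns a polynomial in `b₁, b₂, …` and `numVars X n` variables `x_i` into a
polynomial in `x₁, …, x_n` over `𝓡`: the sequence `params X` for `b`, and `0` for `x_{n+1}`. -/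
def specialize (X : ClType) (n : ℕ) : PolyRing (numVars X n) →+* MvPolynomial (Fin n) CoefRing :=
  MvPolynomial.eval₂Hom
    (MvPolynomial.C.comp
      (MvPolynomial.aeval (params X) : MvPolynomial ℕ+ ZBeta →ₐ[ZBeta] CoefRing).toRingHom)
    (fun k => if h : k.1 < n then MvPolynomial.X ⟨k.1, h⟩ else 0)

/-- `p` is the polynomial `GX_λ^{(n)}(x|b)`, for `λ` of length at most `n`. -/
def IsGXFin (X : ClType) (la : SP) (n : ℕ) (p : MvPolynomial (Fin n) CoefRing) : Prop :=
  ∃ P : PolyRing (numVars X n),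
    algebraMap (PolyRing (numVars X n)) (FractionRing (PolyRing (numVars X n))) P =
      GPQ X la (numVars X n) ∧ p = specialize X n P

/-- `F` is the limit `GX_λ(x|b) = lim GX_λ^{(n)}(x|b)` in `GΓ_𝓡^X`. -/
def IsGX (X : ClType) (la : SP) (F : GGammaR X) : Prop :=
  ∀ n, la.card ≤ n → IsGXFin X la n (level X n F)

/-! ### The algebraic localization map -/

/-- The sequence `b_μ`: it is `(⊖ b_{μ₁}, …, ⊖ b_{μ_r}, 0, …)` for types `B` and `C`, and
`(⊖ b_{μ₁+1}, …, ⊖ b_{μ_r+1}, 0, …)` or `(⊖ b_{μ₁+1}, …, ⊖ b_{μ_r+1}, ⊖ b₁, 0, …)` for type `D` and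
even or odd `r`. -/
def bSeq (X : ClType) (mu : SP) (i : ℕ) : CoefRing :=
  if h : 0 < part (rep X mu) i then b (bar (pos ⟨part (rep X mu) i, h⟩)) else 0

/-- The substitution `x = b_μ`. All entries of `b_μ` after the first `(rep X mu).card` ones are `0`, so
that number of variables is enough. -/
def localizationAt (X : ClType) (mu : SP) : GGammaR X →ₐ[CoefRing] CoefRing :=
  evalAt X (rep X mu).card (fun i => bSeq X mu i)

/-- The algebraic localization map `Φ : GΓ_𝓡^X → Fun(SP, 𝓡)`. -/
def localization (X : ClType) : GGammaR X →ₐ[CoefRing] (SP → CoefRing) :=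
  AlgHom.pi fun mu => localizationAt X mu

end

end KGKM

/-! At distinct points of a field, `GX_λ` depends only on the set S of points: it is a
Hall–Littlewood type sum `hsum` over the injective choices of a point of S for each part of λ. All
identities are proved for `hsum` and reach polynomials and `𝓡` through generic points. Three
mechanisms carry the proof. The factor (a ⊕ c)/(a ⊖ c) vanishes at c = ⊖a, and its values at c = x
and c = ⊖x multiply to 1, so a pair x, ⊖x can be removed from S (`hsum_insert_pair`). If the leading
entries vanish on T, the factors coming from T can be absorbed into these entries
(`hsum_append_linear`). Sums with a single entry are computed by Lagrange interpolation in the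
coordinate 1 + βa, which turns ⊕ into multiplication.

Existence of `GX_λ`: a Vandermonde product times `hsum` is an alternating polynomial, so `hsum` is a
polynomial (`exists_polynomial_hsum`). Removal of pairs is the Q-cancellation property. It also
gives stability when two variables are set to 0, so the even numbers of variables determine an
element of `GΓ`; if the entries are divisible by x ⊕ x, as in type C, the element lies in `GΓ₊`.
Expanding entries with coefficients in `𝓡` into monomials yields the element `gx`
(`exists_represents`).

GKM condition: by symmetry the entry b_ī of b_μ may be put at the place i. A reflection then
exchanges two places, or toggles two places, or toggles one; the required divisibility follows from
symmetry, from Q-cancellation, and from divisibility by x (or by x ⊕ x in type C).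

Injectivity: up to a unit, an element of `GΓ_𝓡` is a polynomial in finitely many b_i over `GΓ`. If
all parts of `rep X μ` exceed the indices that occur, the entries of b_μ act as independent
variables (`eval_level_eq_zero`). Injectivity also makes `GX_λ` unique.

Schubert classes: the localization of `GX_λ` at μ is an `hsum` with entries indexed by `rep X λ`
over the points b_ī, i ∈ `rep X μ` (`localizationAt_gx`), in the same form for all three types. In
s_i(ψ(s_i μ)) the entries are twisted by s_i. The points do not change for i ≥ 1; for the index 0
the effect is that of adding b_1 (types B, C) or b_1 and b_2 (type D). For i ≥ 1 only the entries of
i + 1 and i matter: the twist produces the entry of s_i λ, or an additional term that is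
antisymmetric and drops out. For the index 0 the long entries absorb the new points and the one-row
identities treat the others. The Bruhat order enters only in comparing λ with s_i λ, where it is
decided by size (`SPle_act_iff`). Uniqueness is an induction on the size of μ: the divided
difference at s_i μ < μ determines the value at μ. -/

namespace KGKM

noncomputable section

open scoped Classical

/-! ### Hall–Littlewood type sums over finite subsets of a field -/

section HallLittlewood

variable {K : Type*} [Field K] [Algebra ZBeta K]

/-- The factor `(a ⊕ c) / (a ⊖ c)`. -/
def rr (a c : K) : K := oplus a c / ominus a c

theorem rr_eq (a c : K) : rr a c = oplus a c * (1 + beta K * c) / (a - c) := by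
  unfold rr ominus
  rw [div_div_eq_mul_div]

/-- The sum over all injective choices `a₁, …, a_r ∈ S` of
`∏ g_i(a_i) ∏ (a_i ⊕ c) / (a_i ⊖ c)`, where `c` runs through `S ∖ {a₁, …, a_i}`. -/
def hsum : List (K → K) → Finset K → K
  | [], _ => 1
  | g :: L, S => ∑ a ∈ S, g a * (∏ c ∈ S.erase a, rr a c) * hsum L (S.erase a)

@[simp] theorem hsum_nil (S : Finset K) : hsum [] S = 1 := rfl

theorem hsum_cons (g : K → K) (L : List (K → K)) (S : Finset K) :
    hsum (g :: L) S = ∑ a ∈ S, g a * (∏ c ∈ S.erase a, rr a c) * hsum L (S.erase a) := rfl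

theorem hsum_eq_zero_of_card_lt (L : List (K → K)) (S : Finset K) (h : S.card < L.length) :
    hsum L S = 0 := by
  induction L generalizing S with
  | nil => simp at h
  | cons g L ih =>
    rw [hsum_cons]
    refine Finset.sum_eq_zero fun a ha => ?_
    rw [ih, mul_zero]
    rw [Finset.card_erase_of_mem ha]
    have := Finset.card_pos.2 ⟨a, ha⟩
    simp only [List.length_cons] at h
    omega

theorem map_beta {S T : Type*} [CommRing S] [Algebra ZBeta S] [CommRing T] [Algebra ZBeta T]
    (φ : S →ₐ[ZBeta] T) : φ (beta S) = beta T := φ.commutes _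

theorem map_oplus {S T : Type*} [CommRing S] [Algebra ZBeta S] [CommRing T] [Algebra ZBeta T]
    (φ : S →ₐ[ZBeta] T) (x y : S) : φ (oplus x y) = oplus (φ x) (φ y) := by
  simp [oplus, map_beta]

theorem map_rr {E : Type*} [Field E] [Algebra ZBeta E] (φ : K →ₐ[ZBeta] E) (a c : K) :
    φ (rr a c) = rr (φ a) (φ c) := by
  simp [rr_eq, map_oplus, map_beta]

/-- A homomorphism of fields is injective, so it keeps the points distinct and commutes with the
choice of points. -/
theorem map_hsum {E : Type*} [Field E] [Algebra ZBeta E] (φ : K →ₐ[ZBeta] E)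
    {L : List (K → K)} {L' : List (E → E)} {S : Finset K}
    (h : List.Forall₂ (fun g g' => ∀ a ∈ S, φ (g a) = g' (φ a)) L L') :
    φ (hsum L S) = hsum L' (S.image φ) := by
  have hφ : Function.Injective φ := φ.toRingHom.injective
  induction L generalizing L' S with
  | nil => cases h; simp
  | cons g L ih =>
    cases h with
    | cons h1 h2 =>
      rw [hsum_cons, hsum_cons, map_sum, Finset.sum_image (fun a _ c _ hac => hφ hac)]
      refine Finset.sum_congr rfl fun a ha => ?_
      rw [map_mul, map_mul, h1 a ha, map_prod, ← Finset.image_erase hφ,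
        Finset.prod_image (fun a _ c _ hac => hφ hac)]
      rw [ih (h2.imp fun g g' hg c hc => hg c (Finset.mem_of_mem_erase hc))]
      simp only [map_rr]

/-- The prefix entries vanish on T, so they choose points of S only; each choice a then carries the
extra factor ∏ `rr a z`, z ∈ T, which is what distinguishes L' from L. Thus a relation between the
tails passes to the full lists. The cardinality condition on S' lets the tail relation depend on the
parity of S'. -/
theorem hsum_append_linear {T : Finset K} {L L' M₁ M₂ M₃ : List (K → K)} {c₁ c₂ c₃ : K}
    {S : Finset K} (hd : Disjoint S T)
    (hL : List.Forall₂ (fun g g' => (∀ z ∈ T, g z = 0) ∧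
      ∀ a ∈ S, g' a = g a * ∏ z ∈ T, rr a z) L L')
    (h : ∀ S' ⊆ S, S'.card + L.length = S.card →
      c₁ * hsum M₁ (S' ∪ T) + c₂ * hsum M₂ S' + c₃ * hsum M₃ S' = 0) :
    c₁ * hsum (L ++ M₁) (S ∪ T) + c₂ * hsum (L' ++ M₂) S + c₃ * hsum (L' ++ M₃) S = 0 := by
  induction L generalizing L' S with
  | nil => cases hL; exact h S subset_rfl (by simp)
  | cons g L ih =>
    cases hL with
    | @cons _ g' _ L' h1 h2 =>
      simp only [List.cons_append, hsum_cons]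
      -- Choices from T contribute nothing.
      rw [Finset.sum_union hd, Finset.sum_eq_zero (s := T) fun z hz => by rw [h1.1 z hz]; ring]
      rw [add_zero, Finset.mul_sum, Finset.mul_sum, Finset.mul_sum, ← Finset.sum_add_distrib,
        ← Finset.sum_add_distrib]
      refine Finset.sum_eq_zero fun a ha => ?_
      have haT : a ∉ T := Finset.disjoint_left.1 hd ha
      have hd' : Disjoint (S.erase a) T := hd.mono_left (Finset.erase_subset _ _)
      have := ih (S := S.erase a) (L' := L') hd'
        (h2.imp fun g g' hg => ⟨hg.1, fun c hc => hg.2 c (Finset.mem_of_mem_erase hc)⟩)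
        (fun S' hS' hc => h S' (hS'.trans (Finset.erase_subset _ _)) (by
          rw [Finset.card_erase_of_mem ha] at hc
          have := Finset.card_pos.2 ⟨a, ha⟩
          simp only [List.length_cons]
          omega))
      rw [Finset.erase_union_distrib, Finset.erase_eq_of_notMem haT,
        Finset.prod_union hd', h1.2 a ha]
      linear_combination g a * (∏ c ∈ S.erase a, rr a c) * (∏ z ∈ T, rr a z) * this

theorem forall₂_vanish_empty (L : List (K → K)) (S : Finset K) :
    List.Forall₂ (fun g g' => (∀ z ∈ (∅ : Finset K), g z = 0) ∧
      ∀ a ∈ S, g' a = g a * ∏ z ∈ (∅ : Finset K), rr a z) L L := by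
  refine List.forall₂_same.2 fun g _ => by simp

/-- Linear relations persist under adding a common prefix. -/
theorem hsum_prefix_linear (L : List (K → K)) {M₁ M₂ M₃ : List (K → K)} {c₁ c₂ c₃ : K}
    {S : Finset K}
    (h : ∀ S' ⊆ S, S'.card + L.length = S.card →
      c₁ * hsum M₁ S' + c₂ * hsum M₂ S' + c₃ * hsum M₃ S' = 0) :
    c₁ * hsum (L ++ M₁) S + c₂ * hsum (L ++ M₂) S + c₃ * hsum (L ++ M₃) S = 0 := by
  simpa using hsum_append_linear (T := ∅) (Finset.disjoint_empty_right S)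
    (forall₂_vanish_empty L S) (fun S' hS' hc => by simpa using h S' hS' hc)

/-- Multilinearity. -/
theorem hsum_linear (L M : List (K → K)) {f g k : K → K} {c d : K} {S : Finset K}
    (h : ∀ a ∈ S, f a = c * g a + d * k a) :
    hsum (L ++ f :: M) S = c * hsum (L ++ g :: M) S + d * hsum (L ++ k :: M) S := by
  have := hsum_prefix_linear L (M₁ := f :: M) (M₂ := g :: M) (M₃ := k :: M) (c₁ := 1) (c₂ := -c)
    (c₃ := -d) (S := S) fun S' hS' _ => by
      simp only [hsum_cons, Finset.mul_sum, ← Finset.sum_add_distrib]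
      refine Finset.sum_eq_zero fun a ha => ?_
      rw [h a (hS' ha)]
      ring
  linear_combination this

theorem hsum_append_congr {L M₁ M₂ : List (K → K)} {S : Finset K}
    (h : ∀ S' ⊆ S, S'.card + L.length = S.card → hsum M₁ S' = hsum M₂ S') :
    hsum (L ++ M₁) S = hsum (L ++ M₂) S := by
  have := hsum_prefix_linear L (M₁ := M₁) (M₂ := M₂) (M₃ := []) (c₁ := 1) (c₂ := -1)
    (c₃ := 0) (S := S) fun S' hS' hc => by rw [h S' hS' hc]; ring
  linear_combination this

/-- The contributions of two adjacent entries cancel if they are antisymmetric. -/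
theorem hsum_antisymm [CharZero K] (L M : List (K → K)) {g k : K → K} {S : Finset K}
    (h : ∀ a ∈ S, ∀ c ∈ S, a ≠ c → g a * k c * rr a c + g c * k a * rr c a = 0) :
    hsum (L ++ g :: k :: M) S = 0 := by
  have key : ∀ S' ⊆ S, hsum (g :: k :: M) S' = 0 := by
    intro S' hS'
    set F : K → K → K := fun a c => g a * k c * rr a c *
      ((∏ d ∈ (S'.erase a).erase c, rr a d) * (∏ d ∈ (S'.erase a).erase c, rr c d) *
        hsum M ((S'.erase a).erase c)) with hF
    have e1 : hsum (g :: k :: M) S' = ∑ a ∈ S', ∑ c ∈ S', if a = c then 0 else F a c := by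
      rw [hsum_cons]
      refine Finset.sum_congr rfl fun a ha => ?_
      rw [hsum_cons, Finset.mul_sum]
      rw [← Finset.sum_erase S' (a := a) (f := fun c => if a = c then 0 else F a c) (by simp)]
      refine Finset.sum_congr rfl fun c hc => ?_
      rw [if_neg (Finset.ne_of_mem_erase hc).symm, hF, ← Finset.mul_prod_erase _ _ hc]
      ring
    have e2 : hsum (g :: k :: M) S' = ∑ a ∈ S', ∑ c ∈ S', if a = c then 0 else F c a := by
      rw [e1, Finset.sum_comm]
      simp only [eq_comm]
    -- Adding the sum to its copy with a and c exchanged groups terms that share all factors except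
    -- the antisymmetric one.
    have e3 : hsum (g :: k :: M) S' + hsum (g :: k :: M) S' = 0 := by
      nth_rewrite 2 [e2]
      rw [e1, ← Finset.sum_add_distrib]
      refine Finset.sum_eq_zero fun a ha => ?_
      rw [← Finset.sum_add_distrib]
      refine Finset.sum_eq_zero fun c hc => ?_
      by_cases hac : a = c
      · simp [hac]
      · rw [if_neg hac, if_neg hac, hF]
        simp only
        rw [Finset.erase_right_comm (a := c)]
        linear_combination ((∏ d ∈ (S'.erase a).erase c, rr a d) *
          (∏ d ∈ (S'.erase a).erase c, rr c d) * hsum M ((S'.erase a).erase c)) *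
          h a (hS' ha) c (hS' hc) hac
    exact self_eq_neg.1 (eq_neg_of_add_eq_zero_left e3)
  have := hsum_prefix_linear L (M₁ := g :: k :: M) (M₂ := []) (M₃ := []) (c₁ := 1) (c₂ := 0)
    (c₃ := 0) (S := S) fun S' hS' _ => by rw [key S' hS']; ring
  linear_combination this

/-- As y = ⊖x, the numerator a ⊕ x is a multiple of a - y and a ⊕ y is a multiple of a - x: each
numerator cancels the denominator of the other factor. -/
theorem rr_mul_rr {a x y : K} (hxy : oplus x y = 0) (hx : a ≠ x) (hy : a ≠ y) :
    rr a x * rr a y = 1 := by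
  have e1 : oplus a x = (a - y) * (1 + beta K * x) := by
    unfold oplus at *; linear_combination hxy
  have e2 : oplus a y = (a - x) * (1 + beta K * y) := by
    unfold oplus at *; linear_combination hxy
  have e3 : (1 + beta K * x) * (1 + beta K * y) = 1 := by
    unfold oplus at *; linear_combination beta K * hxy
  rw [rr_eq, rr_eq, e1, e2]
  have h1 := sub_ne_zero.2 hx
  have h2 := sub_ne_zero.2 hy
  field_simp
  linear_combination ((1 + beta K * x) * (1 + beta K * y) + 1) * e3

/-- The case ⊖z = z, where the factor cancels with itself. It applies to z = 0 and to z = -2/β. -/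
theorem rr_eq_one {a z : K} (hz : oplus z z = 0) (h : a ≠ z) : rr a z = 1 := by
  have e1 : oplus a z = (a - z) * (1 + beta K * z) := by
    unfold oplus at *; linear_combination hz
  have e3 : (1 + beta K * z) * (1 + beta K * z) = 1 := by
    unfold oplus at *; linear_combination beta K * hz
  rw [rr_eq, e1, div_eq_one_iff_eq (sub_ne_zero.2 h)]
  linear_combination (a - z) * e3

theorem rr_eq_zero {x y : K} (hxy : oplus x y = 0) : rr x y = 0 := by
  rw [rr, hxy, zero_div]

/-- Two points that are inverse to each other for `⊕` can be removed. -/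
theorem hsum_insert_pair {x y : K} (hxy : oplus x y = 0) (hne : x ≠ y) (L : List (K → K))
    {S : Finset K} (hx : x ∉ S) (hy : y ∉ S) :
    hsum L (insert x (insert y S)) = hsum L S := by
  induction L generalizing S with
  | nil => rfl
  | cons g L ih =>
    have hyx : oplus y x = 0 := by rw [oplus_comm, hxy]
    -- Choosing x brings the factor `rr x y` = 0, and choosing y brings `rr y x` = 0.
    rw [hsum_cons, Finset.sum_insert (by simp [hne, hx]), Finset.sum_insert hy,
      Finset.prod_eq_zero (i := y) (by simp [hne.symm]) (rr_eq_zero hxy),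
      Finset.prod_eq_zero (i := x) (by simp [hne]) (rr_eq_zero hyx)]
    simp only [mul_zero, zero_mul, zero_add, hsum_cons]
    refine Finset.sum_congr rfl fun a ha => ?_
    have hax : a ≠ x := fun h => hx (h ▸ ha)
    have hay : a ≠ y := fun h => hy (h ▸ ha)
    rw [Finset.erase_insert_of_ne hax.symm, Finset.erase_insert_of_ne hay.symm,
      ih (fun h => hx (Finset.mem_of_mem_erase h)) (fun h => hy (Finset.mem_of_mem_erase h)),
      Finset.prod_insert (by simp [hne, hx]), Finset.prod_insert (by simp [hy]),
      ← mul_assoc (rr a x), rr_mul_rr hxy hax hay, one_mul]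

/-- A point `z` with `z ⊕ z = 0` at which all entries vanish can be removed. -/
theorem hsum_insert_self_inverse {z : K} (hz : oplus z z = 0) (L : List (K → K))
    (hL : ∀ g ∈ L, g z = 0) {S : Finset K} (hzS : z ∉ S) :
    hsum L (insert z S) = hsum L S := by
  have h := hsum_append_linear (T := {z}) (S := S) (L := L) (L' := L) (M₁ := []) (M₂ := [])
    (M₃ := []) (c₁ := 1) (c₂ := -1) (c₃ := 0) (by simpa using hzS)
    (List.forall₂_same.2 fun g hg => ⟨by simpa using hL g hg, fun a ha => by
      rw [Finset.prod_singleton, rr_eq_one hz fun h => hzS (h ▸ ha), mul_one]⟩)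
    (fun S' _ _ => by simp)
  rw [Finset.insert_eq, Finset.union_comm]
  simp only [List.append_nil] at h
  linear_combination h

/-! ### One-row identities -/

/-- The top coefficient of the Lagrange interpolation polynomial with nodes U ∪ T. The nodes U will
be the points of a one-row sum, and T the few extra poles of its weight. -/
theorem sum_lagrange_split {F : Type*} [Field F] {U T : Finset F} (hd : Disjoint U T)
    {f : Polynomial F} (hf : f.degree < (U.card + T.card : ℕ)) :
    (∑ a ∈ U, f.eval a / ((∏ c ∈ U.erase a, (a - c)) * ∏ t ∈ T, (a - t))) +
      ∑ t ∈ T, f.eval t / ((∏ c ∈ U, (t - c)) * ∏ u ∈ T.erase t, (t - u)) =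
    f.coeff (U.card + T.card - 1) := by
  have hcard := Finset.card_union_of_disjoint hd
  rw [← hcard] at hf ⊢
  rw [Lagrange.coeff_eq_sum (s := U ∪ T) (v := id) Function.injective_id.injOn hf,
    Finset.sum_union hd]
  congr 1
  · refine Finset.sum_congr rfl fun a ha => ?_
    have : a ∉ T := Finset.disjoint_left.1 hd ha
    rw [Finset.erase_union_distrib, Finset.erase_eq_of_notMem this,
      Finset.prod_union (hd.mono_left (Finset.erase_subset _ _))]
    rfl
  · refine Finset.sum_congr rfl fun a ha => ?_
    have : a ∉ U := Finset.disjoint_right.1 hd ha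
    rw [Finset.erase_union_distrib, Finset.erase_eq_of_notMem this,
      Finset.prod_union (hd.mono_right (Finset.erase_subset _ _))]
    rfl

/-- The polynomial `∏_{c ∈ U} (c z - 1)`. -/
def nodePoly {F : Type*} [Field F] (U : Finset F) : Polynomial F :=
  ∏ c ∈ U, (Polynomial.C c * Polynomial.X + Polynomial.C (-1))

theorem eval_nodePoly {F : Type*} [Field F] (U : Finset F) (z : F) :
    (nodePoly U).eval z = ∏ c ∈ U, (c * z - 1) := by
  simp [nodePoly, Polynomial.eval_prod, sub_eq_add_neg]

theorem natDegree_nodePoly_le {F : Type*} [Field F] (U : Finset F) :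
    (nodePoly U).natDegree ≤ U.card := by
  refine (Polynomial.natDegree_prod_le _ _).trans ?_
  refine (Finset.sum_le_card_nsmul _ _ 1 fun c _ => Polynomial.natDegree_linear_le).trans ?_
  simp

theorem degree_nodePoly_lt {F : Type*} [Field F] (U : Finset F) {m : ℕ} (hm : 0 < m) :
    (nodePoly U).degree < (U.card + m : ℕ) := by
  refine lt_of_le_of_lt Polynomial.degree_le_natDegree ?_
  have := natDegree_nodePoly_le U
  exact_mod_cast by omega

theorem coeff_card_nodePoly {F : Type*} [Field F] (U : Finset F) :
    (nodePoly U).coeff U.card = ∏ c ∈ U, c := by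
  have := Polynomial.coeff_prod_of_natDegree_le U
    (fun c : F => Polynomial.C c * Polynomial.X + Polynomial.C (-1)) 1
    (fun c _ => Polynomial.natDegree_linear_le)
  rw [mul_one] at this
  rw [nodePoly, this]
  refine Finset.prod_congr rfl fun c _ => ?_
  rw [Polynomial.coeff_add, Polynomial.coeff_C_mul, Polynomial.coeff_X_one,
    Polynomial.coeff_C_of_ne_zero one_ne_zero, mul_one, add_zero]

theorem coeff_nodePoly_of_lt {F : Type*} [Field F] (U : Finset F) {m : ℕ} (hm : U.card < m) :
    (nodePoly U).coeff m = 0 :=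
  Polynomial.coeff_eq_zero_of_natDegree_lt ((natDegree_nodePoly_le U).trans_lt hm)

/-- At a node, `nodePoly` gives the numerator of the product of the factors `rr`, times a² - 1. This
unwanted factor is what the extra nodes 1 and -1 serve to cancel. -/
theorem eval_nodePoly_mem {F : Type*} [Field F] {U : Finset F} {a : F} (ha : a ∈ U) :
    (nodePoly U).eval a = (a * a - 1) * ∏ c ∈ U.erase a, (c * a - 1) := by
  rw [eval_nodePoly, ← Finset.mul_prod_erase _ _ ha]

theorem eval_nodePoly_zero {F : Type*} [Field F] {U : Finset F} (h0 : ∀ c ∈ U, c ≠ 0) :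
    (nodePoly U).eval 0 / (∏ c ∈ U, (0 - c)) = (∏ c ∈ U, c)⁻¹ := by
  rw [eval_nodePoly, ← Finset.prod_div_distrib, ← Finset.prod_inv_distrib]
  refine Finset.prod_congr rfl fun c hc => ?_
  have := h0 c hc
  field_simp
  ring

theorem eval_nodePoly_one {F : Type*} [Field F] {U : Finset F} (h1 : ∀ c ∈ U, c ≠ 1) :
    (nodePoly U).eval 1 / (∏ c ∈ U, (1 - c)) = (-1) ^ U.card := by
  rw [eval_nodePoly, ← Finset.prod_div_distrib, ← Finset.prod_const]
  refine Finset.prod_congr rfl fun c hc => ?_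
  have : (1 : F) - c ≠ 0 := sub_ne_zero.2 (h1 c hc).symm
  rw [div_eq_iff this]
  ring

theorem eval_nodePoly_neg_one {F : Type*} [Field F] {U : Finset F} (h1 : ∀ c ∈ U, c ≠ -1) :
    (nodePoly U).eval (-1) / (∏ c ∈ U, (-1 - c)) = 1 := by
  rw [eval_nodePoly, ← Finset.prod_div_distrib]
  refine Finset.prod_eq_one fun c hc => ?_
  have : (-1 : F) - c ≠ 0 := sub_ne_zero.2 (h1 c hc).symm
  rw [div_eq_iff this]
  ring

section OneRow

variable (hβ : beta K ≠ 0)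
include hβ

/-- With A = 1 + βa and C = 1 + βc one has β(a ⊕ c) = AC - 1 and β(a - c) = A - C, so `rr a c` =
C(AC - 1)/(A - C). -/
theorem prod_rr_eq {S : Finset K} {a : K} :
    ∏ c ∈ S.erase a, rr a c = (∏ c ∈ S.erase a, (1 + beta K * c)) *
      (∏ c ∈ S.erase a, ((1 + beta K * c) * (1 + beta K * a) - 1)) /
      ∏ c ∈ S.erase a, ((1 + beta K * a) - (1 + beta K * c)) := by
  rw [← Finset.prod_mul_distrib, ← Finset.prod_div_distrib]
  refine Finset.prod_congr rfl fun c hc => ?_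
  have h := sub_ne_zero.2 (Finset.ne_of_mem_erase hc).symm
  have h' : (1 + beta K * a) - (1 + beta K * c) ≠ 0 := by
    rw [show (1 + beta K * a) - (1 + beta K * c) = beta K * (a - c) by ring]
    exact mul_ne_zero hβ h
  rw [rr_eq, div_eq_div_iff h h', oplus]
  ring

theorem injective_one_add_beta_mul : Function.Injective fun a : K => 1 + beta K * a :=
  fun _ _ h => mul_left_cancel₀ hβ (add_left_cancel h)

/-- The factors C over c ≠ a are completed to the product over all of S; this costs the division of
the weight by A. -/
theorem sum_weight_prod_rr (S : Finset K) (h0 : ∀ a ∈ S, 1 + beta K * a ≠ 0) (w : K → K) :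
    ∑ a ∈ S, w (1 + beta K * a) * ∏ c ∈ S.erase a, rr a c =
      (∏ c ∈ S, (1 + beta K * c)) * ∑ a ∈ S.image fun a => 1 + beta K * a, w a / a *
        ((∏ c ∈ (S.image fun a => 1 + beta K * a).erase a, (c * a - 1)) /
          ∏ c ∈ (S.image fun a => 1 + beta K * a).erase a, (a - c)) := by
  have hinj := injective_one_add_beta_mul hβ
  rw [Finset.sum_image (fun a _ c _ h => hinj h), Finset.mul_sum]
  refine Finset.sum_congr rfl fun a ha => ?_
  have e := Finset.image_erase hinj S a
  rw [← e, Finset.prod_image (fun a _ c _ h => hinj h),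
    Finset.prod_image (fun a _ c _ h => hinj h), prod_rr_eq hβ, ← Finset.mul_prod_erase _ _ ha]
  have := h0 a ha
  field_simp

/-- In the variable u = 1 + βa the weight is (u - 1)/(βu) = (u² - 1)/(βu(u + 1)), so the extra nodes
are 0 and -1. The interpolation coefficient is 0 for degree reasons, and the two extra nodes give
the value. -/
theorem sum_mul_prod_rr (S : Finset K) (h0 : ∀ a ∈ S, 1 + beta K * a ≠ 0)
    (h1 : ∀ a ∈ S, oplus a a ≠ 0) :
    ∑ a ∈ S, a * ∏ c ∈ S.erase a, rr a c = (∏ c ∈ S, (1 + beta K * c) - 1) / beta K := by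
  have hinj := injective_one_add_beta_mul hβ
  have e := sum_weight_prod_rr hβ S h0 fun y => (y - 1) / beta K
  have e1 : ∀ a : K, (1 + beta K * a - 1) / beta K = a := fun a => by field_simp; ring
  simp only [e1] at e
  rw [e]
  set U := S.image fun a => 1 + beta K * a with hU
  have hprod : ∏ c ∈ U, c = ∏ c ∈ S, (1 + beta K * c) :=
    Finset.prod_image (fun a _ c _ h => hinj h)
  have hU0 : ∀ c ∈ U, c ≠ 0 := by
    intro c hc
    obtain ⟨a, ha, rfl⟩ := Finset.mem_image.1 hc
    exact h0 a ha
  have hUm : ∀ c ∈ U, c ≠ -1 := by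
    intro c hc
    obtain ⟨a, ha, rfl⟩ := Finset.mem_image.1 hc
    refine fun h => h1 a ha ?_
    have : beta K * oplus a a = 0 := by
      unfold oplus; linear_combination (beta K * a) * h
    exact (mul_eq_zero.1 this).resolve_left hβ
  have hne : (0 : K) ≠ -1 := by simp
  have hd : Disjoint U {0, -1} := by
    rw [Finset.disjoint_left]
    intro c hc hc'
    rcases Finset.mem_insert.1 hc' with h | h
    · exact hU0 c hc h
    · exact hUm c hc (Finset.mem_singleton.1 h)
  have hcard : ({0, -1} : Finset K).card = 2 := Finset.card_pair hne
  have key := sum_lagrange_split hd (f := nodePoly U) (degree_nodePoly_lt U (by rw [hcard]; omega))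
  rw [coeff_nodePoly_of_lt U (by rw [hcard]; omega), Finset.sum_pair hne] at key
  have z1 : ({0, -1} : Finset K).erase 0 = {-1} := by
    rw [Finset.erase_insert (by simp)]
  have z2 : ({0, -1} : Finset K).erase (-1) = {0} := by
    rw [Finset.pair_comm, Finset.erase_insert (by simp)]
  rw [z1, z2, Finset.prod_singleton, Finset.prod_singleton, ← div_div, ← div_div,
    eval_nodePoly_zero hU0, eval_nodePoly_neg_one hUm, hprod] at key
  have e2 : ∑ a ∈ U, (a - 1) / beta K / a *
        ((∏ c ∈ U.erase a, (c * a - 1)) / ∏ c ∈ U.erase a, (a - c)) =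
      (beta K)⁻¹ * ∑ a ∈ U, (nodePoly U).eval a /
        ((∏ c ∈ U.erase a, (a - c)) * ∏ t ∈ ({0, -1} : Finset K), (a - t)) := by
    rw [Finset.mul_sum]
    refine Finset.sum_congr rfl fun a ha => ?_
    rw [eval_nodePoly_mem ha, Finset.prod_pair hne]
    have h3 : a - -1 ≠ 0 := sub_ne_zero.2 (hUm a ha)
    have h4 : a - 0 ≠ 0 := sub_ne_zero.2 (hU0 a ha)
    have h5 := hU0 a ha
    have h6 : ∏ c ∈ U.erase a, (a - c) ≠ 0 :=
      Finset.prod_ne_zero_iff.2 fun c hc => sub_ne_zero.2 (Finset.ne_of_mem_erase hc).symm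
    field_simp
    ring
  rw [e2, eq_neg_of_add_eq_zero_left key]
  have h7 : ∏ c ∈ S, (1 + beta K * c) ≠ 0 := Finset.prod_ne_zero_iff.2 h0
  field_simp
  ring

/-- Here β(a ⊕ a) = u² - 1 is precisely the unwanted factor of `nodePoly`, and 0 is the only extra
node. The interpolation coefficient is now the leading coefficient ∏ u, which accounts for the
square. -/
theorem sum_oplus_self_prod_rr (S : Finset K) (h0 : ∀ a ∈ S, 1 + beta K * a ≠ 0) :
    ∑ a ∈ S, oplus a a * ∏ c ∈ S.erase a, rr a c =
      ((∏ c ∈ S, (1 + beta K * c)) ^ 2 - 1) / beta K := by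
  have hinj := injective_one_add_beta_mul hβ
  have e := sum_weight_prod_rr hβ S h0 fun y => (y * y - 1) / beta K
  have e1 : ∀ a : K, ((1 + beta K * a) * (1 + beta K * a) - 1) / beta K = oplus a a :=
    fun a => by unfold oplus; field_simp; ring
  simp only [e1] at e
  rw [e]
  set U := S.image fun a => 1 + beta K * a with hU
  have hprod : ∏ c ∈ U, c = ∏ c ∈ S, (1 + beta K * c) :=
    Finset.prod_image (fun a _ c _ h => hinj h)
  have hU0 : ∀ c ∈ U, c ≠ 0 := by
    intro c hc
    obtain ⟨a, ha, rfl⟩ := Finset.mem_image.1 hc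
    exact h0 a ha
  have hd : Disjoint U {0} := by
    rw [Finset.disjoint_singleton_right]
    exact fun h => hU0 0 h rfl
  have key := sum_lagrange_split hd (f := nodePoly U) (degree_nodePoly_lt U (by simp))
  rw [Finset.card_singleton, Nat.add_sub_cancel, coeff_card_nodePoly, Finset.sum_singleton,
    Finset.erase_singleton, Finset.prod_empty, mul_one, eval_nodePoly_zero hU0, hprod] at key
  have e2 : ∑ a ∈ U, (a * a - 1) / beta K / a *
        ((∏ c ∈ U.erase a, (c * a - 1)) / ∏ c ∈ U.erase a, (a - c)) =
      (beta K)⁻¹ * ∑ a ∈ U, (nodePoly U).eval a /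
        ((∏ c ∈ U.erase a, (a - c)) * ∏ t ∈ ({0} : Finset K), (a - t)) := by
    rw [Finset.mul_sum]
    refine Finset.sum_congr rfl fun a ha => ?_
    rw [eval_nodePoly_mem ha, Finset.prod_singleton, sub_zero]
    have h5 := hU0 a ha
    have h6 : ∏ c ∈ U.erase a, (a - c) ≠ 0 :=
      Finset.prod_ne_zero_iff.2 fun c hc => sub_ne_zero.2 (Finset.ne_of_mem_erase hc).symm
    field_simp
  rw [e2, eq_sub_of_add_eq key]
  have h7 : ∏ c ∈ S, (1 + beta K * c) ≠ 0 := Finset.prod_ne_zero_iff.2 h0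
  field_simp

/-- The weight is 1/u = (u² - 1)/(u(u - 1)(u + 1)), with extra nodes 0, 1 and -1. The parity of S
enters through the value of `nodePoly` at 1; the factor 2 comes from the distance of the nodes 1 and
-1. -/
theorem two_mul_sum_prod_rr [CharZero K] (S : Finset K) (h0 : ∀ a ∈ S, 1 + beta K * a ≠ 0)
    (h1 : ∀ a ∈ S, oplus a a ≠ 0) : 2 * ∑ a ∈ S, ∏ c ∈ S.erase a, rr a c =
      2 - (∏ c ∈ S, (1 + beta K * c)) * (1 + (-1) ^ S.card) := by
  have hinj := injective_one_add_beta_mul hβ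
  have e := sum_weight_prod_rr hβ S h0 fun y => 1
  simp only [one_mul] at e
  rw [e]
  set U := S.image fun a => 1 + beta K * a with hU
  have hprod : ∏ c ∈ U, c = ∏ c ∈ S, (1 + beta K * c) :=
    Finset.prod_image (fun a _ c _ h => hinj h)
  have hU0 : ∀ c ∈ U, c ≠ 0 := by
    intro c hc
    obtain ⟨a, ha, rfl⟩ := Finset.mem_image.1 hc
    exact h0 a ha
  have hUm : ∀ c ∈ U, c ≠ -1 := by
    intro c hc
    obtain ⟨a, ha, rfl⟩ := Finset.mem_image.1 hc
    refine fun h => h1 a ha ?_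
    have : beta K * oplus a a = 0 := by
      unfold oplus; linear_combination (beta K * a) * h
    exact (mul_eq_zero.1 this).resolve_left hβ
  have hU1 : ∀ c ∈ U, c ≠ 1 := by
    intro c hc
    obtain ⟨a, ha, rfl⟩ := Finset.mem_image.1 hc
    refine fun h => h1 a ha ?_
    have : beta K * oplus a a = 0 := by
      unfold oplus; linear_combination (beta K * a + 2) * h
    exact (mul_eq_zero.1 this).resolve_left hβ
  have hn1 : (0 : K) ≠ -1 := by simp
  have hn2 : (0 : K) ≠ 1 := by simp
  have hn3 : (1 : K) ≠ -1 := by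
    intro h
    have : (2 : K) = 0 := by linear_combination h
    exact two_ne_zero this
  have hm1 : (0 : K) ∉ ({1, -1} : Finset K) := by simp
  have hd : Disjoint U {0, 1, -1} := by
    rw [Finset.disjoint_left]
    intro c hc hc'
    simp only [Finset.mem_insert, Finset.mem_singleton] at hc'
    rcases hc' with h | h | h
    · exact hU0 c hc h
    · exact hU1 c hc h
    · exact hUm c hc h
  have hcard : ({0, 1, -1} : Finset K).card = 3 := by
    rw [Finset.card_insert_of_notMem hm1, Finset.card_pair hn3]
  have key := sum_lagrange_split hd (f := nodePoly U) (degree_nodePoly_lt U (by rw [hcard]; omega))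
  rw [coeff_nodePoly_of_lt U (by rw [hcard]; omega), Finset.sum_insert hm1,
    Finset.sum_pair hn3] at key
  have z1 : ({0, 1, -1} : Finset K).erase 0 = {1, -1} := Finset.erase_insert hm1
  have z2 : ({0, 1, -1} : Finset K).erase 1 = {0, -1} := by
    ext x; simp only [Finset.mem_erase, Finset.mem_insert, Finset.mem_singleton]
    constructor
    · tauto
    · rintro (rfl | rfl) <;> simp [hn2, hn3.symm]
  have z3 : ({0, 1, -1} : Finset K).erase (-1) = {0, 1} := by
    ext x; simp only [Finset.mem_erase, Finset.mem_insert, Finset.mem_singleton]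
    constructor
    · tauto
    · rintro (rfl | rfl) <;> simp [hn1, hn3]
  have hcU : U.card = S.card := Finset.card_image_of_injective _ hinj
  rw [z1, z2, z3, Finset.prod_pair hn3, Finset.prod_pair hn1, Finset.prod_pair hn2, ← div_div (Polynomial.eval 0 _),
    ← div_div (Polynomial.eval 1 _), ← div_div (Polynomial.eval (-1) _), eval_nodePoly_zero hU0, eval_nodePoly_one hU1,
    eval_nodePoly_neg_one hUm, hprod, hcU] at key
  have e2 : ∑ a ∈ U, 1 / a *
        ((∏ c ∈ U.erase a, (c * a - 1)) / ∏ c ∈ U.erase a, (a - c)) =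
      ∑ a ∈ U, (nodePoly U).eval a /
        ((∏ c ∈ U.erase a, (a - c)) * ∏ t ∈ ({0, 1, -1} : Finset K), (a - t)) := by
    refine Finset.sum_congr rfl fun a ha => ?_
    rw [eval_nodePoly_mem ha, Finset.prod_insert hm1, Finset.prod_pair hn3]
    have h3 : a - -1 ≠ 0 := sub_ne_zero.2 (hUm a ha)
    have h4 : a - 0 ≠ 0 := sub_ne_zero.2 (hU0 a ha)
    have h4' : a - 1 ≠ 0 := sub_ne_zero.2 (hU1 a ha)
    have h5 := hU0 a ha
    have h6 : ∏ c ∈ U.erase a, (a - c) ≠ 0 :=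
      Finset.prod_ne_zero_iff.2 fun c hc => sub_ne_zero.2 (Finset.ne_of_mem_erase hc).symm
    field_simp
    ring
  rw [e2, eq_neg_of_add_eq_zero_left key]
  have h7 : ∏ c ∈ S, (1 + beta K * c) ≠ 0 := Finset.prod_ne_zero_iff.2 h0
  have h8 : (2 : K) ≠ 0 := two_ne_zero
  have h9 : (1 : K) - -1 ≠ 0 := sub_ne_zero.2 hn3
  have h10 : (-1 : K) - 1 ≠ 0 := sub_ne_zero.2 hn3.symm
  field_simp
  ring

theorem sum_prod_rr_of_odd [CharZero K] (S : Finset K) (h0 : ∀ a ∈ S, 1 + beta K * a ≠ 0)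
    (h1 : ∀ a ∈ S, oplus a a ≠ 0) (hS : Odd S.card) :
    ∑ a ∈ S, ∏ c ∈ S.erase a, rr a c = 1 := by
  have h := two_mul_sum_prod_rr hβ S h0 h1
  rw [hS.neg_one_pow] at h
  exact mul_left_cancel₀ (two_ne_zero (α := K)) (by rw [h]; ring)

theorem sum_prod_rr_of_even [CharZero K] (S : Finset K) (h0 : ∀ a ∈ S, 1 + beta K * a ≠ 0)
    (h1 : ∀ a ∈ S, oplus a a ≠ 0) (hS : Even S.card) :
    ∑ a ∈ S, ∏ c ∈ S.erase a, rr a c = 1 - ∏ c ∈ S, (1 + beta K * c) := by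
  have h := two_mul_sum_prod_rr hβ S h0 h1
  rw [hS.neg_one_pow] at h
  exact mul_left_cancel₀ (two_ne_zero (α := K)) (by rw [h]; ring)

/-- Split a ⊕ w = (1 + βw)a + w and use the sums with weights a and 1. The dependence on w remains
for odd S and disappears for even S. -/
theorem sum_oplus_prod_rr_of_odd [CharZero K] (S : Finset K) (h0 : ∀ a ∈ S, 1 + beta K * a ≠ 0)
    (h1 : ∀ a ∈ S, oplus a a ≠ 0) (hS : Odd S.card) (w : K) :
    ∑ a ∈ S, oplus a w * ∏ c ∈ S.erase a, rr a c =
      ((1 + beta K * w) * ∏ c ∈ S, (1 + beta K * c) - 1) / beta K := by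
  have h : ∀ a ∈ S, oplus a w * ∏ c ∈ S.erase a, rr a c =
      (1 + beta K * w) * (a * ∏ c ∈ S.erase a, rr a c) + w * ∏ c ∈ S.erase a, rr a c := by
    intro a _; unfold oplus; ring
  rw [Finset.sum_congr rfl h, Finset.sum_add_distrib, ← Finset.mul_sum, ← Finset.mul_sum,
    sum_mul_prod_rr hβ S h0 h1, sum_prod_rr_of_odd hβ S h0 h1 hS]
  field_simp
  ring

theorem sum_oplus_prod_rr_of_even [CharZero K] (S : Finset K) (h0 : ∀ a ∈ S, 1 + beta K * a ≠ 0)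
    (h1 : ∀ a ∈ S, oplus a a ≠ 0) (hS : Even S.card) (w : K) :
    ∑ a ∈ S, oplus a w * ∏ c ∈ S.erase a, rr a c =
      (∏ c ∈ S, (1 + beta K * c) - 1) / beta K := by
  have h : ∀ a ∈ S, oplus a w * ∏ c ∈ S.erase a, rr a c =
      (1 + beta K * w) * (a * ∏ c ∈ S.erase a, rr a c) + w * ∏ c ∈ S.erase a, rr a c := by
    intro a _; unfold oplus; ring
  rw [Finset.sum_congr rfl h, Finset.sum_add_distrib, ← Finset.mul_sum, ← Finset.mul_sum,
    sum_mul_prod_rr hβ S h0 h1, sum_prod_rr_of_even hβ S h0 h1 hS]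
  field_simp
  ring

end OneRow

end HallLittlewood

/-- The set of values of a family of elements. -/
def pts {K : Type*} {n : ℕ} (y : Fin n → K) : Finset K := Finset.univ.image y

theorem pts_comp_equiv {K : Type*} {n : ℕ} (y : Fin n → K) (σ : Equiv.Perm (Fin n)) :
    pts (y ∘ σ) = pts y := by
  rw [pts, ← Finset.image_image, Finset.image_univ_equiv, pts]

/-! ### The symmetrization formula -/

section SymSum

theorem map_part {K : Type*} (la : SP) (f : ℕ → K → K) :
    (List.range la.card).map (fun i => f (part la i)) =
      (la.sort (· ≥ ·)).map fun p : ℕ+ => f p := by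
  refine List.ext_getElem (by simp) fun i h1 h2 => ?_
  simp only [List.getElem_map, List.getElem_range, part]
  rw [List.getD_eq_getElem _ _ (by simpa using h2)]
  simp

variable {K : Type*} [Field K] [Algebra ZBeta K]

/-- Permutations are sorted by the value at 0, which is the first chosen point. The factorial counts
the arrangements of the n - r points that no entry uses. -/
theorem sum_perm_eq_hsum (r : ℕ) : ∀ {n : ℕ} (g : ℕ → K → K) (x : Fin n → K)
    (_ : Function.Injective x) (_ : r ≤ n),
    ∑ w : Equiv.Perm (Fin n), ∏ i : Fin n with i.1 < r, (g i (x (w i)) *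
      ∏ j : Fin n with i < j, rr (x (w i)) (x (w j))) =
    ((n - r).factorial : ℕ) * hsum ((List.range r).map g) (Finset.univ.image x) := by
  induction r with
  | zero =>
    intro n g x _ _
    simp [Fintype.card_perm]
  | succ r ih =>
    intro n g x hx hr
    obtain ⟨m, rfl⟩ : ∃ m, n = m + 1 := ⟨n - 1, by omega⟩
    rw [List.range_succ_eq_map, List.map_cons, hsum_cons, Finset.sum_image fun a _ c _ h => hx h,
      ← Equiv.Perm.decomposeFin.symm.sum_comp, Fintype.sum_prod_type, Finset.mul_sum]
    refine Finset.sum_congr rfl fun p _ => ?_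
    -- `decomposeFin` writes a permutation with value p at 0 as a permutation of the other places
    -- followed by the transposition of 0 and p; x' lists the points other than x p in the resulting
    -- order.
    set x' : Fin m → K := fun i => x (Equiv.swap 0 p i.succ) with hx'
    have hinj : Function.Injective x' := fun i j h =>
      Fin.succ_injective _ ((Equiv.swap 0 p).injective (hx h))
    have himg : Finset.univ.image x' = (Finset.univ.image x).erase (x p) := by
      ext c
      simp only [hx', Finset.mem_image, Finset.mem_univ, true_and, Finset.mem_erase]
      constructor
      · rintro ⟨i, rfl⟩
        refine ⟨fun h => ?_, _, rfl⟩
        have h2 := hx h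
        rw [Equiv.swap_apply_eq_iff, Equiv.swap_apply_right] at h2
        exact Fin.succ_ne_zero _ h2
      · rintro ⟨h, j, rfl⟩
        have hj : Equiv.swap 0 p j ≠ 0 := fun h0 => h (by
          rw [Equiv.swap_apply_eq_iff, Equiv.swap_apply_left] at h0
          rw [h0])
        obtain ⟨i, hi⟩ := Fin.exists_succ_eq.2 hj
        exact ⟨i, by rw [hi, Equiv.swap_apply_self]⟩
    have h := ih (fun i => g (i + 1)) x' hinj (by omega)
    rw [himg] at h
    rw [show m + 1 - (r + 1) = m - r by omega, List.map_map]
    have h' : ((m - r).factorial : K) * (g 0 (x p) *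
        (∏ c ∈ (Finset.univ.image x).erase (x p), rr (x p) c) *
        hsum (List.map (g ∘ Nat.succ) (List.range r)) ((Finset.univ.image x).erase (x p))) =
        (g 0 (x p) * (∏ c ∈ (Finset.univ.image x).erase (x p), rr (x p) c)) *
        ∑ e : Equiv.Perm (Fin m), ∏ i : Fin m with i.1 < r, (g (i + 1) (x' (e i)) *
          ∏ j : Fin m with i < j, rr (x' (e i)) (x' (e j))) := by
      rw [h]
      simp only [Function.comp_def, Nat.succ_eq_add_one]
      ring
    rw [h', Finset.mul_sum]
    refine Finset.sum_congr rfl fun e _ => ?_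
    have hsucc : ∀ i : Fin m, x (Equiv.Perm.decomposeFin.symm (p, e) i.succ) = x' (e i) := by
      intro i
      rw [Equiv.Perm.decomposeFin_symm_apply_succ]
    have hzero : Equiv.Perm.decomposeFin.symm (p, e) 0 = p :=
      Equiv.Perm.decomposeFin_symm_apply_zero p e
    rw [← himg, Finset.prod_image fun a _ c _ h => hinj h, ← Equiv.prod_comp e,
      Finset.prod_filter, Fin.prod_univ_succ]
    congr 1
    · rw [if_pos (by simp), hzero, Finset.prod_filter, Fin.prod_univ_succ]
      simp [hx']
    · rw [Finset.prod_filter]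
      refine Finset.prod_congr rfl fun i _ => ?_
      simp only [hsucc, Fin.val_succ, Nat.add_lt_add_iff_right]
      congr 2
      rw [Finset.prod_filter, Fin.prod_univ_succ, Finset.prod_filter]
      simp [hx']

theorem symSum_eq_hsum [CharZero K] (pw : K → ℕ → K) (la : SP) {n : ℕ} (hn : la.card ≤ n)
    (x : Fin n → K) (hx : Function.Injective x) :
    symSum pw la n x = hsum ((la.sort (· ≥ ·)).map fun (p : ℕ+) (a : K) => pw a p) (pts x) := by
  have h := sum_perm_eq_hsum la.card (fun i a => pw a (part la i)) x hx hn
  rw [map_part la fun k a => pw a k] at h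
  have h0 : (((n - la.card).factorial : ℕ) : K) ≠ 0 := by
    exact_mod_cast Nat.factorial_ne_zero _
  unfold symSum
  rw [inv_mul_eq_iff_eq_mul₀ h0, pts, ← h]
  rfl

end SymSum

/-! ### Polynomiality -/

section Polynomiality

/-- The Vandermonde product of the `y_i`, `i ∈ U`. -/
def vdm {T : Type*} [CommRing T] {n : ℕ} (U : Finset (Fin n)) (y : Fin n → T) : T :=
  ∏ i ∈ U, ∏ k ∈ U with i < k, (y i - y k)

theorem vdm_erase {T : Type*} [CommRing T] {n : ℕ} {U : Finset (Fin n)} (y : Fin n → T)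
    {j : Fin n} (hj : j ∈ U) :
    vdm U y = (∏ k ∈ U.erase j, if k < j then -1 else 1) * vdm (U.erase j) y *
      ∏ k ∈ U.erase j, (y j - y k) := by
  have h1 : ∀ i ∈ U.erase j, ∏ k ∈ U with i < k, (y i - y k) =
      (if i < j then y i - y j else 1) * ∏ k ∈ U.erase j with i < k, (y i - y k) := by
    intro i _
    rw [Finset.prod_filter, Finset.prod_filter,
      ← Finset.mul_prod_erase U (fun k => if i < k then y i - y k else 1) hj]
  have h2 : ∏ k ∈ U with j < k, (y j - y k) =
      ∏ k ∈ U.erase j, if j < k then y j - y k else 1 := by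
    rw [Finset.prod_filter,
      ← Finset.mul_prod_erase U (fun k => if j < k then y j - y k else 1) hj, if_neg (lt_irrefl j), one_mul]
  have h3 : (∏ k ∈ U.erase j, if j < k then y j - y k else 1) *
      (∏ k ∈ U.erase j, if k < j then y k - y j else 1) =
      (∏ k ∈ U.erase j, if k < j then -1 else 1) * ∏ k ∈ U.erase j, (y j - y k) := by
    rw [← Finset.prod_mul_distrib, ← Finset.prod_mul_distrib]
    refine Finset.prod_congr rfl fun k hk => ?_
    rcases lt_or_gt_of_ne (Finset.ne_of_mem_erase hk) with h | h
    · rw [if_neg (not_lt.2 h.le), if_pos h, if_pos h]; ring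
    · rw [if_pos h, if_neg (not_lt.2 h.le), if_neg (not_lt.2 h.le), one_mul, mul_one]
  unfold vdm
  rw [← Finset.mul_prod_erase U (fun i => ∏ k ∈ U with i < k, (y i - y k)) hj, h2,
    Finset.prod_congr rfl h1, Finset.prod_mul_distrib]
  linear_combination (∏ i ∈ U.erase j, ∏ k ∈ U.erase j with i < k, (y i - y k)) * h3

theorem map_vdm {S T : Type*} [CommRing S] [CommRing T] (φ : S →+* T) {n : ℕ}
    (U : Finset (Fin n)) (y : Fin n → S) : φ (vdm U y) = vdm U fun i => φ (y i) := by
  simp [vdm]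

theorem vdm_ne_zero {T : Type*} [CommRing T] [IsDomain T] {n : ℕ} {U : Finset (Fin n)}
    {y : Fin n → T} (hy : Function.Injective y) : vdm U y ≠ 0 := by
  refine Finset.prod_ne_zero_iff.2 fun i _ => Finset.prod_ne_zero_iff.2 fun k hk => ?_
  refine sub_ne_zero.2 fun h => ?_
  have := (Finset.mem_filter.1 hk).2
  rw [hy h] at this
  exact lt_irrefl _ this

theorem vdm_univ_swap {T : Type*} [CommRing T] {n : ℕ} (y : Fin n → T) {i j : Fin n}
    (hij : i ≠ j) : vdm Finset.univ (y ∘ Equiv.swap i j) = -vdm Finset.univ y := by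
  have key : ∀ z : Fin n → T, vdm Finset.univ z = (Matrix.vandermonde fun k => -z k).det := by
    intro z
    rw [Matrix.det_vandermonde, vdm]
    refine Finset.prod_congr rfl fun i _ => Finset.prod_congr ?_ fun k _ => by ring
    ext k; simp
  rw [key, key]
  have : (Matrix.vandermonde fun k => -(y ∘ Equiv.swap i j) k) =
      (Matrix.vandermonde fun k => -y k).submatrix (Equiv.swap i j) id := by
    ext a c; simp [Matrix.vandermonde]
  rw [this, Matrix.det_permute, Equiv.Perm.sign_swap hij]
  simp

variable {Q : Type} [CommRing Q] [Algebra ZBeta Q]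

/-- The functions on `E` given by a list of polynomials over `Q`. -/
def evalList {E : Type*} [CommRing E] [Algebra ZBeta E] (φ : Q →ₐ[ZBeta] E)
    (L : List (Polynomial Q)) : List (E → E) :=
  L.map fun G a => G.eval₂ φ.toRingHom a

/-- If the first chosen point is y j, its denominators are the Vandermonde factors that involve j,
up to sign, and the Vandermonde product of the other points serves the rest of the list. One
polynomial works for all fields and all injective families. -/
theorem exists_vdm_mul_hsum {n : ℕ} (L : List (Polynomial Q)) (U : Finset (Fin n)) :
    ∃ p : MvPolynomial (Fin n) Q, ∀ (E : Type) [Field E] [Algebra ZBeta E] (φ : Q →ₐ[ZBeta] E)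
      (y : Fin n → E), Function.Injective y →
      MvPolynomial.aevalTower φ y p = vdm U y * hsum (evalList φ L) (U.image y) := by
  induction L generalizing U with
  | nil =>
    refine ⟨vdm U MvPolynomial.X, fun E _ _ φ y _ => ?_⟩
    have := map_vdm (MvPolynomial.aevalTower φ y).toRingHom U MvPolynomial.X
    simpa [evalList] using this
  | cons G L ih =>
    choose p hp using ih
    refine ⟨∑ j ∈ U, (∏ k ∈ U.erase j, if k < j then -1 else 1) *
      G.eval₂ (MvPolynomial.C) (MvPolynomial.X j) *
      (∏ k ∈ U.erase j, oplus (MvPolynomial.X j) (MvPolynomial.X k) *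
        (1 + beta (MvPolynomial (Fin n) Q) * MvPolynomial.X k)) * p (U.erase j),
      fun E _ _ φ y hy => ?_⟩
    rw [evalList, List.map_cons, hsum_cons, Finset.sum_image fun a _ c _ h => hy h, map_sum,
      Finset.mul_sum]
    refine Finset.sum_congr rfl fun j hj => ?_
    have hG : MvPolynomial.aevalTower φ y (G.eval₂ MvPolynomial.C (MvPolynomial.X j)) =
        G.eval₂ φ.toRingHom (y j) := by
      have := Polynomial.hom_eval₂ G MvPolynomial.C (MvPolynomial.aevalTower φ y).toRingHom
        (MvPolynomial.X j)
      refine this.trans ?_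
      congr 1
      · ext r; simp
      · simp
    rw [vdm_erase y hj, map_mul, map_mul, map_mul, hG, hp _ E φ y hy, ← Finset.image_erase hy,
      Finset.prod_image fun a _ c _ h => hy h]
    simp only [map_prod, map_mul, map_oplus, map_add, map_one, map_beta,
      MvPolynomial.aevalTower_X, apply_ite (MvPolynomial.aevalTower φ y), map_neg]
    have h3 : (∏ k ∈ U.erase j, (oplus (y j) (y k) * (1 + beta E * y k))) =
        (∏ k ∈ U.erase j, (y j - y k)) * ∏ k ∈ U.erase j, rr (y j) (y k) := by
      rw [← Finset.prod_mul_distrib]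
      refine Finset.prod_congr rfl fun k hk => ?_
      have : y j - y k ≠ 0 := sub_ne_zero.2 fun h => Finset.ne_of_mem_erase hk (hy h).symm
      rw [rr_eq]
      field_simp
    rw [h3, evalList]
    ring

theorem X_sub_X_dvd_iff {Q : Type*} [CommRing Q] {n : ℕ} {i j : Fin n} (p : MvPolynomial (Fin n) Q) :
    (MvPolynomial.X i - MvPolynomial.X j) ∣ p ↔
      MvPolynomial.aeval (fun k => if k = j then MvPolynomial.X i else MvPolynomial.X k :
        Fin n → MvPolynomial (Fin n) Q) p = 0 := by
  constructor
  · rintro ⟨q, rfl⟩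
    by_cases h : i = j <;> simp [h]
  · intro h
    have key : ∀ q : MvPolynomial (Fin n) Q, (MvPolynomial.X i - MvPolynomial.X j) ∣
        q - MvPolynomial.aeval (fun k => if k = j then MvPolynomial.X i else MvPolynomial.X k :
          Fin n → MvPolynomial (Fin n) Q) q := by
      intro q
      induction q using MvPolynomial.induction_on with
      | C a => simp
      | add p q hp hq =>
        rw [map_add, add_sub_add_comm]
        exact dvd_add hp hq
      | mul_X p k hp =>
        rw [map_mul, MvPolynomial.aeval_X]
        have : ∀ A B C D : MvPolynomial (Fin n) Q, A * B - C * D = (A - C) * B + C * (B - D) :=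
          fun _ _ _ _ => by ring
        rw [this]
        refine dvd_add (hp.mul_right _) (Dvd.dvd.mul_left ?_ _)
        split_ifs with hk
        · rw [hk, ← neg_sub (MvPolynomial.X i), dvd_neg]
        · simp
    have := key p
    rwa [h, sub_zero] at this

/-- Divisibility by x_i - x_j is vanishing under a substitution with values in a domain. -/
theorem prime_X_sub_X {Q : Type*} [CommRing Q] [IsDomain Q] {n : ℕ} {i j : Fin n} (hij : i ≠ j) :
    Prime (MvPolynomial.X i - MvPolynomial.X j : MvPolynomial (Fin n) Q) := by
  refine ⟨sub_ne_zero.2 fun h => hij (MvPolynomial.X_injective h), fun hu => ?_, fun a c h => ?_⟩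
  · have := (X_sub_X_dvd_iff (i := i) (j := j) (1 : MvPolynomial (Fin n) Q)).1 hu.dvd
    simp at this
  · rw [X_sub_X_dvd_iff] at h ⊢
    rw [X_sub_X_dvd_iff, ← mul_eq_zero, ← map_mul, h]

theorem not_X_sub_X_dvd {Q : Type*} [CommRing Q] [IsDomain Q] {n : ℕ} {i j k l : Fin n} (hij : i < j) (hkl : k < l)
    (h : (i, j) ≠ (k, l)) : ¬ (MvPolynomial.X i - MvPolynomial.X j) ∣
      (MvPolynomial.X k - MvPolynomial.X l : MvPolynomial (Fin n) Q) := by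
  rw [X_sub_X_dvd_iff, map_sub, MvPolynomial.aeval_X, MvPolynomial.aeval_X]
  intro h0
  have h1 : (if k = j then i else k) = if l = j then i else l := by
    apply MvPolynomial.X_injective (R := Q)
    simp only [apply_ite MvPolynomial.X]
    exact sub_eq_zero.1 h0
  apply h
  split_ifs at h1 with h2 h3 h3
  · exact absurd (h2.trans h3.symm) hkl.ne
  · subst h2 h1; exact absurd hkl hij.asymm
  · rw [h3, h1]
  · exact absurd h1 hkl.ne

theorem prod_primes_dvd_of_not_dvd {ι T : Type*} [CommRing T] [IsDomain T] (s : Finset ι)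
    (f : ι → T) (hf : ∀ i ∈ s, Prime (f i)) (hne : ∀ i ∈ s, ∀ j ∈ s, i ≠ j → ¬ f i ∣ f j)
    {p : T} (hp : ∀ i ∈ s, f i ∣ p) : ∏ i ∈ s, f i ∣ p := by
  induction s using Finset.induction_on with
  | empty => simp
  | insert a s ha ih =>
    obtain ⟨q, hq⟩ := ih (fun i hi => hf i (Finset.mem_insert_of_mem hi))
      (fun i hi j hj => hne i (Finset.mem_insert_of_mem hi) j (Finset.mem_insert_of_mem hj))
      (fun i hi => hp i (Finset.mem_insert_of_mem hi))
    have ha' := Finset.mem_insert_self a s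
    have h := hp a ha'
    rw [hq, (hf a ha').dvd_mul, (hf a ha').dvd_finsetProd_iff] at h
    rcases h with ⟨i, hi, h⟩ | ⟨r, hr⟩
    · exact absurd h (hne a ha' i (Finset.mem_insert_of_mem hi) fun h => ha (h ▸ hi))
    · rw [Finset.prod_insert ha, hq, hr]
      exact ⟨r, by ring⟩

/-- An alternating polynomial equals its own negative after x_j = x_i, hence vanishes there in
characteristic 0. The x_i - x_j with i < j are primes none of which divides another, so their
product divides. -/
theorem vdm_dvd_of_swap {Q : Type*} [CommRing Q] [IsDomain Q] [CharZero Q] {n : ℕ} {p : MvPolynomial (Fin n) Q}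
    (h : ∀ i j : Fin n, i ≠ j → MvPolynomial.rename (Equiv.swap i j) p = -p) :
    vdm Finset.univ MvPolynomial.X ∣ p := by
  unfold vdm
  rw [Finset.prod_sigma' Finset.univ (fun i : Fin n => {k ∈ Finset.univ | i < k})
    (fun i k => (MvPolynomial.X i - MvPolynomial.X k : MvPolynomial (Fin n) Q))]
  refine prod_primes_dvd_of_not_dvd _ _ (fun x hx => ?_) (fun x hx y hy hxy => ?_) fun x hx => ?_
  · simp only [Finset.mem_sigma, Finset.mem_filter, Finset.mem_univ, true_and] at hx
    exact prime_X_sub_X hx.ne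
  · simp only [Finset.mem_sigma, Finset.mem_filter, Finset.mem_univ, true_and] at hx hy
    refine not_X_sub_X_dvd hx hy fun h => hxy ?_
    obtain ⟨x1, x2⟩ := x
    obtain ⟨y1, y2⟩ := y
    simp only [Prod.mk.injEq] at h
    rw [h.1, h.2]
  · simp only [Finset.mem_sigma, Finset.mem_filter, Finset.mem_univ, true_and] at hx
    rw [X_sub_X_dvd_iff]
    have h1 := congrArg (MvPolynomial.aeval
      (fun k => if k = x.2 then MvPolynomial.X x.1 else MvPolynomial.X k :
        Fin n → MvPolynomial (Fin n) Q)) (h x.1 x.2 hx.ne)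
    rw [map_neg, MvPolynomial.aeval_rename] at h1
    have h2 : ((fun k => if k = x.2 then MvPolynomial.X x.1 else MvPolynomial.X k :
        Fin n → MvPolynomial (Fin n) Q) ∘ Equiv.swap x.1 x.2) =
        fun k => if k = x.2 then MvPolynomial.X x.1 else MvPolynomial.X k := by
      funext k
      simp only [Function.comp_apply]
      by_cases hk1 : k = x.1
      · subst hk1; simp
      by_cases hk2 : k = x.2
      · subst hk2; simp
      rw [Equiv.swap_apply_of_ne_of_ne hk1 hk2]
    rw [h2] at h1
    exact self_eq_neg.1 h1

/-- The sum `hsum` in the variables `x₁, …, x_n` is a polynomial. -/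
theorem exists_polynomial_hsum [IsDomain Q] [CharZero Q] (n : ℕ) (L : List (Polynomial Q)) :
    ∃ p : MvPolynomial (Fin n) Q, ∀ (E : Type) [Field E] [Algebra ZBeta E] (φ : Q →ₐ[ZBeta] E)
      (y : Fin n → E), Function.Injective y →
      MvPolynomial.aevalTower φ y p = hsum (evalList φ L) (pts y) := by
  obtain ⟨p, hp'⟩ := exists_vdm_mul_hsum (n := n) L Finset.univ
  have hp : ∀ (E : Type) [Field E] [Algebra ZBeta E] (φ : Q →ₐ[ZBeta] E)
      (y : Fin n → E), Function.Injective y →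
      MvPolynomial.aevalTower φ y p = vdm Finset.univ y * hsum (evalList φ L) (pts y) := hp'
  let F := FractionRing (MvPolynomial (Fin n) Q)
  let φ : Q →ₐ[ZBeta] F := IsScalarTower.toAlgHom ZBeta Q F
  let ι : MvPolynomial (Fin n) Q →ₐ[ZBeta] F :=
    IsScalarTower.toAlgHom ZBeta (MvPolynomial (Fin n) Q) F
  have hι : Function.Injective ι := IsFractionRing.injective (MvPolynomial (Fin n) Q) F
  have hX : Function.Injective fun k : Fin n => ι (MvPolynomial.X k) :=
    hι.comp (MvPolynomial.X_injective)
  have hev : ∀ σ : Equiv.Perm (Fin n), ι (MvPolynomial.rename σ p) =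
      MvPolynomial.aevalTower φ ((fun k => ι (MvPolynomial.X k)) ∘ σ) p := by
    intro σ
    have : (ι.toRingHom.comp (MvPolynomial.rename (R := Q) σ).toRingHom) =
        (MvPolynomial.aevalTower φ ((fun k => ι (MvPolynomial.X k)) ∘ σ)).toRingHom := by
      refine MvPolynomial.ringHom_ext (fun a => ?_) fun k => ?_
      · have := IsScalarTower.algebraMap_apply Q (MvPolynomial (Fin n) Q) F a
        simpa [φ, ι] using this.symm
      · simp
    exact DFunLike.congr_fun this p
  -- At the generic point, `hsum` depends only on the set of variables, while the Vandermonde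
  -- product changes sign.
  have hswap : ∀ i j : Fin n, i ≠ j → MvPolynomial.rename (Equiv.swap i j) p = -p := by
    intro i j hij
    apply hι
    have h1 := hev (Equiv.swap i j)
    rw [hp F φ _ (hX.comp (Equiv.swap i j).injective), vdm_univ_swap _ hij] at h1
    have h2 := hev 1
    rw [hp F φ _ (hX.comp (Equiv.injective _))] at h2
    rw [pts_comp_equiv] at h1 h2
    rw [h1, map_neg, neg_mul, neg_inj]
    rw [show (MvPolynomial.rename (R := Q) (1 : Equiv.Perm (Fin n))) p = p from
      MvPolynomial.rename_id_apply p] at h2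
    exact h2.symm
  obtain ⟨q, rfl⟩ := vdm_dvd_of_swap hswap
  refine ⟨q, fun E _ _ ψ y hy => ?_⟩
  have h := hp E ψ y hy
  rw [map_mul] at h
  have h1 : MvPolynomial.aevalTower ψ y (vdm Finset.univ MvPolynomial.X) = vdm Finset.univ y := by
    have := map_vdm (MvPolynomial.aevalTower ψ y).toRingHom Finset.univ MvPolynomial.X
    simpa using this
  rw [h1] at h
  exact mul_left_cancel₀ (vdm_ne_zero hy) h

end Polynomiality

/-! ### The coefficient ring -/

section Coef

theorem toCoef_surjective : Function.Surjective toCoef := Ideal.Quotient.mkₐ_surjective _ _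

theorem CoefRing.induction {P : CoefRing → Prop} (hC : ∀ r : ZBeta, P (algebraMap ZBeta CoefRing r))
    (hadd : ∀ x y, P x → P y → P (x + y)) (hmul : ∀ x z, P x → P (x * b z)) (x : CoefRing) :
    P x := by
  obtain ⟨p, rfl⟩ := toCoef_surjective x
  induction p using MvPolynomial.induction_on with
  | C a =>
    have := hC a
    rwa [← AlgHom.commutes toCoef] at this
  | add p q hp hq => rw [map_add]; exact hadd _ _ hp hq
  | mul_X p z hp => rw [map_mul]; exact hmul _ z hp

/-- The ring homomorphism from `𝓡` that extends `φ : ℤ[β] → S` and maps `b_z` to `c z`. -/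
def coefLift {S : Type*} [CommRing S] (φ : ZBeta →+* S) (c : SNum → S)
    (h : ∀ z, c z + c (bar z) + φ Polynomial.X * c z * c (bar z) = 0) : CoefRing →+* S :=
  Ideal.Quotient.lift relIdeal (MvPolynomial.eval₂Hom φ c) (by
    intro a ha
    have hle : relIdeal ≤ RingHom.ker (MvPolynomial.eval₂Hom φ c) := by
      refine Ideal.span_le.2 ?_
      rintro _ ⟨z, rfl⟩
      have := h z
      simpa [oplus, beta, RingHom.mem_ker, MvPolynomial.algebraMap_eq] using this
    exact hle ha)

theorem coefLift_b {S : Type*} [CommRing S] (φ : ZBeta →+* S) (c : SNum → S) (h) (z : SNum) :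
    coefLift φ c h (b z) = c z := by
  have : coefLift φ c h (b z) = MvPolynomial.eval₂Hom φ c (MvPolynomial.X z) :=
    Ideal.Quotient.lift_mk _ _ _
  simpa using this

theorem coefLift_algebraMap {S : Type*} [CommRing S] (φ : ZBeta →+* S) (c : SNum → S) (h)
    (r : ZBeta) : coefLift φ c h (algebraMap ZBeta CoefRing r) = φ r := by
  have : coefLift φ c h (algebraMap ZBeta CoefRing r) =
      MvPolynomial.eval₂Hom φ c (MvPolynomial.C r) :=
    Ideal.Quotient.lift_mk _ _ _
  simpa using this

/-- The algebra homomorphism from `𝓡` that maps `b_z` to `c z`. -/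
def coefLiftAlg {S : Type*} [CommRing S] [Algebra ZBeta S] (c : SNum → S)
    (h : ∀ z, oplus (c z) (c (bar z)) = 0) : CoefRing →ₐ[ZBeta] S :=
  { coefLift (algebraMap ZBeta S) c h with
    commutes' := coefLift_algebraMap _ _ _ }

theorem coefLiftAlg_b {S : Type*} [CommRing S] [Algebra ZBeta S] (c : SNum → S) (h) (z : SNum) :
    coefLiftAlg c h (b z) = c z := coefLift_b _ _ (fun z => h z) z

theorem coef_algHom_ext {S : Type*} [CommRing S] [Algebra ZBeta S] {f g : CoefRing →ₐ[ZBeta] S}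
    (h : ∀ z, f (b z) = g (b z)) : f = g := by
  ext x
  induction x using CoefRing.induction with
  | hC r => simp
  | hadd x y hx hy => rw [map_add, map_add, hx, hy]
  | hmul x z hx => rw [map_mul, map_mul, hx, h]

theorem actCoef_b (w : signedPerm) (z : SNum) : actCoef w (b z) = b (w.1 z) := by
  have : actCoef w (b z) = MvPolynomial.aeval (R := ZBeta) (fun z : SNum => b (w.1 z))
    (MvPolynomial.X z) := Ideal.Quotient.lift_mk _ _ _
  simpa using this

theorem one_add_mul_one_add {S : Type*} [CommRing S] [Algebra ZBeta S] {x y : S}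
    (h : oplus x y = 0) : (1 + beta S * x) * (1 + beta S * y) = 1 := by
  unfold oplus at h; linear_combination beta S * h

theorem isUnit_one_add {S : Type*} [CommRing S] [Algebra ZBeta S] {x y : S}
    (h : oplus x y = 0) : IsUnit (1 + beta S * x) :=
  IsUnit.of_mul_eq_one _ (one_add_mul_one_add h)

/-- The specialization `β = 0`, `b_z = z`. -/
def coefToInt : CoefRing →+* ℤ :=
  coefLift (Polynomial.eval₂RingHom (Int.castRingHom ℤ) 0) (fun z => z.1) (fun z => by simp [bar])

theorem coefToInt_b (z : SNum) : coefToInt (b z) = z.1 := coefLift_b _ _ _ z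

theorem coefToInt_beta : coefToInt (beta CoefRing) = 0 := by
  rw [beta, coefToInt, coefLift_algebraMap]; simp

theorem coefToInt_oplus (x y : CoefRing) :
    coefToInt (oplus x y) = coefToInt x + coefToInt y := by
  simp [oplus, coefToInt_beta]

/-- At β = 0 and b_z = z the operation ⊕ becomes the addition of integers. -/
theorem oplus_b_ne_zero {z w : SNum} (h : w ≠ bar z) : oplus (b z) (b w) ≠ 0 := fun h0 => by
  have := congrArg coefToInt h0
  rw [coefToInt_oplus, coefToInt_b, coefToInt_b, map_zero] at this
  exact h (Subtype.ext (by simp only [bar]; omega))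

theorem bar_ne_self (z : SNum) : bar z ≠ z := fun h => by
  have h1 := congrArg Subtype.val h
  have h2 := z.2
  simp only [bar] at h1
  omega

instance : CharZero CoefRing := ⟨fun m n h => by
  have := congrArg coefToInt h
  simpa using this⟩

theorem beta_coefRing_ne_zero : beta CoefRing ≠ 0 := fun h => by
  have h1 := congrArg (coefLiftAlg (S := ZBeta) (fun _ => 0) (fun _ => oplus_zero 0)) h
  rw [map_beta, map_zero] at h1
  exact Polynomial.X_ne_zero h1

/-! The subring `ℤ[β][b₁, b₂, …]`, of which `𝓡` is a localization. -/

/-- The map `ℤ[β][b₁, b₂, …] → 𝓡`. -/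
def fromPoly : MvPolynomial ℕ+ ZBeta →ₐ[ZBeta] CoefRing := MvPolynomial.aeval fun i => b (pos i)

/-- Since b_ī = -b_i/(1 + βb_i), every element is a fraction whose denominator is a product of the
units 1 + βb_i. -/
theorem exists_num_den (x : CoefRing) : ∃ u a : MvPolynomial ℕ+ ZBeta,
    IsUnit (fromPoly u) ∧ fromPoly u * x = fromPoly a := by
  induction x using CoefRing.induction with
  | hC r => exact ⟨1, MvPolynomial.C r, by simp, by simp [fromPoly]⟩
  | hadd x y hx hy =>
    obtain ⟨u, a, hu, h⟩ := hx
    obtain ⟨v, c, hv, h'⟩ := hy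
    refine ⟨u * v, v * a + u * c, by rw [map_mul]; exact hu.mul hv, ?_⟩
    simp only [map_mul, map_add, ← h, ← h']
    ring
  | hmul x z hx =>
    obtain ⟨u, a, hu, h⟩ := hx
    rcases pos_or_bar_pos z with ⟨i, rfl⟩ | ⟨i, rfl⟩
    · refine ⟨u, a * MvPolynomial.X i, hu, ?_⟩
      simp only [map_mul, ← h]
      simp [fromPoly]
      ring
    · have hb := b_oplus_b_bar (pos i)
      have e1 : fromPoly (1 + beta _ * MvPolynomial.X i) = 1 + beta CoefRing * b (pos i) := by
        simp [fromPoly, map_beta]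
      refine ⟨u * (1 + beta _ * MvPolynomial.X i), -(a * MvPolynomial.X i), ?_, ?_⟩
      · rw [map_mul, e1]
        exact hu.mul (isUnit_one_add hb)
      · rw [map_mul, e1, map_neg, map_mul, ← h]
        have e2 : fromPoly (MvPolynomial.X i) = b (pos i) := by simp [fromPoly]
        rw [e2]
        unfold oplus at hb
        linear_combination (fromPoly u * x) * hb

theorem oplus_neg_div {F : Type*} [Field F] [Algebra ZBeta F] {x : F} (h : 1 + beta F * x ≠ 0) :
    oplus x (-x / (1 + beta F * x)) = 0 := by
  have h1 := mul_inv_cancel₀ h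
  rw [oplus, div_eq_mul_inv]
  linear_combination -x * h1

/-- The embedding of `𝓡` into the field of fractions of `ℤ[β][b₁, b₂, …]`. -/
theorem exists_toFrac : ∃ f : CoefRing →ₐ[ZBeta] FractionRing (MvPolynomial ℕ+ ZBeta),
    ∀ a, f (fromPoly a) = algebraMap _ _ a := by
  let F := FractionRing (MvPolynomial ℕ+ ZBeta)
  let ι : MvPolynomial ℕ+ ZBeta →ₐ[ZBeta] F := IsScalarTower.toAlgHom ZBeta _ F
  have hι : Function.Injective ι := IsFractionRing.injective (MvPolynomial ℕ+ ZBeta) F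
  have hne : ∀ i : ℕ+, 1 + beta F * ι (MvPolynomial.X i) ≠ 0 := by
    intro i h
    rw [← map_beta ι, ← map_mul, ← map_one ι, ← map_add] at h
    have := hι (h.trans (map_zero ι).symm)
    have h1 := congrArg (MvPolynomial.aeval (R := ZBeta) (fun _ => (0 : ZBeta))) this
    simp at h1
  let c : SNum → F := fun z =>
    if 0 < z.1 then ι (MvPolynomial.X ⟨z.1.natAbs, Int.natAbs_pos.2 z.2⟩)
    else -ι (MvPolynomial.X ⟨z.1.natAbs, Int.natAbs_pos.2 z.2⟩) /
      (1 + beta F * ι (MvPolynomial.X ⟨z.1.natAbs, Int.natAbs_pos.2 z.2⟩))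
  have hc1 : ∀ i, c (pos i) = ι (MvPolynomial.X i) := by
    intro i
    have : 0 < (pos i).1 := by have := i.pos; simp only [pos]; omega
    simp only [c, if_pos this]
    congr 1
  have hc2 : ∀ i, c (bar (pos i)) = -ι (MvPolynomial.X i) / (1 + beta F * ι (MvPolynomial.X i)) := by
    intro i
    have : ¬ 0 < (bar (pos i)).1 := by have := i.pos; simp only [pos, bar]; omega
    have h2 : (⟨(bar (pos i)).1.natAbs, Int.natAbs_pos.2 (bar (pos i)).2⟩ : ℕ+) = i :=
      PNat.eq (by simp [bar, pos])
    simp only [c, if_neg this, h2]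
  have hc : ∀ z, oplus (c z) (c (bar z)) = 0 := by
    intro z
    rcases pos_or_bar_pos z with ⟨i, rfl⟩ | ⟨i, rfl⟩
    · rw [hc1, hc2, oplus_neg_div (hne i)]
    · rw [bar_bar, hc1, hc2, oplus_comm, oplus_neg_div (hne i)]
  refine ⟨coefLiftAlg c hc, fun a => ?_⟩
  have : (coefLiftAlg c hc).comp fromPoly = ι := by
    refine MvPolynomial.algHom_ext fun i => ?_
    simp [fromPoly, coefLiftAlg_b, hc1]
  exact DFunLike.congr_fun this a

/-- The map to the fraction field is injective: an element of the kernel is, up to a unit, the image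
of a polynomial, and that polynomial must be 0. -/
instance : IsDomain CoefRing := by
  obtain ⟨f, hf⟩ := exists_toFrac
  refine Function.Injective.isDomain f.toRingHom ((injective_iff_map_eq_zero _).2 fun x hx => ?_)
  obtain ⟨u, a, hu, h⟩ := exists_num_den x
  have h1 : f (fromPoly a) = 0 := by
    rw [← h, map_mul, show f x = 0 from hx, mul_zero]
  rw [hf] at h1
  have h2 : a = 0 := IsFractionRing.injective (MvPolynomial ℕ+ ZBeta)
    (FractionRing (MvPolynomial ℕ+ ZBeta)) (h1.trans (map_zero _).symm)
  rw [h2, map_zero] at h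
  exact (hu.mul_right_eq_zero).1 h

/-! The map `e`. -/

theorem e_add (x y : Lat) : e (x + y) = oplus (e x) (e y) := by
  rw [e, map_add]; rfl

theorem oplus_e_neg (x : Lat) : oplus (e x) (e (-x)) = 0 := by
  have h : e (-x) = (Finsupp.linearCombination ℤ
    (fun i : ℕ+ => (⟨b (pos i), b (bar (pos i)), b_oplus_b_bar _⟩ : OplusGroup CoefRing)) x).inv := by
    rw [e, map_neg]; rfl
  rw [h]
  exact OplusGroup.val_inv _

theorem t_bar (z : SNum) : t (bar z) = -t z := by
  unfold t bar
  simp only [Int.natAbs_neg, Int.sign_neg]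
  exact Finsupp.single_neg _ _

theorem t_pos (i : ℕ+) : t (pos i) = Finsupp.single i 1 := by
  unfold t pos
  congr 1
  simp

theorem e_t_pos (i : ℕ+) : e (t (pos i)) = b (pos i) := by
  rw [e, t_pos, Finsupp.linearCombination_single, one_smul]

theorem e_t (z : SNum) : e (t z) = b z := by
  rcases pos_or_bar_pos z with ⟨i, rfl⟩ | ⟨i, rfl⟩
  · exact e_t_pos i
  · refine oplus_cancel (x := b (pos i)) ?_ (b_oplus_b_bar _)
    rw [t_bar, ← e_t_pos, oplus_e_neg]

theorem e_t_sub_t (p q : SNum) : e (t q - t p) = oplus (b q) (b (bar p)) := by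
  rw [sub_eq_add_neg, ← t_bar, e_add, e_t, e_t]

theorem actLat_t (w : signedPerm) (z : SNum) : actLat w (t z) = t (w.1 z) := by
  rcases pos_or_bar_pos z with ⟨i, rfl⟩ | ⟨i, rfl⟩
  · rw [actLat, t_pos, Finsupp.linearCombination_single, one_smul]
  · rw [t_bar, w.2.1, t_bar, map_neg, actLat, t_pos, Finsupp.linearCombination_single, one_smul]

end Coef

/-! ### Divisibility in polynomial rings -/

section Divisibility

theorem dvd_aeval_sub_aeval {R S σ : Type*} [CommRing R] [CommRing S] [Algebra R S]
    {y y' : σ → S} {d : S} (h : ∀ k, d ∣ y k - y' k) (f : MvPolynomial σ R) :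
    d ∣ MvPolynomial.aeval y f - MvPolynomial.aeval y' f := by
  induction f using MvPolynomial.induction_on with
  | C a => simp
  | add p q hp hq =>
    rw [map_add, map_add, add_sub_add_comm]
    exact dvd_add hp hq
  | mul_X p k hp =>
    rw [map_mul, map_mul, MvPolynomial.aeval_X, MvPolynomial.aeval_X]
    have : ∀ A B C D : S, A * B - C * D = (A - C) * B + C * (B - D) := fun _ _ _ _ => by ring
    rw [this]
    exact dvd_add (hp.mul_right _) ((h k).mul_left _)

variable {Q σ : Type*} [CommRing Q] [DecidableEq σ] (j : σ)

/-- The substitution `x_j = 0`. -/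
def killVar : MvPolynomial σ Q →ₐ[Q] MvPolynomial σ Q :=
  MvPolynomial.aeval fun k => if k = j then 0 else MvPolynomial.X k

theorem killVar_X (k : σ) : killVar (Q := Q) j (MvPolynomial.X k) =
    if k = j then 0 else MvPolynomial.X k := by simp [killVar]

/-- Pseudo-division by a polynomial linear in x_j: modulo u x_j + v each factor u x_j can be
replaced by -v, which leaves a remainder free of x_j. -/
theorem exists_pow_mul_sub_dvd {u v : MvPolynomial σ Q} (hv : killVar j v = v)
    (hu : killVar j u = u) (q : MvPolynomial σ Q) :
    ∃ (d : ℕ) (q₀ : MvPolynomial σ Q), killVar j q₀ = q₀ ∧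
      (u * MvPolynomial.X j + v) ∣ u ^ d * q - q₀ := by
  induction q using MvPolynomial.induction_on with
  | C a => exact ⟨0, MvPolynomial.C a, by simp [killVar], by simp⟩
  | add p q hp hq =>
    obtain ⟨d, p₀, hp₀, hp⟩ := hp
    obtain ⟨d', q₀, hq₀, hq⟩ := hq
    refine ⟨d + d', u ^ d' * p₀ + u ^ d * q₀, ?_, ?_⟩
    · simp only [map_add, map_mul, map_pow, hp₀, hq₀, hu]
    · have : u ^ (d + d') * (p + q) - (u ^ d' * p₀ + u ^ d * q₀) =
        u ^ d' * (u ^ d * p - p₀) + u ^ d * (u ^ d' * q - q₀) := by ring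
      rw [this]
      exact dvd_add (hp.mul_left _) (hq.mul_left _)
  | mul_X p k hp =>
    obtain ⟨d, p₀, hp₀, hp⟩ := hp
    by_cases hk : k = j
    · subst hk
      refine ⟨d + 1, -(v * p₀), by simp only [map_neg, map_mul, hv, hp₀], ?_⟩
      have : u ^ (d + 1) * (p * MvPolynomial.X k) - -(v * p₀) =
        (u * MvPolynomial.X k) * (u ^ d * p - p₀) + (u * MvPolynomial.X k + v) * p₀ := by ring
      rw [this]
      exact dvd_add (hp.mul_left _) (dvd_mul_right _ _)
    · refine ⟨d, p₀ * MvPolynomial.X k, by rw [map_mul, hp₀, killVar_X, if_neg hk], ?_⟩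
      have : u ^ d * (p * MvPolynomial.X k) - p₀ * MvPolynomial.X k =
        (u ^ d * p - p₀) * MvPolynomial.X k := by ring
      rw [this]
      exact hp.mul_right _

/-- A polynomial that vanishes at the root `x_j = c` of `u x_j + v` is divisible by `u x_j + v`, up
to a power of `u`. -/
theorem exists_dvd_pow_mul_of_root {K : Type*} [Field K] [Algebra Q K] [Algebra (MvPolynomial σ Q) K]
    [IsScalarTower Q (MvPolynomial σ Q) K]
    (hinj : Function.Injective (algebraMap (MvPolynomial σ Q) K))
    {u v q : MvPolynomial σ Q} (hv : killVar j v = v) (hu : killVar j u = u) {c : K}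
    (hc : algebraMap (MvPolynomial σ Q) K u * c + algebraMap (MvPolynomial σ Q) K v = 0)
    (hq : MvPolynomial.aeval (fun k => if k = j then c else algebraMap (MvPolynomial σ Q) K (MvPolynomial.X k)) q
      = 0) :
    ∃ d : ℕ, (u * MvPolynomial.X j + v) ∣ u ^ d * q := by
  obtain ⟨d, q₀, hq₀, h⟩ := exists_pow_mul_sub_dvd j hv hu q
  set ψ : MvPolynomial σ Q →ₐ[Q] K :=
    MvPolynomial.aeval (fun k => if k = j then c else algebraMap (MvPolynomial σ Q) K (MvPolynomial.X k)) with hψ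
  have hfree : ∀ p, killVar j p = p → ψ p = algebraMap (MvPolynomial σ Q) K p := by
    have h1 : ψ.comp (killVar j) =
        (IsScalarTower.toAlgHom Q (MvPolynomial σ Q) K).comp (killVar j) := by
      refine MvPolynomial.algHom_ext fun k => ?_
      simp only [AlgHom.comp_apply, killVar_X]
      by_cases hk : k = j
      · simp [hk]
      · simp [hk, hψ]
    intro p hp
    have h2 := DFunLike.congr_fun h1 p
    simpa [hp] using h2
  have hψp : ψ (u * MvPolynomial.X j + v) = 0 := by
    rw [map_add, map_mul, hfree u hu, hfree v hv, hψ, MvPolynomial.aeval_X, if_pos rfl, hc]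
  obtain ⟨r, hr⟩ := h
  have h3 := congrArg ψ hr
  rw [map_mul, hψp, zero_mul, map_sub, map_mul, hq, mul_zero, zero_sub, neg_eq_zero,
    hfree _ hq₀] at h3
  have h4 : q₀ = 0 := hinj (h3.trans (map_zero _).symm)
  exact ⟨d, r, by rw [← hr, h4, sub_zero]⟩

end Divisibility

/-! ### Evaluation of the elements of `GΓ` -/

section Evaluation

/-- As a polynomial in x_j, x_i ⊕ x_j = (1 + βx_i)x_j + x_i has the root ⊖x_i. Vanishing at this
root gives divisibility up to a power of 1 + βx_i, and that power is coprime to x_i ⊕ x_j. -/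
theorem oplus_dvd_of_aeval_eq {n : ℕ} {f : MvPolynomial (Fin n) ZBeta} {i j : Fin n} (hij : i ≠ j)
    {K : Type*} [Field K] [Algebra ZBeta K] [Algebra (MvPolynomial (Fin n) ZBeta) K]
    [IsScalarTower ZBeta (MvPolynomial (Fin n) ZBeta) K]
    (hinj : Function.Injective (algebraMap (MvPolynomial (Fin n) ZBeta) K)) {x : Fin n → K}
    (hx : ∀ k, x k = algebraMap (MvPolynomial (Fin n) ZBeta) K (MvPolynomial.X k))
    (hf : MvPolynomial.aeval (R := ZBeta) (fun k => if k = j then ominus 0 (x i) else x k) f =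
      MvPolynomial.aeval (R := ZBeta) (fun k => if k = j ∨ k = i then 0 else x k) f) :
    oplus (MvPolynomial.X i) (MvPolynomial.X j) ∣
      f - MvPolynomial.aeval (fun k => if k = j ∨ k = i then 0 else MvPolynomial.X k) f := by
  obtain rfl : x = fun k => algebraMap (MvPolynomial (Fin n) ZBeta) K (MvPolynomial.X k) := funext hx
  have hβ : algebraMap (MvPolynomial (Fin n) ZBeta) K (beta _) = beta K := by
    rw [beta, beta, ← IsScalarTower.algebraMap_apply]
  have hne : 1 + beta K * algebraMap (MvPolynomial (Fin n) ZBeta) K (MvPolynomial.X i) ≠ 0 := by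
    intro h
    rw [← hβ, ← map_mul, ← map_one (algebraMap (MvPolynomial (Fin n) ZBeta) K), ← map_add] at h
    have h1 := hinj (h.trans (map_zero _).symm)
    have h2 := congrArg (MvPolynomial.aeval (R := ZBeta) (fun _ => (0 : ZBeta))) h1
    simp at h2
  have hroot := exists_dvd_pow_mul_of_root j hinj (u := 1 + beta _ * MvPolynomial.X i)
    (v := MvPolynomial.X i)
    (q := f - MvPolynomial.aeval (fun k => if k = j ∨ k = i then 0 else MvPolynomial.X k) f)
    (c := ominus 0 (algebraMap (MvPolynomial (Fin n) ZBeta) K (MvPolynomial.X i)))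
    (by rw [killVar_X, if_neg hij])
    (by rw [map_add, map_mul, killVar_X, if_neg hij, map_one, map_beta])
    (by
      rw [map_add, map_mul, hβ, map_one, ominus, mul_div_cancel₀ _ hne]
      ring)
    (by
      rw [map_sub, sub_eq_zero]
      refine hf.trans ?_
      rw [MvPolynomial.comp_aeval_apply]
      refine congrArg (fun y => MvPolynomial.aeval (R := ZBeta) y f) (funext fun k => ?_)
      by_cases h1 : k = j
      · simp [h1]
      by_cases h2 : k = i
      · simp [h2]
      simp [h1, h2])
  obtain ⟨d, hd⟩ := hroot
  have e1 : (1 + beta (MvPolynomial (Fin n) ZBeta) * MvPolynomial.X i) * MvPolynomial.X j +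
      MvPolynomial.X i = oplus (MvPolynomial.X i) (MvPolynomial.X j) := by unfold oplus; ring
  rw [e1] at hd
  -- The Bézout relation is (1 + βx_i)(1 + βx_j) - β(x_i ⊕ x_j) = 1.
  have hcop : IsCoprime (oplus (MvPolynomial.X i) (MvPolynomial.X j))
      (1 + beta (MvPolynomial (Fin n) ZBeta) * MvPolynomial.X i) :=
    ⟨-beta _, 1 + beta _ * MvPolynomial.X j, by unfold oplus; ring⟩
  exact (hcop.pow_right).dvd_of_dvd_mul_left hd

theorem oplus_dvd_of_QCancel {n : ℕ} {f : MvPolynomial (Fin n) ZBeta} (hf : QCancel f)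
    {i j : Fin n} (hij : i < j) :
    oplus (MvPolynomial.X i) (MvPolynomial.X j) ∣
      f - MvPolynomial.aeval (fun k => if k = j ∨ k = i then 0 else MvPolynomial.X k) f :=
  oplus_dvd_of_aeval_eq hij.ne (IsFractionRing.injective _ _) (fun _ => rfl) (hf i j hij)

variable {S : Type*} [CommRing S] [Algebra ZBeta S]

/-- Cancellation is turned from a statement about a fraction field into a divisibility that can be
specialized to any ring. -/
theorem oplus_dvd_aeval_sub {n : ℕ} {f : MvPolynomial (Fin n) ZBeta} (hf : QCancel f)
    {i j : Fin n} (hij : i ≠ j) {y y' : Fin n → S} (hi : y' i = 0) (hj : y' j = 0)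
    (h : ∀ k, k ≠ i → k ≠ j → y k = y' k) :
    oplus (y i) (y j) ∣ MvPolynomial.aeval y f - MvPolynomial.aeval y' f := by
  wlog hlt : i < j generalizing i j
  · rw [oplus_comm]
    exact this hij.symm hj hi (fun k h1 h2 => h k h2 h1)
      (lt_of_le_of_ne (not_lt.1 hlt) hij.symm)
  obtain ⟨r, hr⟩ := oplus_dvd_of_QCancel hf hlt
  have h1 := congrArg (MvPolynomial.aeval (R := ZBeta) y) hr
  rw [map_sub, map_mul, map_oplus, MvPolynomial.aeval_X, MvPolynomial.aeval_X,
    ← AlgHom.comp_apply] at h1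
  have h2 : (MvPolynomial.aeval (R := ZBeta) y).comp
      (MvPolynomial.aeval (fun k => if k = j ∨ k = i then 0 else MvPolynomial.X k)) =
      MvPolynomial.aeval y' := by
    refine MvPolynomial.algHom_ext fun k => ?_
    simp only [MvPolynomial.aeval_X, AlgHom.comp_apply]
    by_cases h1 : k = j
    · simp [h1, hj]
    by_cases h2 : k = i
    · simp [h2, hi]
    simp [h1, h2, h k h2 h1]
  rw [h2] at h1
  rw [h1]
  exact dvd_mul_right _ _

theorem aeval_comp_equiv {n : ℕ} {f : MvPolynomial (Fin n) ZBeta} (hf : f.IsSymmetric)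
    (y : Fin n → S) (σ : Equiv.Perm (Fin n)) :
    MvPolynomial.aeval (y ∘ σ) f = MvPolynomial.aeval y f := by
  rw [← MvPolynomial.aeval_rename, hf σ]

theorem GGamma_mem_fin {X : ClType} {f : ∀ n : ℕ, MvPolynomial (Fin n) ZBeta} (hf : f ∈ GGamma X)
    (n : ℕ) : f n ∈ GGammaFin n := by
  cases X
  · exact hf.1 n
  · exact (hf.1 n).1
  · exact hf.1 n

theorem GGamma_dropLast {X : ClType} {f : ∀ n : ℕ, MvPolynomial (Fin n) ZBeta}
    (hf : f ∈ GGamma X) (n : ℕ) : dropLast n (f (n + 1)) = f n := by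
  cases X <;> exact hf.2 n

theorem aeval_dropLast {n : ℕ} (f : MvPolynomial (Fin (n + 1)) ZBeta) (y : ℕ → S) (hy : y n = 0) :
    MvPolynomial.aeval (fun i : Fin n => y i) (dropLast n f) =
      MvPolynomial.aeval (fun i : Fin (n + 1) => y i) f := by
  rw [dropLast, ← AlgHom.comp_apply]
  congr 1
  refine MvPolynomial.algHom_ext fun k => ?_
  simp only [MvPolynomial.aeval_X, AlgHom.comp_apply]
  split_ifs with h
  · simp
  · have : (k : ℕ) = n := by omega
    simp [this, hy]

theorem aeval_stable {X : ClType} {f : ∀ n : ℕ, MvPolynomial (Fin n) ZBeta} (hf : f ∈ GGamma X)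
    {n m : ℕ} (hnm : n ≤ m) (y : ℕ → S) (hy : ∀ k, n ≤ k → y k = 0) :
    MvPolynomial.aeval (fun i : Fin m => y i) (f m) =
      MvPolynomial.aeval (fun i : Fin n => y i) (f n) := by
  induction m, hnm using Nat.le_induction with
  | base => rfl
  | succ m hm ih => rw [← ih, ← GGamma_dropLast hf m, aeval_dropLast _ _ (hy m hm)]

theorem evalAt_tmul (X : ClType) {S : Type} [CommRing S] [Algebra ZBeta S] [Algebra CoefRing S]
    [IsScalarTower ZBeta CoefRing S] (n : ℕ) (x : Fin n → S) (r : CoefRing) (f : GGamma X) :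
    evalAt X n x (r ⊗ₜ f) = algebraMap CoefRing S r * MvPolynomial.aeval x (f.1 n) := by
  simp [evalAt]

/-- Two evaluations agree if they agree on `GΓ`. -/
theorem evalAt_congr {X : ClType} {S : Type} [CommRing S] [Algebra ZBeta S] [Algebra CoefRing S]
    [IsScalarTower ZBeta CoefRing S] {n m : ℕ} {x : Fin n → S} {y : Fin m → S}
    (h : ∀ f ∈ GGamma X, MvPolynomial.aeval x (f n) = MvPolynomial.aeval y (f m))
    (F : GGammaR X) : evalAt X n x F = evalAt X m y F := by
  induction F using TensorProduct.induction_on with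
  | zero => simp
  | tmul r f => rw [evalAt_tmul, evalAt_tmul, h f.1 f.2]
  | add F G hF hG => rw [map_add, map_add, hF, hG]

theorem map_evalAt {X : ClType} {S T : Type} [CommRing S] [Algebra ZBeta S] [Algebra CoefRing S]
    [IsScalarTower ZBeta CoefRing S] [CommRing T] [Algebra ZBeta T] [Algebra CoefRing T]
    [IsScalarTower ZBeta CoefRing T] (φ : S →ₐ[CoefRing] T) (n : ℕ) (x : Fin n → S)
    (F : GGammaR X) : φ (evalAt X n x F) = evalAt X n (fun i => φ (x i)) F := by
  induction F using TensorProduct.induction_on with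
  | zero => simp
  | tmul r f =>
    rw [evalAt_tmul, evalAt_tmul, map_mul, AlgHom.commutes]
    congr 1
    have := MvPolynomial.comp_aeval_apply x (φ.restrictScalars ZBeta) (f.1 n)
    exact this
  | add F G hF hG => rw [map_add, map_add, map_add, hF, hG]

theorem evalAt_stable {X : ClType} {S : Type} [CommRing S] [Algebra ZBeta S] [Algebra CoefRing S]
    [IsScalarTower ZBeta CoefRing S] {n m : ℕ} (hnm : n ≤ m) (y : ℕ → S)
    (hy : ∀ k, n ≤ k → y k = 0) (F : GGammaR X) :
    evalAt X m (fun i => y i) F = evalAt X n (fun i => y i) F :=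
  evalAt_congr (fun _ hf => aeval_stable hf hnm y hy) F

/-- The sequence with the entry `b_ī` at the place `i` if `i ∈ E`, and the entry `0` otherwise. -/
def placeSeq (E : SP) (k : ℕ) : CoefRing :=
  if k.succPNat ∈ E then b (bar (pos k.succPNat)) else 0

theorem part_eq_zero {E : SP} {i : ℕ} (hi : E.card ≤ i) : part E i = 0 := by
  rw [part, List.getD_eq_default]
  simpa using hi

theorem part_eq_getElem {E : SP} {i : ℕ} (hi : i < E.card) :
    part E i = ((E.sort (· ≥ ·))[i]'(by simpa using hi) : ℕ+) := by
  rw [part, List.getD_eq_getElem _ _ (by simpa using hi)]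
  simp

theorem bSeq_of_lt {X : ClType} {mu : SP} {i : ℕ} (hi : i < (rep X mu).card) :
    bSeq X mu i = b (bar (pos (((rep X mu).sort (· ≥ ·))[i]'(by simpa using hi)))) := by
  have h := part_eq_getElem hi
  have hpos : 0 < part (rep X mu) i := by rw [h]; exact PNat.pos _
  rw [bSeq, dif_pos hpos]
  congr 3
  exact PNat.eq h

theorem bSeq_of_le {X : ClType} {mu : SP} {i : ℕ} (hi : (rep X mu).card ≤ i) :
    bSeq X mu i = 0 := by
  rw [bSeq, dif_neg]
  rw [part_eq_zero hi]
  omega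

/-- The elements of `GΓ` are symmetric, so the entry b_ī may be moved from its rank among the parts
to the place i. There the action of a reflection is visible place by place. -/
theorem localizationAt_eq_placeSeq {X : ClType} (mu : SP) (F : GGammaR X) {n : ℕ}
    (hn : ∀ i ∈ rep X mu, (i : ℕ) ≤ n) :
    localizationAt X mu F = evalAt X n (fun i => placeSeq (rep X mu) i) F := by
  set E := rep X mu with hE
  have hcard : E.card ≤ n := by
    have : E.card ≤ (Finset.Icc (1 : ℕ) n).card :=
      Finset.card_le_card_of_injOn (fun i : ℕ+ => (i : ℕ))
        (fun i hi => by simpa using ⟨i.pos, hn i hi⟩) (fun i _ j _ h => PNat.eq h)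
    simpa using this
  have hlen : (E.sort (· ≥ ·)).length = E.card := by simp
  rw [localizationAt, ← evalAt_stable hcard (bSeq X mu) (fun k hk => bSeq_of_le hk)]
  let f : {k : Fin n // (k : ℕ) < E.card} → {k : Fin n // (k : ℕ).succPNat ∈ E} := fun k =>
    ⟨⟨((E.sort (· ≥ ·))[(k.1 : ℕ)]'(by rw [hlen]; exact k.2) : ℕ+) - 1, by
      have h1 : (E.sort (· ≥ ·))[(k.1 : ℕ)]'(by rw [hlen]; exact k.2) ∈ E :=
        (Finset.mem_sort _).1 (List.getElem_mem _)
      have := hn _ h1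
      have := PNat.pos ((E.sort (· ≥ ·))[(k.1 : ℕ)]'(by rw [hlen]; exact k.2))
      omega⟩, by
      have h1 : (E.sort (· ≥ ·))[(k.1 : ℕ)]'(by rw [hlen]; exact k.2) ∈ E :=
        (Finset.mem_sort _).1 (List.getElem_mem _)
      convert h1
      apply PNat.eq
      have := PNat.pos ((E.sort (· ≥ ·))[(k.1 : ℕ)]'(by rw [hlen]; exact k.2))
      simp only [Nat.succPNat_coe]
      omega⟩
  have hfval : ∀ k, ((f k).1 : ℕ).succPNat =
      (E.sort (· ≥ ·))[(k.1 : ℕ)]'(by rw [hlen]; exact k.2) := by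
    intro k
    apply PNat.eq
    have := PNat.pos ((E.sort (· ≥ ·))[(k.1 : ℕ)]'(by rw [hlen]; exact k.2))
    simp only [Nat.succPNat_coe, f]
    omega
  have hbij : Function.Bijective f := by
    constructor
    · intro k l h
      have h1 := hfval k
      rw [h, hfval l] at h1
      have h2 := (List.Nodup.getElem_inj_iff (Finset.sort_nodup E (· ≥ ·))).1 h1
      exact Subtype.ext (Fin.ext h2.symm)
    · intro k
      obtain ⟨m, hm, h⟩ := List.getElem_of_mem ((Finset.mem_sort (· ≥ ·)).2 k.2)
      have hm' : m < E.card := by rwa [hlen] at hm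
      refine ⟨⟨⟨m, hm'.trans_le hcard⟩, hm'⟩, Subtype.ext (Fin.ext ?_)⟩
      have h1 := hfval ⟨⟨m, hm'.trans_le hcard⟩, hm'⟩
      simp only at h1
      rw [h] at h1
      exact Nat.succPNat_injective h1
  -- f matches the first |E| places with the places of the elements of E. Any extension to a
  -- permutation will do, as both sequences are 0 elsewhere.
  let σ : Equiv.Perm (Fin n) := (Equiv.ofBijective f hbij).extendSubtype
  have hσ : (fun i : Fin n => bSeq X mu i) = (fun i : Fin n => placeSeq E i) ∘ σ := by
    funext k
    by_cases hk : (k : ℕ) < E.card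
    · have h1 : σ k = (f ⟨k, hk⟩).1 := Equiv.extendSubtype_apply_of_mem _ k hk
      rw [Function.comp_apply, bSeq_of_lt (X := X) (mu := mu) hk, h1, placeSeq,
        if_pos (f ⟨k, hk⟩).2, hfval]
    · have h1 := Equiv.extendSubtype_not_mem (Equiv.ofBijective f hbij) k hk
      rw [Function.comp_apply, bSeq_of_le (X := X) (mu := mu) (not_lt.1 hk), placeSeq, if_neg h1]
  rw [hσ]
  exact evalAt_congr (fun g hg => aeval_comp_equiv (GGamma_mem_fin hg n).1 _ σ) F

end Evaluation

/-! ### Elements of `GΓ` defined by lists of polynomials -/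

section Elements

/-- The functions on `E` given by a list of polynomials over `ℤ[β]`. -/
def evalZ {E : Type*} [CommRing E] [Algebra ZBeta E] (M : List (Polynomial ZBeta)) :
    List (E → E) :=
  M.map fun G a => Polynomial.aeval a G

/-- The polynomial in `x₁, …, x_n` given by the sum `hsum`. -/
def hsumPoly (M : List (Polynomial ZBeta)) (n : ℕ) : MvPolynomial (Fin n) ZBeta :=
  (exists_polynomial_hsum n M).choose

variable {M : List (Polynomial ZBeta)} {E : Type} [Field E] [Algebra ZBeta E]

theorem aeval_hsumPoly {n : ℕ} {y : Fin n → E} (hy : Function.Injective y) :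
    MvPolynomial.aeval y (hsumPoly M n) = hsum (evalZ M) (pts y) :=
  (exists_polynomial_hsum n M).choose_spec E (Algebra.ofId ZBeta E) y hy

theorem map_hsum_evalZ {F : Type*} [Field F] [Algebra ZBeta F] (φ : E →ₐ[ZBeta] F)
    (S : Finset E) : φ (hsum (evalZ M) S) = hsum (evalZ M) (S.image φ) := by
  refine map_hsum φ ?_
  unfold evalZ
  rw [List.forall₂_map_left_iff, List.forall₂_map_right_iff, List.forall₂_same]
  intro G _ a _
  exact (Polynomial.aeval_algHom_apply φ a G).symm

/-- The values of a family at the indices other than `i` and `j`. -/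
def offPts {K : Type*} {n : ℕ} (y : Fin n → K) (i j : Fin n) : Finset K :=
  ((Finset.univ.erase i).erase j).image y

theorem mem_offPts {K : Type*} {n : ℕ} {y : Fin n → K} {i j : Fin n} {a : K} :
    a ∈ offPts y i j ↔ ∃ k, k ≠ i ∧ k ≠ j ∧ y k = a := by
  simp only [offPts, Finset.mem_image, Finset.mem_erase, Finset.mem_univ, and_true]
  exact ⟨fun ⟨k, h1, h2⟩ => ⟨k, h1.2, h1.1, h2⟩, fun ⟨k, h1, h2, h3⟩ => ⟨k, ⟨h2, h1⟩, h3⟩⟩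

theorem offPts_congr {K : Type*} {n : ℕ} {y y' : Fin n → K} {i j : Fin n}
    (h : ∀ k, k ≠ i → k ≠ j → y k = y' k) : offPts y i j = offPts y' i j := by
  ext a
  simp only [mem_offPts]
  exact ⟨fun ⟨k, h1, h2, h3⟩ => ⟨k, h1, h2, h k h1 h2 ▸ h3⟩,
    fun ⟨k, h1, h2, h3⟩ => ⟨k, h1, h2, h k h1 h2 ▸ h3⟩⟩

theorem mem_pts {K : Type*} {n : ℕ} {y : Fin n → K} {a : K} : a ∈ pts y ↔ ∃ k, y k = a := by
  simp [pts]

theorem pts_eq_insert {K : Type*} {n : ℕ} (y : Fin n → K) (i j : Fin n) :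
    pts y = insert (y i) (insert (y j) (offPts y i j)) := by
  ext a
  simp only [mem_pts, Finset.mem_insert, mem_offPts]
  constructor
  · rintro ⟨k, rfl⟩
    by_cases h1 : k = i
    · simp [h1]
    by_cases h2 : k = j
    · simp [h2]
    exact Or.inr (Or.inr ⟨k, h1, h2, rfl⟩)
  · rintro (rfl | rfl | ⟨k, -, -, rfl⟩) <;> exact ⟨_, rfl⟩

theorem aeval_hsumPoly_pair {n : ℕ} {y : Fin n → E} (hy : Function.Injective y) {i j : Fin n}
    (hij : i ≠ j) (h : oplus (y i) (y j) = 0) :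
    MvPolynomial.aeval y (hsumPoly M n) = hsum (evalZ M) (offPts y i j) := by
  rw [aeval_hsumPoly hy, pts_eq_insert y i j, hsum_insert_pair h (hy.ne hij)]
  · rw [mem_offPts]
    rintro ⟨k, h1, -, h3⟩
    exact h1 (hy h3)
  · rw [mem_offPts]
    rintro ⟨k, -, h2, h3⟩
    exact h2 (hy h3)

theorem exists_field_embedding (P : Type) [CommRing P] [IsDomain P] [Algebra ZBeta P] :
    ∃ (T : Type) (_ : Field T) (_ : Algebra ZBeta T) (ι : P →ₐ[ZBeta] T), Function.Injective ι :=
  ⟨FractionRing P, inferInstance, inferInstance, IsScalarTower.toAlgHom ZBeta P _,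
    IsFractionRing.injective P _⟩

/-- A domain over `E` with a parameter `s` that specializes to `0` and has an inverse `t` for `⊕`. -/
theorem exists_deformation (E : Type) [Field E] [Algebra ZBeta E] :
    ∃ (P : Type) (_ : CommRing P) (_ : IsDomain P) (_ : Algebra ZBeta P) (C : E →ₐ[ZBeta] P)
      (π : P →ₐ[ZBeta] E) (s t : P), (∀ a, π (C a) = a) ∧ π s = 0 ∧ s ≠ 0 ∧ oplus s t = 0 := by
  let alg : Algebra ZBeta (PowerSeries E) :=
    ((PowerSeries.C (R := E)).comp (algebraMap ZBeta E)).toAlgebra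
  let C : E →ₐ[ZBeta] PowerSeries E := { PowerSeries.C (R := E) with commutes' := fun r => rfl }
  let π : PowerSeries E →ₐ[ZBeta] E :=
    { PowerSeries.constantCoeff (R := E) with
      commutes' := fun r => PowerSeries.constantCoeff_C _ }
  obtain ⟨u, hu⟩ : IsUnit (1 + beta (PowerSeries E) * PowerSeries.X) := by
    rw [PowerSeries.isUnit_iff_constantCoeff]
    simp
  refine ⟨PowerSeries E, inferInstance, inferInstance, alg, C, π, PowerSeries.X,
    -PowerSeries.X * u.inv, fun a => PowerSeries.constantCoeff_C a,
    PowerSeries.constantCoeff_X, PowerSeries.X_ne_zero, ?_⟩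
  have h1 : (1 + beta (PowerSeries E) * PowerSeries.X) * u.inv = 1 := by rw [← hu, u.val_inv]
  unfold oplus
  linear_combination -PowerSeries.X * h1

/-- Two equal points are outside the range of the formula by `hsum`. The two zeros are deformed to s
and ⊖s, which are distinct; this pair is removed, and then s is specialized to 0. -/
theorem aeval_hsumPoly_double_zero [CharZero E] {n : ℕ} {y : Fin n → E} {i j : Fin n} (hij : i ≠ j)
    (hi : y i = 0) (hj : y j = 0)
    (hy : ∀ k l, k ≠ i → k ≠ j → l ≠ i → l ≠ j → y k = y l → k = l) :
    MvPolynomial.aeval y (hsumPoly M n) = hsum (evalZ M) (offPts y i j) := by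
  obtain ⟨P, _, _, _, C, π, s, t', hπC, hs, hs0, ht⟩ := exists_deformation E
  obtain ⟨T, _, _, ι, hι⟩ := exists_field_embedding P
  have ht0 : t' ≠ 0 := fun h => hs0 (by rw [h, oplus_zero] at ht; exact ht)
  have hπt : π t' = 0 := by
    have h := congrArg π ht
    rw [map_oplus, hs, map_zero, oplus_comm, oplus_zero] at h
    exact h
  -- s ⊕ s = s(2 + βs), and the second factor specializes to 2 ≠ 0.
  have hts : t' ≠ s := by
    intro h
    rw [h] at ht
    have h1 : s * (2 + beta P * s) = 0 := by unfold oplus at ht; linear_combination ht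
    have h2 := congrArg π ((mul_eq_zero.1 h1).resolve_left hs0)
    rw [map_add, map_mul, hs, mul_zero, add_zero, map_zero, map_ofNat] at h2
    exact two_ne_zero h2
  have hCs : ∀ a : E, C a ≠ s := by
    intro a h
    have h1 : a = 0 := by rw [← hs, ← h, hπC]
    rw [h1, map_zero] at h
    exact hs0 h.symm
  have hCt : ∀ a : E, C a ≠ t' := by
    intro a h
    have h1 : a = 0 := by rw [← hπt, ← h, hπC]
    rw [h1, map_zero] at h
    exact ht0 h.symm
  let Y : Fin n → P := fun k => if k = i then s else if k = j then t' else C (y k)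
  have hYi : Y i = s := by simp [Y]
  have hYj : Y j = t' := by simp [Y, hij.symm]
  have hYk : ∀ k, k ≠ i → k ≠ j → Y k = C (y k) := fun k h1 h2 => by simp [Y, h1, h2]
  have hCinj : Function.Injective C := Function.LeftInverse.injective hπC
  have hYinj : Function.Injective Y := by
    intro k l h
    by_cases k1 : k = i
    · subst k1
      by_contra hne
      by_cases l2 : l = j
      · subst l2; rw [hYi, hYj] at h; exact hts h.symm
      · rw [hYi, hYk l (Ne.symm hne) l2] at h; exact hCs _ h.symm
    by_cases k2 : k = j
    · subst k2
      by_contra hne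
      by_cases l1 : l = i
      · subst l1; rw [hYi, hYj] at h; exact hts h
      · rw [hYj, hYk l l1 (Ne.symm hne)] at h; exact hCt _ h.symm
    rw [hYk k k1 k2] at h
    by_cases l1 : l = i
    · subst l1; rw [hYi] at h; exact absurd h (hCs _)
    by_cases l2 : l = j
    · subst l2; rw [hYj] at h; exact absurd h (hCt _)
    rw [hYk l l1 l2] at h
    exact hy k l k1 k2 l1 l2 (hCinj h)
  have h1 : MvPolynomial.aeval (fun k => ι (Y k)) (hsumPoly M n) =
      hsum (evalZ M) (offPts (fun k => ι (Y k)) i j) := by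
    refine aeval_hsumPoly_pair (hι.comp hYinj) hij ?_
    rw [Function.comp_apply, Function.comp_apply, hYi, hYj, ← map_oplus, ht, map_zero]
  have h2 : offPts (fun k => ι (Y k)) i j = (offPts y i j).image (ι.comp C) := by
    ext a
    simp only [mem_offPts, Finset.mem_image]
    constructor
    · rintro ⟨k, k1, k2, rfl⟩
      exact ⟨y k, ⟨k, k1, k2, rfl⟩, by rw [hYk k k1 k2]; rfl⟩
    · rintro ⟨-, ⟨k, k1, k2, rfl⟩, rfl⟩
      exact ⟨k, k1, k2, by rw [hYk k k1 k2]; rfl⟩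
  have h3 : MvPolynomial.aeval Y (hsumPoly M n) = C (hsum (evalZ M) (offPts y i j)) := by
    apply hι
    rw [MvPolynomial.comp_aeval_apply, h1, h2, ← map_hsum_evalZ]
    rfl
  have h4 := congrArg π h3
  rw [MvPolynomial.comp_aeval_apply] at h4
  have h5 : (fun k => π (Y k)) = y := by
    funext k
    by_cases k1 : k = i
    · subst k1; rw [hYi, hs, hi]
    by_cases k2 : k = j
    · subst k2; rw [hYj, hj, hπt]
    rw [hYk k k1 k2, hπC]
  rw [h5, hπC] at h4
  exact h4

/-- Both values are the sum over the remaining points. -/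
theorem aeval_hsumPoly_cancel [CharZero E] {n : ℕ} {y y' : Fin n → E} (hy : Function.Injective y)
    {i j : Fin n} (hij : i ≠ j) (h : oplus (y i) (y j) = 0) (hi : y' i = 0) (hj : y' j = 0)
    (hyy : ∀ k, k ≠ i → k ≠ j → y k = y' k) :
    MvPolynomial.aeval y (hsumPoly M n) = MvPolynomial.aeval y' (hsumPoly M n) := by
  rw [aeval_hsumPoly_pair hy hij h, aeval_hsumPoly_double_zero hij hi hj, offPts_congr hyy]
  intro k l k1 k2 l1 l2 hkl
  rw [← hyy k k1 k2, ← hyy l l1 l2] at hkl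
  exact hy hkl

/-- The extension of a family by zeros. -/
def extZero {K : Type*} [Zero K] {n : ℕ} (x : Fin n → K) (k : ℕ) : K :=
  if h : k < n then x ⟨k, h⟩ else 0

theorem extZero_coe {K : Type*} [Zero K] {n : ℕ} (x : Fin n → K) (k : Fin n) :
    extZero x k = x k := by simp [extZero]

theorem extZero_of_le {K : Type*} [Zero K] {n : ℕ} (x : Fin n → K) {k : ℕ} (hk : n ≤ k) :
    extZero x k = 0 := by simp [extZero, hk]

theorem aeval_dropLast_extZero {S : Type*} [CommRing S] [Algebra ZBeta S] {n : ℕ}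
    (f : MvPolynomial (Fin (n + 1)) ZBeta) (x : Fin n → S) :
    MvPolynomial.aeval x (dropLast n f) =
      MvPolynomial.aeval (fun k : Fin (n + 1) => extZero x k) f := by
  rw [← aeval_dropLast f (extZero x) (extZero_of_le x le_rfl)]
  simp only [extZero_coe]

theorem extZero_injective {K : Type*} [Zero K] {n : ℕ} {x : Fin n → K}
    (hx : Function.Injective x) (h0 : ∀ k, x k ≠ 0) :
    Function.Injective fun k : Fin (n + 1) => extZero x k := by
  intro k l h
  simp only [extZero] at h
  split_ifs at h with h1 h2 h2
  · have := hx h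
    simp only [Fin.mk.injEq] at this
    exact Fin.ext this
  · exact absurd h (h0 _)
  · exact absurd h.symm (h0 _)
  · exact Fin.ext (by omega)

theorem pts_extZero {K : Type*} [Zero K] {n : ℕ} (x : Fin n → K) :
    pts (fun k : Fin (n + 1) => extZero x k) = insert 0 (pts x) := by
  ext a
  simp only [mem_pts, Finset.mem_insert]
  constructor
  · rintro ⟨k, rfl⟩
    by_cases h : (k : ℕ) < n
    · exact Or.inr ⟨⟨k, h⟩, by simp [extZero, h]⟩
    · exact Or.inl (extZero_of_le x (by omega))
  · rintro (rfl | ⟨k, rfl⟩)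
    · exact ⟨Fin.last n, extZero_of_le x le_rfl⟩
    · exact ⟨k.castSucc, extZero_coe x k⟩

/-- The variables, in a field that contains the polynomial ring. -/
theorem exists_generic (n : ℕ) : ∃ (K : Type) (_ : Field K) (_ : Algebra ZBeta K)
    (_ : CharZero K) (ι : MvPolynomial (Fin n) ZBeta →ₐ[ZBeta] K), Function.Injective ι :=
  ⟨FractionRing (MvPolynomial (Fin n) ZBeta), inferInstance, inferInstance,
    inferInstance, IsScalarTower.toAlgHom ZBeta _ _, IsFractionRing.injective _ _⟩

theorem isSymmetric_of_aeval {n : ℕ} {f : MvPolynomial (Fin n) ZBeta}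
    (h : ∀ (K : Type) [Field K] [Algebra ZBeta K] (y : Fin n → K) (σ : Equiv.Perm (Fin n)),
      Function.Injective y → (∀ k, y k ≠ 0) →
      MvPolynomial.aeval (y ∘ σ) f = MvPolynomial.aeval y f) : f.IsSymmetric := by
  intro σ
  obtain ⟨K, _, _, _, ι, hι⟩ := exists_generic n
  have h1 := h K (fun k => ι (MvPolynomial.X k)) σ (hι.comp (MvPolynomial.X_injective))
    (fun k h0 => MvPolynomial.X_ne_zero k (hι (h0.trans (map_zero ι).symm)))
  apply hι
  have h2 : ∀ g, ι g = MvPolynomial.aeval (fun k => ι (MvPolynomial.X k)) g := by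
    intro g
    rw [← MvPolynomial.comp_aeval_apply, MvPolynomial.aeval_X_left, AlgHom.id_apply]
  rw [h2, h2, MvPolynomial.aeval_rename, h1]

/-- The family with ⊖x_i in place of x_j still consists of distinct nonzero points, so the
cancellation property has to be known for such families only. -/
theorem aeval_eq_of_cancel {n : ℕ} {f : MvPolynomial (Fin n) ZBeta} {i j : Fin n} (hij : i ≠ j)
    {K : Type} [Field K] [Algebra ZBeta K] [CharZero K] (ι : MvPolynomial (Fin n) ZBeta →ₐ[ZBeta] K)
    (hι : Function.Injective ι) {x : Fin n → K} (hx : ∀ k, x k = ι (MvPolynomial.X k))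
    (h : ∀ y y' : Fin n → K,
      Function.Injective y → (∀ k, y k ≠ 0) → oplus (y i) (y j) = 0 → y' i = 0 →
      y' j = 0 → (∀ k, k ≠ i → k ≠ j → y k = y' k) →
      MvPolynomial.aeval y f = MvPolynomial.aeval y' f) :
    MvPolynomial.aeval (R := ZBeta) (fun k => if k = j then ominus 0 (x i) else x k) f =
      MvPolynomial.aeval (R := ZBeta) (fun k => if k = j ∨ k = i then 0 else x k) f := by
  obtain rfl : x = fun k => ι (MvPolynomial.X k) := funext hx
  have hX : ∀ k, ι (MvPolynomial.X k) ≠ 0 := fun k h0 =>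
    MvPolynomial.X_ne_zero k (hι (h0.trans (map_zero ι).symm))
  have hne : ∀ k, oplus (ι (MvPolynomial.X i)) (ι (MvPolynomial.X k)) ≠ 0 := by
    intro k h0
    rw [← map_oplus] at h0
    have h1 := hι (h0.trans (map_zero ι).symm)
    have h2 := congrArg (MvPolynomial.eval₂Hom (Polynomial.evalRingHom (0 : ℤ))
      (fun _ : Fin n => (1 : ℤ))) h1
    simp [oplus, beta, MvPolynomial.algebraMap_eq] at h2
  have hu : 1 + beta K * ι (MvPolynomial.X i) ≠ 0 := by
    intro h0
    rw [← map_beta ι, ← map_mul, ← map_one ι, ← map_add] at h0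
    have h1 := hι (h0.trans (map_zero _).symm)
    have h2 := congrArg (MvPolynomial.aeval (R := ZBeta) (fun _ => (0 : ZBeta))) h1
    simp at h2
  have hc : oplus (ι (MvPolynomial.X i)) (ominus 0 (ι (MvPolynomial.X i))) = 0 := by
    rw [ominus, zero_sub, oplus_neg_div hu]
  refine h _ _ ?_ ?_ ?_ ?_ ?_ ?_
  · intro k l hkl
    simp only at hkl
    split_ifs at hkl with h1 h2 h2
    · rw [h1, h2]
    · rw [hkl] at hc; exact absurd hc (hne l)
    · rw [← hkl] at hc; exact absurd hc (hne k)
    · exact MvPolynomial.X_injective (hι hkl)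
  · intro k
    simp only
    split_ifs with h1
    · intro h0
      rw [h0, oplus_zero] at hc
      exact hX i hc
    · exact hX k
  · rw [if_neg hij, if_pos rfl, hc]
  · simp
  · simp
  · intro k h1 h2
    simp [h1, h2]

theorem QCancel_of_aeval {n : ℕ} {f : MvPolynomial (Fin n) ZBeta}
    (h : ∀ (K : Type) [Field K] [Algebra ZBeta K] [CharZero K] (y y' : Fin n → K) (i j : Fin n),
      Function.Injective y → (∀ k, y k ≠ 0) → i ≠ j → oplus (y i) (y j) = 0 → y' i = 0 →
      y' j = 0 → (∀ k, k ≠ i → k ≠ j → y k = y' k) →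
      MvPolynomial.aeval y f = MvPolynomial.aeval y' f) : QCancel f := by
  intro i j hij
  exact aeval_eq_of_cancel hij.ne
    (IsScalarTower.toAlgHom ZBeta _ (FractionRing (MvPolynomial (Fin n) ZBeta)))
    (IsFractionRing.injective _ _) (fun _ => rfl)
    (fun y y' h1 h2 => h _ y y' i j h1 h2 hij.ne)

theorem hsumPoly_mem (M : List (Polynomial ZBeta)) (n : ℕ) : hsumPoly M n ∈ GGammaFin n := by
  refine ⟨isSymmetric_of_aeval fun K _ _ y σ hy _ => ?_, QCancel_of_aeval
    fun K _ _ _ y y' i j hy _ hij h hi hj hyy => aeval_hsumPoly_cancel hy hij h hi hj hyy⟩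
  rw [aeval_hsumPoly hy, aeval_hsumPoly (hy.comp σ.injective), pts_comp_equiv]

theorem dropLast_hsumPoly_mem (M : List (Polynomial ZBeta)) (n : ℕ) :
    dropLast n (hsumPoly M (n + 1)) ∈ GGammaFin n := by
  refine ⟨isSymmetric_of_aeval fun K _ _ y σ hy h0 => ?_, QCancel_of_aeval
    fun K _ _ _ y y' i j hy h0 hij h hi hj hyy => ?_⟩
  · rw [aeval_dropLast_extZero, aeval_dropLast_extZero, aeval_hsumPoly (extZero_injective hy h0),
      aeval_hsumPoly (extZero_injective (hy.comp σ.injective) fun k => h0 _), pts_extZero,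
      pts_extZero, pts_comp_equiv]
  · rw [aeval_dropLast_extZero, aeval_dropLast_extZero]
    refine aeval_hsumPoly_cancel (extZero_injective hy h0) (i := i.castSucc) (j := j.castSucc)
      (fun h => hij (Fin.castSucc_injective _ h)) ?_ ?_ ?_ ?_
    · simpa [extZero] using h
    · simpa [extZero] using hi
    · simpa [extZero] using hj
    · intro k h1 h2
      by_cases hk : (k : ℕ) < n
      · simp only [extZero, hk, dif_pos]
        exact hyy _ (fun h => h1 (by rw [← h]; rfl)) (fun h => h2 (by rw [← h]; rfl))
      · simp [extZero, hk]

theorem aeval_generic {n : ℕ} {K : Type*} [CommRing K] [Algebra ZBeta K]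
    (ι : MvPolynomial (Fin n) ZBeta →ₐ[ZBeta] K) (g : MvPolynomial (Fin n) ZBeta) :
    ι g = MvPolynomial.aeval (fun k => ι (MvPolynomial.X k)) g := by
  rw [← MvPolynomial.comp_aeval_apply, MvPolynomial.aeval_X_left, AlgHom.id_apply]

/-- The two new zeros cancel as a pair. A single zero need not be removable, because the entries
need not vanish there; hence only numbers of variables of the same parity are compared. -/
theorem dropLast_dropLast_hsumPoly (M : List (Polynomial ZBeta)) (n : ℕ) :
    dropLast n (dropLast (n + 1) (hsumPoly M (n + 2))) = hsumPoly M n := by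
  obtain ⟨K, _, _, _, ι, hι⟩ := exists_generic n
  apply hι
  have hX : Function.Injective fun k : Fin n => ι (MvPolynomial.X k) :=
    hι.comp (MvPolynomial.X_injective)
  rw [aeval_generic ι, aeval_generic ι (hsumPoly M n), aeval_dropLast_extZero,
    aeval_dropLast_extZero, aeval_hsumPoly hX]
  set x : Fin n → K := fun k => ι (MvPolynomial.X k) with hx
  have hval : ∀ k : Fin (n + 2), extZero (fun k : Fin (n + 1) => extZero x k) k = extZero x k := by
    intro k
    by_cases h : (k : ℕ) < n + 1
    · rw [extZero, dif_pos h]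
    · rw [extZero_of_le _ (by omega), extZero_of_le _ (by omega)]
  simp only [hval]
  have h1 : ((Fin.last (n + 1) : Fin (n + 2)) : ℕ) = n + 1 := rfl
  have h2 : (((Fin.last n).castSucc : Fin (n + 2)) : ℕ) = n := rfl
  have hlt : ∀ k : Fin (n + 2), k ≠ Fin.last (n + 1) → k ≠ (Fin.last n).castSucc →
      (k : ℕ) < n := by
    intro k k1 k2
    have k3 : (k : ℕ) ≠ n + 1 := fun h => k1 (Fin.ext h)
    have k4 : (k : ℕ) ≠ n := fun h => k2 (Fin.ext h)
    omega
  rw [aeval_hsumPoly_double_zero (i := Fin.last (n + 1)) (j := (Fin.last n).castSucc)]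
  · congr 1
    ext a
    rw [mem_offPts, mem_pts]
    constructor
    · rintro ⟨k, k1, k2, rfl⟩
      exact ⟨⟨k, hlt k k1 k2⟩, by rw [extZero, dif_pos (hlt k k1 k2)]⟩
    · rintro ⟨k, rfl⟩
      refine ⟨k.castSucc.castSucc, fun h => ?_, fun h => ?_, extZero_coe x k⟩
      · have := congrArg Fin.val h
        have hk := k.2
        simp at this
        omega
      · have := congrArg Fin.val h
        have hk := k.2
        simp at this
        omega
  · exact fun h => by simpa using congrArg Fin.val h
  · exact extZero_of_le x (by simp)
  · exact extZero_of_le x (by simp)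
  · intro k l k1 k2 l1 l2 h
    rw [extZero, extZero, dif_pos (hlt k k1 k2), dif_pos (hlt l l1 l2)] at h
    have := hX h
    simp only [Fin.mk.injEq] at this
    exact Fin.ext this

/-- The element of the product of the polynomial rings that is given by `hsumPoly` for an even
number of variables. -/
def hsumSeq (M : List (Polynomial ZBeta)) (n : ℕ) : MvPolynomial (Fin n) ZBeta :=
  if Even n then hsumPoly M n else dropLast n (hsumPoly M (n + 1))

theorem hsumSeq_mem_fin (M : List (Polynomial ZBeta)) (n : ℕ) : hsumSeq M n ∈ GGammaFin n := by
  unfold hsumSeq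
  split_ifs
  · exact hsumPoly_mem M n
  · exact dropLast_hsumPoly_mem M n

theorem dropLast_hsumSeq (M : List (Polynomial ZBeta)) (n : ℕ) :
    dropLast n (hsumSeq M (n + 1)) = hsumSeq M n := by
  unfold hsumSeq
  by_cases h : Even n
  · have h1 : ¬ Even (n + 1) := by rwa [Nat.even_add_one, not_not]
    rw [if_neg h1, if_pos h, dropLast_dropLast_hsumPoly]
  · have h1 : Even (n + 1) := Nat.even_add_one.2 h
    rw [if_pos h1, if_neg h]

theorem hsumSeq_mem (M : List (Polynomial ZBeta)) : hsumSeq M ∈ invLimit GGammaFin :=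
  ⟨hsumSeq_mem_fin M, dropLast_hsumSeq M⟩

theorem aeval_hsumSeq_of_even {n : ℕ} (hn : Even n) {y : Fin n → E} (hy : Function.Injective y) :
    MvPolynomial.aeval y (hsumSeq M n) = hsum (evalZ M) (pts y) := by
  rw [hsumSeq, if_pos hn, aeval_hsumPoly hy]

theorem vanish_of_dvd {S : Type*} [CommRing S] [Algebra ZBeta S] {M : List (Polynomial ZBeta)}
    (hM : ∀ G ∈ M, oplus Polynomial.X Polynomial.X ∣ G)
    {a : S} (ha : oplus a a = 0) : ∀ g ∈ evalZ M, g a = 0 := by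
  intro g hg
  obtain ⟨G, hG, rfl⟩ := List.mem_map.1 hg
  obtain ⟨r, rfl⟩ := hM G hG
  change Polynomial.aeval a (_ * r) = 0
  rw [map_mul, map_oplus, Polynomial.aeval_X, ha, zero_mul]

theorem aeval_hsumPoly_self_inverse (hM : ∀ G ∈ M, oplus Polynomial.X Polynomial.X ∣ G) {n : ℕ}
    {y : Fin n → E} (hy : Function.Injective y) {i : Fin n} (hi : oplus (y i) (y i) = 0) :
    MvPolynomial.aeval y (hsumPoly M n) = hsum (evalZ M) (offPts y i i) := by
  rw [aeval_hsumPoly hy, pts_eq_insert y i i, Finset.insert_idem,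
    hsum_insert_self_inverse hi _ (vanish_of_dvd hM hi)]
  rw [mem_offPts]
  rintro ⟨k, h1, -, h3⟩
  exact h1 (hy h3)

/-- x ⊕ x = x(βx + 2) has the two self-inverse roots 0 and -2/β. At each of them all entries vanish,
so x_i can be removed and f takes the same value; hence f - f(x_i = 0) vanishes at both roots. -/
theorem oplus_self_dvd_hsumPoly (hM : ∀ G ∈ M, oplus Polynomial.X Polynomial.X ∣ G) {n : ℕ}
    (i : Fin n) : oplus (MvPolynomial.X i : MvPolynomial (Fin n) ZBeta) (MvPolynomial.X i) ∣
      hsumPoly M n - setZero i (hsumPoly M n) := by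
  have h1 : (MvPolynomial.X i : MvPolynomial (Fin n) ZBeta) ∣
      hsumPoly M n - setZero i (hsumPoly M n) := by
    have := dvd_aeval_sub_aeval (R := ZBeta) (y := MvPolynomial.X)
      (y' := fun k => if k = i then 0 else MvPolynomial.X k)
      (d := (MvPolynomial.X i : MvPolynomial (Fin n) ZBeta))
      (fun k => by by_cases hk : k = i <;> simp [hk]) (hsumPoly M n)
    rwa [MvPolynomial.aeval_X_left, AlgHom.id_apply] at this
  obtain ⟨q, hq⟩ := h1
  obtain ⟨K, _, _, _, ι, hι⟩ := exists_generic n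
  let alg : Algebra (MvPolynomial (Fin n) ZBeta) K := ι.toRingHom.toAlgebra
  have tow : IsScalarTower ZBeta (MvPolynomial (Fin n) ZBeta) K :=
    IsScalarTower.of_algebraMap_eq fun r => (ι.commutes r).symm
  have hβ : beta K ≠ 0 := by
    rw [← map_beta ι, ← map_zero ι, hι.ne_iff]
    intro h
    have h2 := congrArg (MvPolynomial.aeval (R := ZBeta) (fun _ => (0 : ZBeta))) h
    rw [map_beta, map_zero] at h2
    exact Polynomial.X_ne_zero h2
  -- The nonzero solution of c ⊕ c = 0.
  let c : K := -2 / beta K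
  have hc2 : beta K * c + 2 = 0 := by simp only [c]; field_simp; ring
  have hc : oplus c c = 0 := by unfold oplus; linear_combination c * hc2
  have hc0 : c ≠ 0 := by simp only [c]; exact div_ne_zero (by simp) hβ
  have hX : Function.Injective fun k : Fin n => ι (MvPolynomial.X k) :=
    hι.comp (MvPolynomial.X_injective)
  have hXc : ∀ k, ι (MvPolynomial.X k) ≠ c := by
    intro k h
    rw [← h, ← map_beta ι, ← map_mul, ← map_ofNat ι, ← map_add] at hc2
    have h1 := hι (hc2.trans (map_zero ι).symm)
    have h2 := congrArg (MvPolynomial.aeval (R := ZBeta) (fun _ => (0 : ZBeta))) h1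
    rw [map_add, map_mul, MvPolynomial.aeval_X, mul_zero, zero_add, map_ofNat, map_zero] at h2
    exact two_ne_zero h2
  have hX0 : ∀ k, ι (MvPolynomial.X k) ≠ 0 := fun k h0 =>
    MvPolynomial.X_ne_zero k (hι (h0.trans (map_zero ι).symm))
  have hinj : ∀ d : K, (∀ k, ι (MvPolynomial.X k) ≠ d) →
      Function.Injective fun k : Fin n => if k = i then d else ι (MvPolynomial.X k) := by
    intro d hd k l h
    simp only at h
    split_ifs at h with h1 h2 h2
    · rw [h1, h2]
    · exact absurd h.symm (hd l)
    · exact absurd h (hd k)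
    · exact hX h
  have hval : ∀ d : K, (∀ k, ι (MvPolynomial.X k) ≠ d) → oplus d d = 0 →
      MvPolynomial.aeval (R := ZBeta) (fun k => if k = i then d else ι (MvPolynomial.X k))
        (hsumPoly M n) = hsum (evalZ M) (offPts (fun k => ι (MvPolynomial.X k)) i i) := by
    intro d hd hdd
    rw [aeval_hsumPoly_self_inverse hM (hinj d hd) (i := i) (by simpa using hdd)]
    congr 1
    exact offPts_congr fun k hk _ => by simp [hk]
  have hψ : MvPolynomial.aeval (R := ZBeta) (fun k => if k = i then c else ι (MvPolynomial.X k)) q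
      = 0 := by
    have h1 := congrArg (MvPolynomial.aeval (R := ZBeta)
      (fun k => if k = i then c else ι (MvPolynomial.X k))) hq
    rw [map_sub, map_mul, MvPolynomial.aeval_X, if_pos rfl, hval c hXc hc, setZero,
      MvPolynomial.comp_aeval_apply] at h1
    have h2 : (fun k => (MvPolynomial.aeval (R := ZBeta)
        (fun k => if k = i then c else ι (MvPolynomial.X k)))
        (if k = i then 0 else MvPolynomial.X k)) =
        fun k => if k = i then 0 else ι (MvPolynomial.X k) := by
      funext k
      by_cases hk : k = i <;> simp [hk]
    rw [h2, hval 0 hX0 (oplus_zero 0), sub_self] at h1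
    exact (mul_eq_zero.1 h1.symm).resolve_left hc0
  obtain ⟨d, hd⟩ := exists_dvd_pow_mul_of_root i (K := K) hι
    (u := beta (MvPolynomial (Fin n) ZBeta)) (v := 2) (q := q) (c := c)
    (map_ofNat _ 2) (map_beta _)
    (by
      have h1 : algebraMap (MvPolynomial (Fin n) ZBeta) K (beta _) = beta K := map_beta ι
      rw [h1, map_ofNat, hc2]) hψ
  -- The root -2/β gives divisibility by βx_i + 2 up to a power of β. The prime β does not divide
  -- βx_i + 2, so this power can be cancelled.
  have hprime : Prime (beta (MvPolynomial (Fin n) ZBeta)) :=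
    (MvPolynomial.prime_C_iff (Fin n)).2 Polynomial.prime_X
  obtain ⟨r, hr⟩ := hd
  have hnd : ¬ beta (MvPolynomial (Fin n) ZBeta) ∣
      beta (MvPolynomial (Fin n) ZBeta) * MvPolynomial.X i + 2 := by
    rintro ⟨w, hw⟩
    have h2 := congrArg (MvPolynomial.eval₂Hom (Polynomial.evalRingHom (0 : ℤ))
      (fun _ : Fin n => (0 : ℤ))) hw
    rw [map_add, map_mul, map_mul, map_ofNat, MvPolynomial.eval₂Hom_X', mul_zero, zero_add] at h2
    have h3 : (MvPolynomial.eval₂Hom (Polynomial.evalRingHom (0 : ℤ)) (fun _ : Fin n => (0 : ℤ)))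
        (beta (MvPolynomial (Fin n) ZBeta)) = 0 := by
      simp [beta, MvPolynomial.algebraMap_eq]
    rw [h3, zero_mul] at h2
    exact two_ne_zero h2
  obtain ⟨r', hr'⟩ := hprime.pow_dvd_of_dvd_mul_left d hnd (Dvd.intro _ hr)
  rw [hr'] at hr
  have h3 : q = (beta (MvPolynomial (Fin n) ZBeta) * MvPolynomial.X i + 2) * r' :=
    mul_left_cancel₀ (pow_ne_zero d hprime.ne_zero) (by rw [hr]; ring)
  rw [hq, h3]
  exact ⟨r', by unfold oplus; ring⟩

theorem dropLast_hsumPoly_of_dvd (hM : ∀ G ∈ M, oplus Polynomial.X Polynomial.X ∣ G) (n : ℕ) :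
    dropLast n (hsumPoly M (n + 1)) = hsumPoly M n := by
  obtain ⟨K, _, _, _, ι, hι⟩ := exists_generic n
  apply hι
  have hX : Function.Injective fun k : Fin n => ι (MvPolynomial.X k) :=
    hι.comp (MvPolynomial.X_injective)
  have hX0 : ∀ k, ι (MvPolynomial.X k) ≠ 0 := fun k h0 =>
    MvPolynomial.X_ne_zero k (hι (h0.trans (map_zero ι).symm))
  rw [aeval_generic ι, aeval_generic ι (hsumPoly M n), aeval_dropLast_extZero,
    aeval_hsumPoly hX, aeval_hsumPoly (extZero_injective hX hX0), pts_extZero]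
  refine hsum_insert_self_inverse (oplus_zero 0) _ (vanish_of_dvd hM (oplus_zero 0)) ?_
  rw [mem_pts]
  rintro ⟨k, hk⟩
  exact hX0 k hk

/-- The common factor of the entries: `x ⊕ x` for type `C` and `1` for types `B` and `D`. -/
def preFactor (X : ClType) (S : Type*) [CommRing S] [Algebra ZBeta S] (x : S) : S :=
  match X with
  | .C => oplus x x
  | _ => 1

theorem hsumSeq_mem_GGamma {X : ClType} (hM : ∀ G ∈ M, preFactor X _ Polynomial.X ∣ G) :
    hsumSeq M ∈ GGamma X := by
  cases X
  · exact hsumSeq_mem M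
  · have h : ∀ n, hsumSeq M n = hsumPoly M n := by
      intro n
      unfold hsumSeq
      split_ifs
      · rfl
      · exact dropLast_hsumPoly_of_dvd hM n
    exact ⟨fun n => ⟨hsumSeq_mem_fin M n, fun i => by
      rw [h]; exact oplus_self_dvd_hsumPoly hM i⟩, dropLast_hsumSeq M⟩
  · exact hsumSeq_mem M

end Elements

/-! ### The action on strict partitions -/

theorem mem_image_signedPerm (w : signedPerm) (A : Set SNum) (z : SNum) :
    z ∈ w.1 '' A ↔ w.1.symm z ∈ A := by
  rw [Equiv.image_eq_preimage_symm]; rfl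

theorem mem_halfSet_iff (la : SP) (z : SNum) : z ∈ halfSet la ↔ bar z ∉ halfSet la := by
  rcases pos_or_bar_pos z with ⟨j, rfl⟩ | ⟨j, rfl⟩
  · simp [pos_mem_halfSet, bar_pos_mem_halfSet]
  · simp [pos_mem_halfSet, bar_pos_mem_halfSet, bar_bar]

theorem symm_bar (w : signedPerm) (z : SNum) : w.1.symm (bar z) = bar (w.1.symm z) := by
  rw [Equiv.symm_apply_eq, w.2.1, Equiv.apply_symm_apply]

theorem mem_actBC (w : signedPerm) (la : SP) (i : ℕ+) :
    i ∈ actBC w la ↔ w.1.symm (bar (pos i)) ∈ halfSet la := by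
  rw [← mem_image_signedPerm, actBC, Set.Finite.mem_toFinset]; rfl

theorem mem_actBC' (w : signedPerm) (la : SP) (i : ℕ+) :
    i ∈ actBC w la ↔ w.1.symm (pos i) ∉ halfSet la := by
  rw [mem_actBC, symm_bar, mem_halfSet_iff, bar_bar]

theorem halfSet_actBC (w : signedPerm) (la : SP) : halfSet (actBC w la) = w.1 '' halfSet la := by
  ext z
  rw [mem_image_signedPerm]
  rcases pos_or_bar_pos z with ⟨j, rfl⟩ | ⟨j, rfl⟩
  · rw [pos_mem_halfSet, mem_actBC', not_not]
  · rw [bar_pos_mem_halfSet, mem_actBC]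

theorem halfSet_injective : Function.Injective halfSet := by
  intro la mu h
  ext i
  rw [← bar_pos_mem_halfSet, h, bar_pos_mem_halfSet]

theorem actBC_mul (u v : signedPerm) (la : SP) : actBC (u * v) la = actBC u (actBC v la) := by
  apply halfSet_injective
  rw [halfSet_actBC, halfSet_actBC, halfSet_actBC, ← Set.image_comp]
  rfl

theorem actBC_one (la : SP) : actBC 1 la = la := by
  apply halfSet_injective
  rw [halfSet_actBC]
  exact Set.image_id _

theorem lam_eq_actBC (w : signedPerm) : lam w = actBC w ∅ := rfl

theorem sPos_symm (k : ℕ+) (z : SNum) : (sPos k).1.symm z = sFun k z := rfl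

theorem s0_symm (z : SNum) : s0.1.symm z = sFunZero z := rfl

theorem mem_actBC_sPos (k : ℕ+) (E : SP) (i : ℕ+) : i ∈ actBC (sPos k) E ↔
    if i = k then k + 1 ∈ E else if i = k + 1 then k ∈ E else i ∈ E := by
  have h : (sPos k).1.symm (bar (pos i)) =
      bar (pos (if i = k then k + 1 else if i = k + 1 then k else i)) := by
    rw [sPos_symm]
    refine ((sPos k).2.1 (pos i)).trans (congrArg bar ?_)
    change sFun k (pos i) = _
    have h3 : ∀ j : ℕ+, pos i ≠ bar (pos j) := fun j => (bar_pos_ne_pos j i).symm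
    simp only [sFun, pos_injective.eq_iff, h3, if_false]
    split_ifs <;> rfl
  rw [mem_actBC, h, bar_pos_mem_halfSet]
  split_ifs <;> rfl

theorem mem_actBC_s0 (E : SP) (i : ℕ+) : i ∈ actBC s0 E ↔ if i = 1 then 1 ∉ E else i ∈ E := by
  have h : s0.1.symm (bar (pos i)) = if i = 1 then pos i else bar (pos i) := by
    rw [s0_symm]
    apply Subtype.ext
    have hi := i.pos
    rw [sFunZero_val]
    have e1 : i = 1 ↔ (i : ℕ) = 1 := PNat.coe_inj.symm
    simp only [bar, pos, e1, apply_ite Subtype.val]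
    split_ifs <;> omega
  rw [mem_actBC, h]
  split_ifs with h1
  · rw [pos_mem_halfSet, h1]
  · rw [bar_pos_mem_halfSet]

theorem simpleRefl_succ (X : ClType) (k : ℕ) : simpleRefl X (k + 1) = sPos k.succPNat := by
  cases X <;> rfl

theorem mem_actBC_sHat (E : SP) (i : ℕ+) : i ∈ actBC (simpleRefl .D 0) E ↔
    if i = 1 then 2 ∉ E else if i = 2 then 1 ∉ E else i ∈ E := by
  have h : simpleRefl .D 0 = s0 * sPos 1 * s0 := rfl
  have h2 : (1 : ℕ+) + 1 = 2 := rfl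
  have h3 : (2 : ℕ+) ≠ 1 := by decide
  rw [h, actBC_mul, actBC_mul]
  by_cases h1 : i = 1
  · subst h1; simp [mem_actBC_s0, mem_actBC_sPos, h2, h3]
  · by_cases h4 : i = 2
    · subst h4; simp [mem_actBC_s0, mem_actBC_sPos, h2, h3]
    · simp [mem_actBC_s0, mem_actBC_sPos, h2, h1, h4]

theorem sPos_mul_self (k : ℕ+) : sPos k * sPos k = 1 := by
  apply Subtype.ext
  ext z : 1
  exact (sPos k).1.apply_symm_apply z

theorem s0_mul_self : s0 * s0 = 1 := by
  apply Subtype.ext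
  ext z : 1
  exact s0.1.apply_symm_apply z

theorem simpleRefl_mul_self (X : ClType) (i : ℕ) : simpleRefl X i * simpleRefl X i = 1 := by
  cases i with
  | succ k => rw [simpleRefl_succ, sPos_mul_self]
  | zero =>
    cases X
    · exact s0_mul_self
    · exact s0_mul_self
    · have h : simpleRefl .D 0 = s0 * sPos 1 * s0 := rfl
      rw [h]
      have h1 : s0 * sPos 1 * s0 * (s0 * sPos 1 * s0) =
          s0 * (sPos 1 * (s0 * s0) * sPos 1) * s0 := by group
      rw [h1, s0_mul_self, mul_one, sPos_mul_self, mul_one, s0_mul_self]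

theorem simpleRefl_inv (X : ClType) (i : ℕ) : (simpleRefl X i)⁻¹ = simpleRefl X i :=
  inv_eq_of_mul_eq_one_left (simpleRefl_mul_self X i)

theorem simpleRefl_mem (X : ClType) (i : ℕ) : simpleRefl X i ∈ weyl X :=
  Subgroup.subset_closure ⟨i, rfl⟩

theorem exists_word {X : ClType} {w : signedPerm} (hw : w ∈ weyl X) :
    ∃ l : List ℕ, (l.map (simpleRefl X)).prod = w := by
  refine Subgroup.closure_induction (p := fun w _ => ∃ l : List ℕ, (l.map (simpleRefl X)).prod = w)
    ?_ ⟨[], rfl⟩ ?_ ?_ hw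
  · rintro _ ⟨i, rfl⟩
    exact ⟨[i], by simp⟩
  · rintro _ _ _ _ ⟨l, rfl⟩ ⟨m, rfl⟩
    exact ⟨l ++ m, by simp⟩
  · rintro _ _ ⟨l, rfl⟩
    refine ⟨l.reverse, ?_⟩
    rw [List.prod_inv_reverse, List.map_map, List.map_reverse]
    congr 2
    exact List.map_congr_left fun i _ => (simpleRefl_inv X i).symm

theorem actBC_sPos_of_iff {k : ℕ+} {E : SP} (h : k ∈ E ↔ k + 1 ∈ E) : actBC (sPos k) E = E := by
  ext i
  rw [mem_actBC_sPos]
  split_ifs with h1 h2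
  · rw [h1, h]
  · rw [h2, h]
  · rfl

theorem actBC_sPos_raise {k : ℕ+} {E : SP} (h : k ∈ E) (h' : k + 1 ∉ E) :
    actBC (sPos k) E = insert (k + 1) (E.erase k) := by
  ext i
  rw [mem_actBC_sPos, Finset.mem_insert, Finset.mem_erase]
  have := (PNat.lt_add_right k 1).ne
  split_ifs with h1 h2
  · subst h1; simp [h', this]
  · simp [h, h2]
  · simp [h1, h2]

theorem actBC_sPos_lower {k : ℕ+} {E : SP} (h : k ∉ E) (h' : k + 1 ∈ E) :
    actBC (sPos k) E = insert k (E.erase (k + 1)) := by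
  ext i
  rw [mem_actBC_sPos, Finset.mem_insert, Finset.mem_erase]
  have := (PNat.lt_add_right k 1).ne'
  split_ifs with h1 h2
  · simp [h', h1]
  · subst h2; simp [h, this]
  · simp [h1, h2]

theorem actBC_s0_raise {E : SP} (h : 1 ∉ E) : actBC s0 E = insert 1 E := by
  ext i
  rw [mem_actBC_s0, Finset.mem_insert]
  split_ifs with h1 <;> simp [h, h1]

theorem actBC_s0_lower {E : SP} (h : 1 ∈ E) : actBC s0 E = E.erase 1 := by
  ext i
  rw [mem_actBC_s0, Finset.mem_erase]
  split_ifs with h1 <;> simp [h, h1]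

theorem actBC_sHat_of_iff {E : SP} (h : 1 ∈ E ↔ 2 ∉ E) : actBC (simpleRefl .D 0) E = E := by
  ext i
  rw [mem_actBC_sHat]
  split_ifs with h1 h2
  · rw [h1, h]
  · rw [h2, h, not_not]
  · rfl

theorem actBC_sHat_raise {E : SP} (h : 1 ∉ E) (h' : 2 ∉ E) :
    actBC (simpleRefl .D 0) E = insert 1 (insert 2 E) := by
  ext i
  rw [mem_actBC_sHat, Finset.mem_insert, Finset.mem_insert]
  split_ifs with h1 h2
  · simp [h', h1]
  · simp [h, h2]
  · simp [h1, h2]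

theorem actBC_sHat_lower {E : SP} (h : 1 ∈ E) (h' : 2 ∈ E) :
    actBC (simpleRefl .D 0) E = (E.erase 1).erase 2 := by
  ext i
  rw [mem_actBC_sHat, Finset.mem_erase, Finset.mem_erase]
  split_ifs with h1 h2
  · simp [h', h1]
  · simp [h, h2]
  · simp [h1, h2]

theorem even_card_actBC_s0 (E : SP) : Even (actBC s0 E).card ↔ ¬ Even E.card := by
  by_cases h : 1 ∈ E
  · rw [actBC_s0_lower h, ← Finset.card_erase_add_one h, Nat.even_add_one, not_not]
  · rw [actBC_s0_raise h, Finset.card_insert_of_notMem h, Nat.even_add_one]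

theorem card_actBC_sPos (k : ℕ+) (E : SP) : (actBC (sPos k) E).card = E.card := by
  by_cases h : k ∈ E <;> by_cases h' : k + 1 ∈ E
  · rw [actBC_sPos_of_iff (by tauto)]
  · rw [actBC_sPos_raise h h', Finset.card_insert_of_notMem (by simp [h']),
      Finset.card_erase_add_one h]
  · rw [actBC_sPos_lower h h', Finset.card_insert_of_notMem (by simp [h]),
      Finset.card_erase_add_one h']
  · rw [actBC_sPos_of_iff (by tauto)]

/-- s_1̂ = s_0 s_1 s_0 contains two sign changes, and the other generators contain none. Therefore
the type D action stays within the sets of even size. -/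
theorem even_card_actBC {w : signedPerm} (hw : w ∈ weyl .D) (E : SP) :
    Even (actBC w E).card ↔ Even E.card := by
  obtain ⟨l, rfl⟩ := exists_word hw
  clear hw
  induction l with
  | nil => rw [List.map_nil, List.prod_nil, actBC_one]
  | cons i l ih =>
    rw [List.map_cons, List.prod_cons, actBC_mul, ← ih]
    cases i with
    | succ k => rw [simpleRefl_succ, card_actBC_sPos]
    | zero =>
      have h : simpleRefl .D 0 = s0 * sPos 1 * s0 := rfl
      rw [h, actBC_mul, actBC_mul, even_card_actBC_s0, card_actBC_sPos, even_card_actBC_s0, not_not]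

/-! ### The sets `rep X λ` -/

/-- The sets of parts of the `λ(w)`, for `w` in `W(X_∞)`. -/
def IsRep (X : ClType) (E : SP) : Prop :=
  match X with
  | .D => Even E.card
  | _ => True

/-- The inverse of `rep X`. -/
def unrep (X : ClType) (E : SP) : SP :=
  match X with
  | .D => dropDiag E
  | _ => E

theorem act_eq (X : ClType) (w : signedPerm) (la : SP) :
    act X w la = unrep X (actBC w (rep X la)) := by
  cases X <;> rfl

theorem shape_eq (X : ClType) (w : signedPerm) : shape X w = unrep X (lam w) := by
  cases X <;> rfl

theorem add_one_ne_one (i : ℕ+) : i + 1 ≠ 1 := by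
  intro h
  have := congrArg PNat.val h
  have := i.pos
  simp at *

theorem add_one_mem_toEven (la : SP) (i : ℕ+) : i + 1 ∈ toEven la ↔ i ∈ la := by
  unfold toEven
  split_ifs
  · simp [add_one_ne_one]
  · simp

theorem one_mem_toEven (la : SP) : 1 ∈ toEven la ↔ Odd la.card := by
  unfold toEven
  split_ifs with h
  · simp [h]
  · simp [h, add_one_ne_one]

theorem mem_dropDiag (E : SP) (i : ℕ+) : i ∈ dropDiag E ↔ i + 1 ∈ E := by
  unfold dropDiag
  simp only [Finset.mem_image, Finset.mem_filter]
  constructor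
  · rintro ⟨a, ⟨ha, h1⟩, rfl⟩
    rwa [PNat.sub_add_of_lt h1]
  · intro h
    exact ⟨i + 1, ⟨h, PNat.lt_add_left 1 i⟩, PNat.add_sub⟩

theorem eq_one_or_add_one (i : ℕ+) : i = 1 ∨ ∃ j : ℕ+, i = j + 1 := by
  rcases eq_or_ne i 1 with h | h
  · exact Or.inl h
  · exact Or.inr ⟨_, (PNat.sub_add_of_lt (lt_of_le_of_ne one_le h.symm)).symm⟩

theorem card_dropDiag (E : SP) : (dropDiag E).card + (if 1 ∈ E then 1 else 0) = E.card := by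
  have h : (dropDiag E).card = (E.erase 1).card := by
    rw [← Finset.card_map ⟨fun i : ℕ+ => i + 1, add_left_injective 1⟩]
    congr 1
    ext i
    simp only [Finset.mem_map, Function.Embedding.coeFn_mk, mem_dropDiag, Finset.mem_erase]
    constructor
    · rintro ⟨a, ha, rfl⟩
      exact ⟨add_one_ne_one a, ha⟩
    · rintro ⟨h1, h2⟩
      obtain ⟨j, rfl⟩ := (eq_one_or_add_one i).resolve_left h1
      exact ⟨j, h2, rfl⟩
  split_ifs with h1
  · rw [h, Finset.card_erase_add_one h1]
  · rw [h, Finset.erase_eq_of_notMem h1, add_zero]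

theorem unrep_rep (X : ClType) (la : SP) : unrep X (rep X la) = la := by
  cases X
  · rfl
  · rfl
  · ext i
    change i ∈ dropDiag (toEven la) ↔ _
    rw [mem_dropDiag, add_one_mem_toEven]

theorem rep_unrep {X : ClType} {E : SP} (h : IsRep X E) : rep X (unrep X E) = E := by
  cases X
  · rfl
  · rfl
  -- In type D the presence of 1 is lost by `unrep` and recovered from the parity of the other
  -- elements.
  · change Even E.card at h
    ext i
    change i ∈ toEven (dropDiag E) ↔ _
    rcases eq_one_or_add_one i with rfl | ⟨j, rfl⟩
    · rw [one_mem_toEven]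
      rw [← card_dropDiag E] at h
      split_ifs at h with h1
      · simpa [h1, Nat.even_add_one] using h
      · simpa [h1] using h
    · rw [add_one_mem_toEven, mem_dropDiag]

theorem isRep_rep (X : ClType) (la : SP) : IsRep X (rep X la) := by
  cases X
  · trivial
  · trivial
  · change Even (toEven la).card
    have h : dropDiag (toEven la) = la := unrep_rep .D la
    rw [← card_dropDiag, h]
    split_ifs with h1
    · exact ((one_mem_toEven la).1 h1).add_one
    · rw [one_mem_toEven] at h1
      rw [add_zero]; exact Nat.not_odd_iff_even.1 h1

theorem isRep_actBC {X : ClType} {w : signedPerm} (hw : w ∈ weyl X) {E : SP} (h : IsRep X E) :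
    IsRep X (actBC w E) := by
  cases X
  · trivial
  · trivial
  · exact (even_card_actBC hw E).2 h

theorem rep_act {X : ClType} {w : signedPerm} (hw : w ∈ weyl X) (la : SP) :
    rep X (act X w la) = actBC w (rep X la) := by
  rw [act_eq, rep_unrep (isRep_actBC hw (isRep_rep X la))]

theorem isRep_empty (X : ClType) : IsRep X ∅ := by cases X <;> simp [IsRep]

theorem rep_shape {X : ClType} {w : signedPerm} (hw : w ∈ weyl X) :
    rep X (shape X w) = lam w := by
  rw [shape_eq, rep_unrep]
  exact isRep_actBC hw (isRep_empty X)

theorem rep_injective (X : ClType) : Function.Injective (rep X) :=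
  Function.LeftInverse.injective (unrep_rep X)

theorem rep_empty (X : ClType) : rep X ∅ = ∅ := by
  cases X
  · rfl
  · rfl
  · simp [rep, toEven]

theorem act_shape {X : ClType} {w v : signedPerm} (hw : w ∈ weyl X) (hv : v ∈ weyl X) :
    act X w (shape X v) = shape X (w * v) := by
  apply rep_injective X
  rw [rep_act hw, rep_shape hv, rep_shape (mul_mem hw hv), actBC_lam]

theorem act_mul {X : ClType} {w v : signedPerm} (hw : w ∈ weyl X) (hv : v ∈ weyl X) (la : SP) :
    act X (w * v) la = act X w (act X v la) := by
  apply rep_injective X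
  rw [rep_act hw, rep_act hv, rep_act (mul_mem hw hv), actBC_mul]

theorem act_one (X : ClType) (la : SP) : act X 1 la = la := by
  rw [act_eq, actBC_one, unrep_rep]

theorem act_simple_act (X : ClType) (i : ℕ) (la : SP) :
    act X (simpleRefl X i) (act X (simpleRefl X i) la) = la := by
  rw [← act_mul (simpleRefl_mem X i) (simpleRefl_mem X i), simpleRefl_mul_self, act_one]

/-! ### The Bruhat order and sizes of strict partitions -/

/-- The contribution of an element of `rep X λ` to the size of `λ`. -/
def partWeight (X : ClType) (i : ℕ+) : ℕ :=
  match X with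
  | .D => i - 1
  | _ => i

/-- The size of the strict partition `unrep X E`. -/
def weight (X : ClType) (E : SP) : ℕ := ∑ i ∈ E, partWeight X i

/-- The size of a strict partition, that is, the sum of its parts. -/
def size (X : ClType) (la : SP) : ℕ := weight X (rep X la)

theorem partWeight_succ (X : ClType) (k : ℕ+) : partWeight X (k + 1) = partWeight X k + 1 := by
  have := k.pos
  cases X
  · rfl
  · rfl
  · simp only [partWeight, PNat.add_coe, PNat.one_coe]; omega

theorem weight_insert {X : ClType} {E : SP} {i : ℕ+} (h : i ∉ E) :
    weight X (insert i E) = weight X E + partWeight X i := by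
  rw [weight, Finset.sum_insert h, add_comm]; rfl

theorem weight_erase {X : ClType} {E : SP} {i : ℕ+} (h : i ∈ E) :
    weight X (E.erase i) + partWeight X i = weight X E :=
  Finset.sum_erase_add _ _ h

theorem weight_sPos_raise (X : ClType) {k : ℕ+} {E : SP} (h : k ∈ E) (h' : k + 1 ∉ E) :
    weight X (actBC (sPos k) E) = weight X E + 1 := by
  rw [actBC_sPos_raise h h', weight_insert (by simp [h']), partWeight_succ, ← add_assoc,
    weight_erase h]

theorem weight_sPos_lower (X : ClType) {k : ℕ+} {E : SP} (h : k ∉ E) (h' : k + 1 ∈ E) :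
    weight X (actBC (sPos k) E) + 1 = weight X E := by
  rw [actBC_sPos_lower h h', weight_insert (by simp [h]), add_assoc, ← partWeight_succ,
    weight_erase h']

theorem weight_s0_raise {X : ClType} (hX : X ≠ .D) {E : SP} (h : 1 ∉ E) :
    weight X (actBC s0 E) = weight X E + 1 := by
  rw [actBC_s0_raise h, weight_insert h]
  cases X
  · rfl
  · rfl
  · exact absurd rfl hX

theorem weight_s0_lower {X : ClType} (hX : X ≠ .D) {E : SP} (h : 1 ∈ E) :
    weight X (actBC s0 E) + 1 = weight X E := by
  rw [actBC_s0_lower h, ← weight_erase h]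
  cases X
  · rfl
  · rfl
  · exact absurd rfl hX

theorem weight_sHat_raise {E : SP} (h : 1 ∉ E) (h' : 2 ∉ E) :
    weight .D (actBC (simpleRefl .D 0) E) = weight .D E + 1 := by
  rw [actBC_sHat_raise h h', weight_insert (by simp [h]), weight_insert h']
  rfl

theorem weight_sHat_lower {E : SP} (h : 1 ∈ E) (h' : 2 ∈ E) :
    weight .D (actBC (simpleRefl .D 0) E) + 1 = weight .D E := by
  rw [actBC_sHat_lower h h', ← weight_erase h,
    ← weight_erase (E := E.erase 1) (i := 2) (by simp [h'])]
  rfl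

theorem simpleRefl_zero {X : ClType} (hX : X ≠ .D) : simpleRefl X 0 = s0 := by
  cases X
  · rfl
  · rfl
  · exact absurd rfl hX

theorem weight_simple (X : ClType) (i : ℕ) (E : SP) : actBC (simpleRefl X i) E = E ∨
    weight X (actBC (simpleRefl X i) E) = weight X E + 1 ∨
    weight X (actBC (simpleRefl X i) E) + 1 = weight X E := by
  cases i with
  | succ k =>
    rw [simpleRefl_succ]
    by_cases h : k.succPNat ∈ E <;> by_cases h' : k.succPNat + 1 ∈ E
    · exact Or.inl (actBC_sPos_of_iff (by tauto))
    · exact Or.inr (Or.inl (weight_sPos_raise X h h'))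
    · exact Or.inr (Or.inr (weight_sPos_lower X h h'))
    · exact Or.inl (actBC_sPos_of_iff (by tauto))
  | zero =>
    by_cases hX : X = .D
    · subst hX
      by_cases h : 1 ∈ E <;> by_cases h' : 2 ∈ E
      · exact Or.inr (Or.inr (weight_sHat_lower h h'))
      · exact Or.inl (actBC_sHat_of_iff (by tauto))
      · exact Or.inl (actBC_sHat_of_iff (by tauto))
      · exact Or.inr (Or.inl (weight_sHat_raise h h'))
    · rw [simpleRefl_zero hX]
      by_cases h : 1 ∈ E
      · exact Or.inr (Or.inr (weight_s0_lower hX h))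
      · exact Or.inr (Or.inl (weight_s0_raise hX h))

theorem size_act_simple (X : ClType) (i : ℕ) (la : SP) : act X (simpleRefl X i) la = la ∨
    size X (act X (simpleRefl X i) la) = size X la + 1 ∨
    size X (act X (simpleRefl X i) la) + 1 = size X la := by
  have h := weight_simple X i (rep X la)
  rw [← rep_act (simpleRefl_mem X i)] at h
  exact h.imp_left fun h => rep_injective X h

theorem exists_sPos_lower {X : ClType} {E : SP} {m : ℕ+} (hm : m ∈ E) (h1 : m ≠ 1)
    (h2 : ∀ j : ℕ+, m = j + 1 → j ∉ E) :
    ∃ i, weight X (actBC (simpleRefl X i) E) + 1 = weight X E := by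
  obtain ⟨j, rfl⟩ := (eq_one_or_add_one m).resolve_left h1
  refine ⟨j.natPred + 1, ?_⟩
  rw [simpleRefl_succ, PNat.succPNat_natPred]
  exact weight_sPos_lower X (h2 j rfl) hm

/-- The smallest element can be lowered by 1, or removed if it is 1. In type D the element 1 has
weight 0, so the smallest element m > 1 is used: s_1̂ removes 1 and 2 if both are present, and
otherwise m is lowered. -/
theorem exists_weight_lower {X : ClType} {E : SP} (hE : IsRep X E) (h : E ≠ ∅) :
    ∃ i, weight X (actBC (simpleRefl X i) E) + 1 = weight X E := by
  by_cases hX : X = .D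
  · subst hX
    change Even E.card at hE
    have hne : (E.erase 1).Nonempty := by
      rw [Finset.nonempty_iff_ne_empty]
      intro h0
      rcases (Finset.erase_eq_empty_iff E 1).1 h0 with h1 | h1
      · exact h h1
      · rw [h1] at hE; simp at hE
    obtain ⟨m, hm, hle⟩ : ∃ m ∈ E.erase 1, ∀ j ∈ E.erase 1, m ≤ j :=
      ⟨_, Finset.min'_mem _ hne, fun j hj => Finset.min'_le _ j hj⟩
    rw [Finset.mem_erase] at hm
    obtain ⟨j, rfl⟩ := (eq_one_or_add_one m).resolve_left hm.1
    by_cases hj : j ∈ E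
    · by_cases hj1 : j = 1
      · subst hj1
        exact ⟨0, weight_sHat_lower hj hm.2⟩
      · have := hle j (by simp [hj, hj1])
        exact absurd (PNat.lt_add_right j 1) (not_lt.2 this)
    · exact exists_sPos_lower hm.2 hm.1 fun i hi => by rwa [← add_left_injective 1 hi]
  · have hne := Finset.nonempty_iff_ne_empty.2 h
    obtain ⟨m, hm, hle⟩ : ∃ m ∈ E, ∀ j ∈ E, m ≤ j :=
      ⟨_, Finset.min'_mem _ hne, fun j hj => Finset.min'_le _ j hj⟩
    by_cases h1 : m = 1
    · subst h1
      exact ⟨0, by rw [simpleRefl_zero hX]; exact weight_s0_lower hX hm⟩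
    · refine exists_sPos_lower hm h1 ?_
      rintro j rfl hj
      exact absurd (PNat.lt_add_right j 1) (not_lt.2 (hle j hj))

theorem exists_size_lower {X : ClType} {la : SP} (h : la ≠ ∅) :
    ∃ i, size X (act X (simpleRefl X i) la) + 1 = size X la := by
  have h' : rep X la ≠ ∅ := fun h0 => h (rep_injective X (h0.trans (rep_empty X).symm))
  obtain ⟨i, hi⟩ := exists_weight_lower (isRep_rep X la) h'
  refine ⟨i, ?_⟩
  rw [size, rep_act (simpleRefl_mem X i), hi, size]

theorem size_empty (X : ClType) : size X ∅ = 0 := by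
  rw [size, rep_empty]; rfl

theorem shape_one (X : ClType) : shape X 1 = ∅ := by
  apply rep_injective X
  rw [rep_shape (one_mem _), lam_eq_actBC, actBC_one, rep_empty]

theorem word_mem (X : ClType) (l : List ℕ) : (l.map (simpleRefl X)).prod ∈ weyl X := by
  refine Subgroup.list_prod_mem _ fun x hx => ?_
  obtain ⟨i, -, rfl⟩ := List.mem_map.1 hx
  exact simpleRefl_mem X i

theorem size_shape_word_le (X : ClType) (l : List ℕ) :
    size X (shape X (l.map (simpleRefl X)).prod) ≤ l.length := by
  induction l with
  | nil => rw [List.map_nil, List.prod_nil, shape_one, size_empty]; exact le_rfl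
  | cons i l ih =>
    rw [List.map_cons, List.prod_cons, ← act_shape (simpleRefl_mem X i) (word_mem X l),
      List.length_cons]
    rcases size_act_simple X i (shape X (l.map (simpleRefl X)).prod) with h | h | h
    · rw [h]; omega
    · omega
    · omega

/-- Each letter of a word changes the size by at most 1. -/
theorem size_shape_le_length {X : ClType} {w : signedPerm} (hw : w ∈ weyl X) :
    size X (shape X w) ≤ length X w := by
  obtain ⟨l, hl⟩ := exists_word hw
  obtain ⟨m, hm, rfl⟩ := Nat.sInf_mem
    (s := {n | ∃ l : List ℕ, l.length = n ∧ (l.map (simpleRefl X)).prod = w}) ⟨_, l, rfl, hl⟩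
  rw [length, ← hm]
  exact size_shape_word_le X m

theorem length_mul_le {X : ClType} {w : signedPerm} (hw : w ∈ weyl X) (i : ℕ) :
    length X (simpleRefl X i * w) ≤ length X w + 1 := by
  obtain ⟨l, hl⟩ := exists_word hw
  obtain ⟨m, hm, h⟩ := Nat.sInf_mem
    (s := {n | ∃ l : List ℕ, l.length = n ∧ (l.map (simpleRefl X)).prod = w}) ⟨_, l, rfl, hl⟩
  exact Nat.sInf_le ⟨i :: m, by rw [List.length_cons, hm]; rfl, by simp [h]⟩

theorem length_one (X : ClType) : length X 1 = 0 :=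
  Nat.sInf_eq_zero.2 (Or.inl ⟨[], rfl, rfl⟩)

/-! ### Grassmannian elements, their length, and the order on strict partitions -/

theorem sFun_lt {k : ℕ+} {x y : SNum} (h : x < y) : sFun k x < sFun k y ∨
    (x = pos k ∧ y = pos (k + 1)) ∨ (x = bar (pos (k + 1)) ∧ y = bar (pos k)) := by
  have h' : x.1 < y.1 := h
  have hk := k.pos
  simp only [Subtype.ext_iff, pos, bar, PNat.add_coe, PNat.one_coe]
  change (sFun k x).1 < (sFun k y).1 ∨ _
  rw [sFun_val, sFun_val]
  push_cast
  split_ifs <;> omega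

theorem sFunZero_lt {x y : SNum} (h : x < y) : sFunZero x < sFunZero y ∨
    (x = bar (pos 1) ∧ y = pos 1) := by
  have h' : x.1 < y.1 := h
  have hx := x.2
  have hy := y.2
  simp only [Subtype.ext_iff, pos, bar, PNat.one_coe]
  change (sFunZero x).1 < (sFunZero y).1 ∨ _
  rw [sFunZero_val, sFunZero_val]
  push_cast
  split_ifs <;> omega

theorem sHat_val (z : SNum) : ((simpleRefl .D 0).1 z).1 =
    if z.1 = 1 then -2 else if z.1 = 2 then -1 else if z.1 = -1 then 2
    else if z.1 = -2 then 1 else z.1 := by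
  have h : (simpleRefl .D 0).1 z = sFunZero (sFun 1 (sFunZero z)) := rfl
  have h1 := sFunZero_val z
  have h2 := sFun_val 1 (sFunZero z)
  have h3 := sFunZero_val (sFun 1 (sFunZero z))
  rw [h, h3]
  push_cast [PNat.one_coe] at h2
  generalize (sFun 1 (sFunZero z)).1 = c at *
  generalize (sFunZero z).1 = d at *
  have hz := z.2
  split_ifs at h1 <;> split_ifs at h2 <;> split_ifs <;> omega

theorem sHat_lt {x y : SNum} (h : x < y) :
    (simpleRefl .D 0).1 x < (simpleRefl .D 0).1 y ∨ x = bar y ∨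
    (x = bar (pos 2) ∧ y = pos 1) ∨ (x = bar (pos 1) ∧ y = pos 2) := by
  have h' : x.1 < y.1 := h
  have hx := x.2
  have hy := y.2
  have h2 : ((2 : ℕ+) : ℕ) = 2 := rfl
  simp only [Subtype.ext_iff, pos, bar, PNat.one_coe, h2]
  change ((simpleRefl .D 0).1 x).1 < ((simpleRefl .D 0).1 y).1 ∨ _
  rw [sHat_val, sHat_val]
  push_cast
  split_ifs <;> omega

theorem bar_mem_halfSet {la : SP} {z : SNum} (h : z ∈ halfSet la) : bar z ∉ halfSet la :=
  (mem_halfSet_iff la z).1 h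

/-- A simple reflection reverses the order of very few pairs. If w(ℕ) contained such a pair, it
would be stable under the reflection or would contain some z together with z̄. Hence s_i w is
Grassmannian whenever w is and s_i moves its coset. -/
theorem simpleRefl_lt {X : ClType} {i : ℕ} {E : SP} (h : actBC (simpleRefl X i) E ≠ E)
    {x y : SNum} (hx : x ∈ halfSet E) (hy : y ∈ halfSet E) (hxy : x < y) :
    (simpleRefl X i).1 x < (simpleRefl X i).1 y := by
  cases i with
  | succ k =>
    rw [simpleRefl_succ] at h ⊢
    rcases sFun_lt (k := k.succPNat) hxy with h1 | ⟨rfl, rfl⟩ | ⟨rfl, rfl⟩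
    · exact h1
    · rw [pos_mem_halfSet] at hx hy
      exact absurd (actBC_sPos_of_iff (by tauto)) h
    · rw [bar_pos_mem_halfSet] at hx hy
      exact absurd (actBC_sPos_of_iff (by tauto)) h
  | zero =>
    by_cases hX : X = .D
    · subst hX
      rcases sHat_lt hxy with h1 | rfl | ⟨rfl, rfl⟩ | ⟨rfl, rfl⟩
      · exact h1
      · exact absurd hx (bar_mem_halfSet hy)
      · rw [pos_mem_halfSet] at hy
        rw [bar_pos_mem_halfSet] at hx
        exact absurd (actBC_sHat_of_iff (by tauto)) h
      · rw [pos_mem_halfSet] at hy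
        rw [bar_pos_mem_halfSet] at hx
        exact absurd (actBC_sHat_of_iff (by tauto)) h
    · rw [simpleRefl_zero hX]
      rcases sFunZero_lt hxy with h1 | ⟨rfl, rfl⟩
      · exact h1
      · exact absurd hx (bar_mem_halfSet hy)

theorem IsGrassmannian.simple_mul {X : ClType} {i : ℕ} {u : signedPerm} (hw : u ∈ weyl X)
    (hu : IsGrassmannian u) (h : act X (simpleRefl X i) (shape X u) ≠ shape X u) :
    IsGrassmannian (simpleRefl X i * u) := by
  have h' : actBC (simpleRefl X i) (lam u) ≠ lam u := by
    intro h0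
    apply h
    apply rep_injective X
    rw [rep_act (simpleRefl_mem X i), rep_shape hw, h0]
  have hm : ∀ j, u.1 (pos j) ∈ halfSet (lam u) := by
    intro j
    rw [halfSet_lam]
    exact ⟨pos j, by simp [pos_mem_halfSet], rfl⟩
  exact fun j k hjk => simpleRefl_lt h' (hm j) (hm k) (hu j k hjk)

theorem IsGrassmannian.eq_one {u : signedPerm} (hu : IsGrassmannian u) (h : lam u = ∅) : u = 1 := by
  have h1 : halfSet ∅ = u.1 '' halfSet ∅ := by rw [← halfSet_lam, h]
  have hpos : ∀ z, z ∈ halfSet ∅ ↔ ∃ i, z = pos i := by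
    intro z; simp [halfSet]
  have h2 : ∀ i, ∃ j, u.1 (pos i) = pos j := fun i => by
    rw [← hpos, h1]
    exact ⟨pos i, (hpos _).2 ⟨i, rfl⟩, rfl⟩
  choose f hf using h2
  have hmono : StrictMono f := by
    intro i j hij
    have h3 : (u.1 (pos i)).1 < (u.1 (pos j)).1 := hu i j hij
    rw [hf, hf] at h3
    simp only [pos] at h3
    exact_mod_cast h3
  have hsurj : Function.Surjective f := by
    intro j
    have h3 : pos j ∈ u.1 '' halfSet ∅ := by rw [← h1]; exact (hpos _).2 ⟨j, rfl⟩
    obtain ⟨z, hz, hzj⟩ := h3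
    obtain ⟨i, rfl⟩ := (hpos z).1 hz
    exact ⟨i, pos_injective ((hf i).symm.trans hzj)⟩
  -- A well order has no nontrivial order automorphism.
  have hid : hmono.orderIsoOfSurjective f hsurj = OrderIso.refl ℕ+ := Subsingleton.elim _ _
  have h4 : ∀ i, u.1 (pos i) = pos i := fun i => by
    rw [hf i]
    exact congrArg pos (DFunLike.congr_fun hid i)
  apply Subtype.ext
  ext z : 1
  rcases pos_or_bar_pos z with ⟨i, rfl⟩ | ⟨i, rfl⟩
  · exact h4 i
  · rw [u.2.1, h4]; rfl

theorem eq_empty_of_size {X : ClType} {la : SP} (h : size X la = 0) : la = ∅ := by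
  by_contra h0
  obtain ⟨i, hi⟩ := exists_size_lower (X := X) h0
  omega

/-- Simple reflections lower the size one by one down to the empty partition and keep u
Grassmannian; only the identity is Grassmannian of empty shape. -/
theorem length_le_size {X : ClType} {u : signedPerm} (hw : u ∈ weyl X) (hu : IsGrassmannian u) :
    length X u ≤ size X (shape X u) := by
  induction hn : size X (shape X u) generalizing u with
  | zero =>
    have h0 := eq_empty_of_size hn
    have h1 : lam u = ∅ := by rw [← rep_shape hw, h0, rep_empty]
    rw [hu.eq_one h1, length_one]
  | succ n ih =>
    have hne : shape X u ≠ ∅ := by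
      intro h0
      rw [h0, size_empty] at hn
      omega
    obtain ⟨i, hi⟩ := exists_size_lower (X := X) hne
    have hs := simpleRefl_mem X i
    have h1 : IsGrassmannian (simpleRefl X i * u) := by
      refine hu.simple_mul hw fun h0 => ?_
      rw [h0] at hi
      omega
    have h2 := ih (mul_mem hs hw) h1 (by rw [← act_shape hs hw]; omega)
    have h3 := length_mul_le (mul_mem hs hw) i
    rw [← mul_assoc, simpleRefl_mul_self, one_mul] at h3
    omega

theorem length_eq_size {X : ClType} {u : signedPerm} (hw : u ∈ weyl X) (hu : IsGrassmannian u) :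
    length X u = size X (shape X u) :=
  le_antisymm (length_le_size hw hu) (size_shape_le_length hw)

theorem exists_grassmannian (X : ClType) (la : SP) :
    ∃ u ∈ weyl X, IsGrassmannian u ∧ shape X u = la := by
  induction hn : size X la generalizing la with
  | zero =>
    rw [eq_empty_of_size hn]
    refine ⟨1, one_mem _, fun i j hij => ?_, shape_one X⟩
    change ((i : ℕ) : ℤ) < ((j : ℕ) : ℤ)
    exact_mod_cast hij
  | succ n ih =>
    have hne : la ≠ ∅ := by
      intro h0
      rw [h0, size_empty] at hn
      omega
    obtain ⟨i, hi⟩ := exists_size_lower (X := X) hne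
    have hs := simpleRefl_mem X i
    obtain ⟨u, hw, hu, h⟩ := ih (act X (simpleRefl X i) la) (by omega)
    have h1 : act X (simpleRefl X i) (shape X u) = la := by rw [h, act_simple_act]
    refine ⟨simpleRefl X i * u, mul_mem hs hw, hu.simple_mul hw ?_, ?_⟩
    · intro h0
      rw [h1] at h0
      rw [← h0] at h
      rw [← h] at hi
      omega
    · rw [← act_shape hs hw, h1]

theorem size_le_of_SPle {X : ClType} {la mu : SP} (h : SPle X la mu) : size X la ≤ size X mu := by
  obtain ⟨u, hu, v, hv, hgu, hgv, rfl, rfl, hb⟩ := h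
  rw [← length_eq_size hu hgu, ← length_eq_size hv hgv]
  clear hgu hgv hu hv
  induction hb with
  | refl => exact le_rfl
  | tail _ h ih =>
    obtain ⟨t, -, -, hlt⟩ := h
    exact ih.trans hlt.le

theorem SPle_act_of_size_lt {X : ClType} {i : ℕ} {la : SP}
    (h : size X la < size X (act X (simpleRefl X i) la)) :
    SPle X la (act X (simpleRefl X i) la) := by
  obtain ⟨u, hu, hgu, rfl⟩ := exists_grassmannian X la
  have hs := simpleRefl_mem X i
  have hg : IsGrassmannian (simpleRefl X i * u) :=
    hgu.simple_mul hu fun h0 => by rw [h0] at h; exact lt_irrefl _ h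
  -- The Bruhat order multiplies by reflections on the right: s_i u = u (u⁻¹ s_i u).
  refine ⟨u, hu, simpleRefl X i * u, mul_mem hs hu, hgu, hg, rfl, (act_shape hs hu).symm,
    Relation.ReflTransGen.single ⟨u⁻¹ * simpleRefl X i * u⁻¹⁻¹, ⟨u⁻¹, inv_mem hu, i, rfl⟩, ?_, ?_⟩⟩
  · group
  · rw [length_eq_size hu hgu, length_eq_size (mul_mem hs hu) hg, ← act_shape hs hu]
    exact h

theorem SPle_refl (X : ClType) (la : SP) : SPle X la la := by
  obtain ⟨u, hu, hgu, rfl⟩ := exists_grassmannian X la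
  exact ⟨u, hu, u, hu, hgu, hgu, rfl, rfl, Relation.ReflTransGen.refl⟩

/-- Schubert families compare only λ with s_i λ. For such a pair one Bruhat step suffices, and its
direction is read off from the size. -/
theorem SPle_act_iff (X : ClType) (i : ℕ) (la : SP) : SPle X la (act X (simpleRefl X i) la) ↔
    size X la ≤ size X (act X (simpleRefl X i) la) := by
  refine ⟨size_le_of_SPle, fun h => ?_⟩
  rcases size_act_simple X i la with h1 | h1 | h1
  · rw [h1]; exact SPle_refl X la
  · exact SPle_act_of_size_lt (by omega)
  · omega

theorem SPlt_act_iff (X : ClType) (i : ℕ) (la : SP) : SPlt X (act X (simpleRefl X i) la) la ↔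
    size X (act X (simpleRefl X i) la) < size X la := by
  constructor
  · rintro ⟨h, hne⟩
    have := size_le_of_SPle h
    rcases size_act_simple X i la with h1 | h1 | h1
    · exact absurd h1 hne
    · omega
    · omega
  · intro h
    refine ⟨?_, fun h0 => by rw [h0] at h; exact lt_irrefl _ h⟩
    have h1 := SPle_act_of_size_lt (X := X) (i := i) (la := act X (simpleRefl X i) la)
      (by rwa [act_simple_act])
    rwa [act_simple_act] at h1

/-! ### The elements `GX_λ(x|b)` -/

theorem map_preFactor {S T : Type*} [CommRing S] [Algebra ZBeta S] [CommRing T] [Algebra ZBeta T]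
    (X : ClType) (φ : S →ₐ[ZBeta] T) (x : S) : φ (preFactor X S x) = preFactor X T (φ x) := by
  cases X
  · exact map_one φ
  · exact map_oplus φ x x
  · exact map_one φ

/-- The number of factors `x ⊕ b_j` in the entry that belongs to the part `p`. -/
def numFactors (X : ClType) (p : ℕ+) : ℕ :=
  match X with
  | .C => p - 1
  | _ => p

/-- The function `[x|b]^p` or `[[x|b]]^p`. -/
def entry (X : ClType) {S : Type*} [CommRing S] [Algebra ZBeta S] (c : ℕ+ → S) (p : ℕ+) (x : S) :
    S :=
  preFactor X S x * ∏ j ∈ Finset.range (numFactors X p), oplus x (c j.succPNat)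

theorem map_entry {S T : Type*} [CommRing S] [Algebra ZBeta S] [CommRing T] [Algebra ZBeta T]
    (X : ClType) (φ : S →ₐ[ZBeta] T) (c : ℕ+ → S) (p : ℕ+) (x : S) :
    φ (entry X c p x) = entry X (fun j => φ (c j)) p (φ x) := by
  rw [entry, map_mul, map_preFactor, map_prod]
  simp only [map_oplus]
  rfl

/-- The entries of the sum that defines `GX_λ`. -/
def entries (X : ClType) {S : Type*} [CommRing S] [Algebra ZBeta S] (c : ℕ+ → S) (la : SP) :
    List (S → S) :=
  (la.sort (· ≥ ·)).map fun p => entry X c p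

/-- The entries as polynomials. -/
def entryPolys (X : ClType) {S : Type*} [CommRing S] [Algebra ZBeta S] (c : ℕ+ → S) (la : SP) :
    List (Polynomial S) :=
  (la.sort (· ≥ ·)).map fun p => entry X (fun j => Polynomial.C (c j)) p Polynomial.X

theorem evalList_entryPolys {Q : Type} {E : Type*} [CommRing Q] [Algebra ZBeta Q]
    [CommRing E] [Algebra ZBeta E] (φ : Q →ₐ[ZBeta] E) (X : ClType) (c : ℕ+ → Q) (la : SP) :
    evalList φ (entryPolys X c la) = entries X (fun j => φ (c j)) la := by
  rw [evalList, entryPolys, entries, List.map_map]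
  refine List.map_congr_left fun p _ => ?_
  funext a
  let ψ : Polynomial Q →ₐ[ZBeta] E :=
    { Polynomial.eval₂RingHom φ.toRingHom a with
      commutes' := fun r => by
        change Polynomial.eval₂ φ.toRingHom a (algebraMap ZBeta (Polynomial Q) r) = _
        rw [IsScalarTower.algebraMap_apply ZBeta Q (Polynomial Q), Polynomial.algebraMap_eq,
          Polynomial.eval₂_C]
        exact φ.commutes r }
  have h := map_entry X ψ (fun j => Polynomial.C (c j)) p Polynomial.X
  have h1 : ψ Polynomial.X = a := Polynomial.eval₂_X _ _
  have h2 : ∀ j, ψ (Polynomial.C (c j)) = φ (c j) := fun j => Polynomial.eval₂_C _ _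
  simp only [h1, h2] at h
  exact h

variable {X : ClType}

/-- `F` is given by the sums `hsum` of the entries `M` and `L`. -/
def Represents (F : GGammaR X) (M : List (Polynomial ZBeta)) (L : List (Polynomial CoefRing)) :
    Prop :=
  ∀ (n : ℕ), Even n → ∀ (E : Type) [Field E] [Algebra ZBeta E] [Algebra CoefRing E]
    [IsScalarTower ZBeta CoefRing E] (y : Fin n → E), Function.Injective y →
    evalAt X n y F =
      hsum (evalZ M ++ evalList (IsScalarTower.toAlgHom ZBeta CoefRing E) L) (pts y)

/-- Multilinearity reduces the entries over `𝓡` to monomials with scalar r. The scalar goes to the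
left tensor factor, and the entry, now over `ℤ[β]`, joins the list M, which has an element of `GΓ`
at the end of the recursion. -/
theorem exists_represents (M : List (Polynomial ZBeta))
    (hM : ∀ G ∈ M, preFactor X _ Polynomial.X ∣ G)
    (L : List (Polynomial CoefRing)) (hL : ∀ G ∈ L, preFactor X _ Polynomial.X ∣ G) :
    ∃ F : GGammaR X, Represents F M L := by
  induction L generalizing M with
  | nil =>
    refine ⟨1 ⊗ₜ ⟨hsumSeq M, hsumSeq_mem_GGamma hM⟩, fun n hn E _ _ _ _ y hy => ?_⟩
    rw [evalAt_tmul, map_one, one_mul, aeval_hsumSeq_of_even hn hy]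
    simp [evalList]
  | cons G L ih =>
    obtain ⟨G, rfl⟩ := hL G (by simp)
    have hL' : ∀ G ∈ L, preFactor X _ Polynomial.X ∣ G := fun G hG => hL G (by simp [hG])
    clear hL
    induction G using Polynomial.induction_on' with
    | add p q hp hq =>
      obtain ⟨F₁, h₁⟩ := hp
      obtain ⟨F₂, h₂⟩ := hq
      refine ⟨F₁ + F₂, fun n hn E _ _ _ _ y hy => ?_⟩
      rw [map_add, h₁ n hn E y hy, h₂ n hn E y hy]
      simp only [evalList, List.map_cons]
      let φ := (IsScalarTower.toAlgHom ZBeta CoefRing E).toRingHom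
      have := hsum_linear (evalZ M) (L.map fun G a => G.eval₂ φ a) (S := pts y) (c := 1) (d := 1)
        (f := fun a => (preFactor X _ Polynomial.X * (p + q)).eval₂ φ a)
        (g := fun a => (preFactor X _ Polynomial.X * p).eval₂ φ a)
        (k := fun a => (preFactor X _ Polynomial.X * q).eval₂ φ a)
        (fun a _ => by rw [mul_add, Polynomial.eval₂_add, one_mul, one_mul])
      rw [one_mul, one_mul] at this
      exact this.symm
    | monomial k r =>
      obtain ⟨F, h⟩ := ih (M ++ [preFactor X _ Polynomial.X * Polynomial.X ^ k])
        (by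
          intro G hG
          rcases List.mem_append.1 hG with h | h
          · exact hM G h
          · rw [List.mem_singleton.1 h]; exact Dvd.intro _ rfl) hL'
      refine ⟨r • F, fun n hn E _ _ _ _ y hy => ?_⟩
      rw [map_smul, h n hn E y hy, Algebra.smul_def]
      have e : ∀ a : E, Polynomial.eval₂ (IsScalarTower.toAlgHom ZBeta CoefRing E).toRingHom a
          (preFactor X _ Polynomial.X * Polynomial.monomial k r) = algebraMap CoefRing E r *
            Polynomial.aeval a (preFactor X _ Polynomial.X * Polynomial.X ^ k : Polynomial ZBeta) +
            0 * 0 := by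
        intro a
        have e1 : Polynomial.eval₂ (IsScalarTower.toAlgHom ZBeta CoefRing E).toRingHom a
            (preFactor X (Polynomial CoefRing) Polynomial.X) = preFactor X E a := by
          let ψ : Polynomial CoefRing →ₐ[ZBeta] E :=
            ((Polynomial.aeval a : Polynomial CoefRing →ₐ[CoefRing] E).restrictScalars ZBeta)
          have h := map_preFactor X ψ Polynomial.X
          have h1 : ψ Polynomial.X = a := Polynomial.aeval_X a
          rw [h1] at h
          exact h
        rw [Polynomial.eval₂_mul, e1, Polynomial.eval₂_monomial, map_mul,
          map_preFactor X (Polynomial.aeval a : Polynomial ZBeta →ₐ[ZBeta] E), Polynomial.aeval_X,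
          map_pow, Polynomial.aeval_X]
        change _ * (algebraMap CoefRing E r * _) = _
        ring
      simp only [evalList, List.map_cons, evalZ, List.map_append, List.map_nil, List.append_assoc,
        List.singleton_append]
      have := hsum_linear (M.map fun G (a : E) => Polynomial.aeval a G)
        (L.map fun G (a : E) =>
          G.eval₂ (IsScalarTower.toAlgHom ZBeta CoefRing E).toRingHom a) (S := pts y)
        (k := fun _ => 0) (fun a _ => e a)
      rw [zero_mul, add_zero] at this
      exact this.symm

theorem exists_gx (X : ClType) (la : SP) :
    ∃ F : GGammaR X, Represents F [] (entryPolys X (params X) la) := by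
  refine exists_represents [] (by simp) _ ?_
  intro G hG
  obtain ⟨p, -, rfl⟩ := List.mem_map.1 hG
  exact Dvd.intro _ rfl

/-- The element `GX_λ(x|b)`. -/
def gx (X : ClType) (la : SP) : GGammaR X := (exists_gx X la).choose

/-! ### Values of `gx` at distinct points of a field -/

section Field

variable {E : Type} [Field E] [Algebra ZBeta E] [Algebra CoefRing E] [IsScalarTower ZBeta CoefRing E]

/-- The parameters in a field over `𝓡`. -/
def paramsIn (X : ClType) (E : Type) [Field E] [Algebra CoefRing E] (j : ℕ+) : E :=
  algebraMap CoefRing E (params X j)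

theorem evalAt_gx_of_even {la : SP} {n : ℕ} (hn : Even n) {y : Fin n → E}
    (hy : Function.Injective y) :
    evalAt X n y (gx X la) = hsum (entries X (paramsIn X E) la) (pts y) := by
  refine ((exists_gx X la).choose_spec n hn E y hy).trans ?_
  rw [evalList_entryPolys]
  rfl

omit [IsScalarTower ZBeta CoefRing E] in
theorem entry_zero (hX : X ≠ .D) (p : ℕ+) : entry X (paramsIn X E) p 0 = 0 := by
  cases X
  · rw [entry, Finset.prod_eq_zero (i := 0), mul_zero]
    · simp only [numFactors, Finset.mem_range]; exact p.pos
    · have : paramsIn .B E (Nat.succPNat 0) = 0 := by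
        rw [paramsIn, params]
        exact map_zero _
      rw [this, oplus_zero]
  · rw [entry]
    simp only [preFactor]
    rw [oplus_zero, zero_mul]
  · exact absurd rfl hX

omit [IsScalarTower ZBeta CoefRing E] in
theorem hsum_entries_insert_zero (hX : X ≠ .D) {la : SP} {S : Finset E} (hS : 0 ∉ S) :
    hsum (entries X (paramsIn X E) la) (insert 0 S) = hsum (entries X (paramsIn X E) la) S := by
  refine hsum_insert_self_inverse (oplus_zero 0) _ ?_ hS
  intro g hg
  obtain ⟨p, -, rfl⟩ := List.mem_map.1 hg
  exact entry_zero hX p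

omit [Algebra ZBeta E] [Algebra CoefRing E] [IsScalarTower ZBeta CoefRing E] in
theorem zero_notMem_pts {n : ℕ} {y : Fin n → E} (h0 : ∀ k, y k ≠ 0) : (0 : E) ∉ pts y := by
  rw [mem_pts]
  rintro ⟨k, hk⟩
  exact h0 k hk

/-- An odd number of points is completed by a zero. This agrees with the definition of `GD` for odd
n; in types B and C the entries vanish at 0, so the zero can be dropped again. -/
theorem evalAt_gx_of_odd {la : SP} {n : ℕ} (hn : ¬ Even n) {y : Fin n → E}
    (hy : Function.Injective y) (h0 : ∀ k, y k ≠ 0) :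
    evalAt X n y (gx X la) = hsum (entries X (paramsIn X E) la) (insert 0 (pts y)) := by
  have h := evalAt_stable (X := X) n.le_succ (extZero y) (fun k hk => extZero_of_le y hk) (gx X la)
  simp only [extZero_coe] at h
  rw [← h, evalAt_gx_of_even (Nat.even_add_one.2 hn) (extZero_injective hy h0), pts_extZero]

theorem evalAt_gx {la : SP} {n : ℕ} (hX : X ≠ .D ∨ Even n) {y : Fin n → E}
    (hy : Function.Injective y) (h0 : ∀ k, y k ≠ 0) :
    evalAt X n y (gx X la) = hsum (entries X (paramsIn X E) la) (pts y) := by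
  by_cases hn : Even n
  · exact evalAt_gx_of_even hn hy
  · rw [evalAt_gx_of_odd hn hy h0,
      hsum_entries_insert_zero (hX.resolve_right hn) (zero_notMem_pts h0)]

end Field

theorem GPQ_eq (X : ClType) (la : SP) {n : ℕ} (hn : la.card ≤ n) :
    GPQ X la n = hsum (entries X (fun j => algebraMap (PolyRing n) (FractionRing (PolyRing n))
      (MvPolynomial.C (MvPolynomial.X j))) la)
      (pts fun i => algebraMap (PolyRing n) _ (MvPolynomial.X i)) := by
  have hinj : Function.Injective fun i : Fin n =>
      algebraMap (PolyRing n) (FractionRing (PolyRing n)) (MvPolynomial.X i) :=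
    (IsFractionRing.injective (PolyRing n) (FractionRing (PolyRing n))).comp
      MvPolynomial.X_injective
  have hP : ∀ (p : ℕ+) (c : ℕ+ → FractionRing (PolyRing n)) x, entry .B c p x = factPow c x p :=
    fun p c x => one_mul _
  have hP' : ∀ (p : ℕ+) (c : ℕ+ → FractionRing (PolyRing n)) x, entry .D c p x = factPow c x p :=
    fun p c x => one_mul _
  cases X
  · simp only [GPQ]
    rw [symSum_eq_hsum _ _ hn _ hinj]
    simp only [entries, ← hP]
  · simp only [GPQ]
    rw [symSum_eq_hsum _ _ hn _ hinj]
    rfl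
  · simp only [GPQ]
    rw [symSum_eq_hsum _ _ hn _ hinj]
    simp only [entries, ← hP']

theorem exists_generic_over (n : ℕ) : ∃ (K : Type) (_ : Field K) (_ : Algebra ZBeta K)
    (_ : Algebra CoefRing K) (_ : IsScalarTower ZBeta CoefRing K)
    (ι : MvPolynomial (Fin n) CoefRing →ₐ[CoefRing] K), Function.Injective ι :=
  ⟨FractionRing (MvPolynomial (Fin n) CoefRing), inferInstance, inferInstance, inferInstance,
    inferInstance, IsScalarTower.toAlgHom CoefRing _ _, IsFractionRing.injective _ _⟩

theorem le_numVars (X : ClType) (n : ℕ) : n ≤ numVars X n := by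
  cases X
  · exact le_rfl
  · exact le_rfl
  · simp only [numVars]; split_ifs <;> omega

theorem pts_numVars {K : Type*} [Zero K] (X : ClType) {n : ℕ} (x : Fin n → K) :
    pts (fun k : Fin (numVars X n) => extZero x k) =
      if X = .D ∧ ¬ Even n then insert 0 (pts x) else pts x := by
  have h : pts (fun k : Fin n => extZero x k) = pts x := by simp only [extZero_coe]
  cases X
  · exact h.trans (if_neg (by simp)).symm
  · exact h.trans (if_neg (by simp)).symm
  · by_cases hn : Even n
    · have h1 : numVars .D n = n := by simp [numVars, hn]
      rw [if_neg (by simp [hn]), h1, h]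
    · have h1 : numVars .D n = n + 1 := by simp [numVars, Nat.not_even_iff_odd.1 hn]
      rw [if_pos (by simp [hn]), h1, pts_extZero]

theorem extZero_numVars_injective {K : Type*} [Zero K] (X : ClType) {n : ℕ} {x : Fin n → K}
    (hx : Function.Injective x) (h0 : ∀ k, x k ≠ 0) :
    Function.Injective fun k : Fin (numVars X n) => extZero x k := by
  have h : Function.Injective fun k : Fin n => extZero x k := by simpa only [extZero_coe] using hx
  cases X
  · exact h
  · exact h
  · by_cases hn : Even n
    · have h1 : numVars .D n = n := by simp [numVars, hn]
      rw [h1]; exact h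
    · have h1 : numVars .D n = n + 1 := by simp [numVars, Nat.not_even_iff_odd.1 hn]
      rw [h1]; exact extZero_injective hx h0

theorem isGX_gx (X : ClType) (la : SP) : IsGX X la (gx X la) := by
  intro n hn
  have hN := hn.trans (le_numVars X n)
  obtain ⟨P, hP⟩ := exists_polynomial_hsum (numVars X n)
    (entryPolys X (fun j => (MvPolynomial.X j : MvPolynomial ℕ+ ZBeta)) la)
  refine ⟨P, ?_, ?_⟩
  · let φ : MvPolynomial ℕ+ ZBeta →ₐ[ZBeta] FractionRing (PolyRing (numVars X n)) :=
      (IsScalarTower.toAlgHom ZBeta (PolyRing (numVars X n)) _).comp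
        (IsScalarTower.toAlgHom ZBeta (MvPolynomial ℕ+ ZBeta) (PolyRing (numVars X n)))
    let y : Fin (numVars X n) → FractionRing (PolyRing (numVars X n)) :=
      fun i => algebraMap (PolyRing (numVars X n)) _ (MvPolynomial.X i)
    have h := hP _ φ y ((IsFractionRing.injective (PolyRing (numVars X n)) _).comp
      MvPolynomial.X_injective)
    have h1 : algebraMap (PolyRing (numVars X n)) (FractionRing (PolyRing (numVars X n))) =
        (MvPolynomial.aevalTower φ y : PolyRing (numVars X n) →ₐ[ZBeta] _).toRingHom := by
      refine MvPolynomial.ringHom_ext (fun a => ?_) fun i => ?_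
      · exact (MvPolynomial.aevalTower_C φ y a).symm
      · exact (MvPolynomial.aevalTower_X φ y i).symm
    rw [GPQ_eq X la hN]
    refine (RingHom.congr_fun h1 P).trans (h.trans ?_)
    rw [evalList_entryPolys]
    rfl
  -- Both sides are evaluated at the generic point over `𝓡`, where the additional variable of type
  -- D, present for odd n, is the additional point 0.
  · obtain ⟨K, _, _, _, _, ι, hι⟩ := exists_generic_over n
    apply hι
    set x : Fin n → K := fun k => ι (MvPolynomial.X k) with hx
    have hX : Function.Injective x := hι.comp MvPolynomial.X_injective
    have hX0 : ∀ k, x k ≠ 0 := fun k h0 =>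
      MvPolynomial.X_ne_zero k (hι (h0.trans (map_zero ι).symm))
    let φ : MvPolynomial ℕ+ ZBeta →ₐ[ZBeta] K :=
      (IsScalarTower.toAlgHom ZBeta CoefRing K).comp (MvPolynomial.aeval (params X))
    let y : Fin (numVars X n) → K := fun k => extZero x k
    have h1 : ι.toRingHom.comp (specialize X n) =
        (MvPolynomial.aevalTower φ y : PolyRing (numVars X n) →ₐ[ZBeta] K).toRingHom := by
      refine MvPolynomial.ringHom_ext (fun a => ?_) fun i => ?_
      · refine Eq.trans ?_ (MvPolynomial.aevalTower_C φ y a).symm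
        change ι (specialize X n (MvPolynomial.C a)) = _
        rw [specialize, MvPolynomial.eval₂Hom_C]
        exact ι.commutes _
      · refine Eq.trans ?_ (MvPolynomial.aevalTower_X φ y i).symm
        change ι (specialize X n (MvPolynomial.X i)) = _
        rw [specialize, MvPolynomial.eval₂Hom_X']
        simp only [y, extZero]
        split_ifs
        · rfl
        · exact map_zero ι
    have h2 : ι (specialize X n P) = hsum (entries X (paramsIn X K) la) (pts y) := by
      refine (RingHom.congr_fun h1 P).trans ((hP K φ y (extZero_numVars_injective X hX hX0)).trans ?_)
      rw [evalList_entryPolys]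
      congr 2
      funext j
      simp only [φ, AlgHom.comp_apply, MvPolynomial.aeval_X]
      rfl
    rw [h2, level, map_evalAt, pts_numVars]
    split_ifs with h
    · exact evalAt_gx_of_odd h.2 hX hX0
    · exact evalAt_gx (by tauto) hX hX0

/-! ### The image of the localization map -/

variable {X : ClType}

theorem dvd_of_oplus_eq_zero {S : Type*} [CommRing S] [Algebra ZBeta S] {x y : S}
    (h : oplus x y = 0) : x ∣ y :=
  ⟨-1 - beta S * y, by unfold oplus at h; linear_combination h⟩

theorem oplus_bar_bar (z w : SNum) :
    oplus (oplus (b z) (b w)) (oplus (b (bar z)) (b (bar w))) = 0 := by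
  rw [oplus_assoc, ← oplus_assoc (b w), oplus_comm (b w), oplus_assoc (b (bar z)), b_oplus_b_bar,
    oplus_zero, b_oplus_b_bar]

theorem oplus_bar_dvd {z w : SNum} {x : CoefRing} (h : oplus (b (bar z)) (b (bar w)) ∣ x) :
    oplus (b z) (b w) ∣ x :=
  (dvd_of_oplus_eq_zero (oplus_bar_bar z w)).trans h

theorem placeSeq_natPred (E : SP) (i : ℕ+) :
    placeSeq E i.natPred = if i ∈ E then b (bar (pos i)) else 0 := by
  rw [placeSeq, PNat.succPNat_natPred]

theorem natPred_lt {i : ℕ+} {n : ℕ} (h : (i : ℕ) ≤ n) : i.natPred < n := by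
  have := i.pos
  have h1 := i.natPred_add_one
  omega

theorem placeSeq_congr {E E' : SP} {k : ℕ} (h : k.succPNat ∈ E' ↔ k.succPNat ∈ E) :
    placeSeq E' k = placeSeq E k := by
  simp only [placeSeq, h]

theorem succPNat_ne {i : ℕ+} {n : ℕ} (hi : (i : ℕ) ≤ n) {k : Fin n}
    (hk : k ≠ ⟨i.natPred, natPred_lt hi⟩) : (k : ℕ).succPNat ≠ i := by
  rintro rfl
  exact hk (Fin.ext (Nat.natPred_succPNat _).symm)

/-! ### Change of the values on `GΓ` when one or two places change -/

section Moves

variable {n : ℕ} {f : MvPolynomial (Fin n) ZBeta} {i j : ℕ+} {E E' : SP}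

/-- After the two places are exchanged, the sequences differ only by b_j̄ against b_ī, and this
difference is divisible by b_ī ⊕ b_j. -/
theorem oplus_dvd_move (hf : f.IsSymmetric) (hi : (i : ℕ) ≤ n) (hj : (j : ℕ) ≤ n) (hij : i ≠ j)
    (hoff : ∀ k, k ≠ i → k ≠ j → (k ∈ E' ↔ k ∈ E)) (h1 : i ∈ E) (h2 : j ∉ E) (h3 : i ∉ E')
    (h4 : j ∈ E') : oplus (b (bar (pos i))) (b (pos j)) ∣
      MvPolynomial.aeval (fun k : Fin n => placeSeq E' k) f -
        MvPolynomial.aeval (fun k : Fin n => placeSeq E k) f := by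
  set i' : Fin n := ⟨i.natPred, natPred_lt hi⟩ with hi'
  set j' : Fin n := ⟨j.natPred, natPred_lt hj⟩ with hj'
  have hij' : i' ≠ j' := fun h => hij (by
    rw [← PNat.succPNat_natPred i, ← PNat.succPNat_natPred j]
    exact congrArg Nat.succPNat (congrArg Fin.val h))
  rw [← aeval_comp_equiv hf _ (Equiv.swap i' j')]
  refine dvd_aeval_sub_aeval (fun k => ?_) f
  rw [Function.comp_apply]
  by_cases k1 : k = i'
  · rw [k1, Equiv.swap_apply_left, hi', hj', placeSeq_natPred, placeSeq_natPred, if_pos h1,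
      if_pos h4]
    have e1 := b_oplus_b_bar (pos j)
    refine ⟨-(1 + beta _ * b (bar (pos j))), ?_⟩
    unfold oplus at *
    linear_combination (1 + beta CoefRing * b (bar (pos i))) * e1
  · by_cases k2 : k = j'
    · rw [k2, Equiv.swap_apply_right, hi', hj', placeSeq_natPred, placeSeq_natPred, if_neg h2,
        if_neg h3, sub_zero]
      exact dvd_zero _
    · rw [Equiv.swap_apply_of_ne_of_ne k1 k2,
        placeSeq_congr (hoff _ (succPNat_ne hi k1) (succPNat_ne hj k2)), sub_self]
      exact dvd_zero _

/-- Here two entries become 0 at the same time, which is the situation of Q-cancellation. -/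
theorem oplus_dvd_remove (hf : QCancel f) (hi : (i : ℕ) ≤ n) (hj : (j : ℕ) ≤ n) (hij : i ≠ j)
    (hoff : ∀ k, k ≠ i → k ≠ j → (k ∈ E' ↔ k ∈ E)) (h1 : i ∈ E) (h2 : j ∈ E) (h3 : i ∉ E')
    (h4 : j ∉ E') : oplus (b (bar (pos i))) (b (bar (pos j))) ∣
      MvPolynomial.aeval (fun k : Fin n => placeSeq E k) f -
        MvPolynomial.aeval (fun k : Fin n => placeSeq E' k) f := by
  set i' : Fin n := ⟨i.natPred, natPred_lt hi⟩ with hi'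
  set j' : Fin n := ⟨j.natPred, natPred_lt hj⟩ with hj'
  have hij' : i' ≠ j' := fun h => hij (by
    rw [← PNat.succPNat_natPred i, ← PNat.succPNat_natPred j]
    exact congrArg Nat.succPNat (congrArg Fin.val h))
  have h := oplus_dvd_aeval_sub hf hij' (y := fun k : Fin n => placeSeq E k)
    (y' := fun k : Fin n => placeSeq E' k)
    (by simp only [hi']; rw [placeSeq_natPred, if_neg h3])
    (by simp only [hj']; rw [placeSeq_natPred, if_neg h4])
    (fun k k1 k2 => (placeSeq_congr (hoff _ (succPNat_ne hi k1) (succPNat_ne hj k2))).symm)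
  simp only [hi', hj'] at h
  rwa [placeSeq_natPred, placeSeq_natPred, if_pos h1, if_pos h2] at h

theorem eq_of_agree (hoff : ∀ k, k ≠ i → k ≠ j → (k ∈ E' ↔ k ∈ E)) (h1 : i ∈ E' ↔ i ∈ E)
    (h2 : j ∈ E' ↔ j ∈ E) : E' = E := by
  ext k
  by_cases ki : k = i
  · rw [ki, h1]
  · by_cases kj : k = j
    · rw [kj, h2]
    · exact hoff k ki kj

theorem oplus_dvd_swap (hf : f ∈ GGammaFin n) (hi : (i : ℕ) ≤ n) (hj : (j : ℕ) ≤ n) (hij : i ≠ j)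
    (hoff : ∀ k, k ≠ i → k ≠ j → (k ∈ E' ↔ k ∈ E)) (h1 : i ∈ E' ↔ j ∈ E) (h2 : j ∈ E' ↔ i ∈ E) :
    oplus (b (bar (pos i))) (b (pos j)) ∣
      MvPolynomial.aeval (fun k : Fin n => placeSeq E' k) f -
        MvPolynomial.aeval (fun k : Fin n => placeSeq E k) f := by
  by_cases k1 : i ∈ E <;> by_cases k2 : j ∈ E
  · rw [eq_of_agree hoff (by tauto) (by tauto), sub_self]
    exact dvd_zero _
  · exact oplus_dvd_move hf.1 hi hj hij hoff k1 k2 (by tauto) (by tauto)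
  · rw [← bar_bar (pos j), oplus_comm]
    refine oplus_bar_dvd ?_
    rw [bar_bar, bar_bar]
    exact oplus_dvd_move hf.1 hj hi hij.symm (fun k a c => hoff k c a) k2 k1 (by tauto) (by tauto)
  · rw [eq_of_agree hoff (by tauto) (by tauto), sub_self]
    exact dvd_zero _

theorem oplus_dvd_toggle (hf : f ∈ GGammaFin n) (hi : (i : ℕ) ≤ n) (hj : (j : ℕ) ≤ n) (hij : i ≠ j)
    (hoff : ∀ k, k ≠ i → k ≠ j → (k ∈ E' ↔ k ∈ E)) (h1 : i ∈ E' ↔ j ∉ E) (h2 : j ∈ E' ↔ i ∉ E) :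
    oplus (b (bar (pos i))) (b (bar (pos j))) ∣
      MvPolynomial.aeval (fun k : Fin n => placeSeq E' k) f -
        MvPolynomial.aeval (fun k : Fin n => placeSeq E k) f := by
  by_cases k1 : i ∈ E <;> by_cases k2 : j ∈ E
  · rw [dvd_sub_comm]
    exact oplus_dvd_remove hf.2 hi hj hij hoff k1 k2 (by tauto) (by tauto)
  · rw [eq_of_agree hoff (by tauto) (by tauto), sub_self]
    exact dvd_zero _
  · rw [eq_of_agree hoff (by tauto) (by tauto), sub_self]
    exact dvd_zero _
  · exact oplus_dvd_remove hf.2 hi hj hij (fun k a c => (hoff k a c).symm) (by tauto) (by tauto)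
      k1 k2

theorem b_dvd_toggle (hi : (i : ℕ) ≤ n) (hoff : ∀ k, k ≠ i → (k ∈ E' ↔ k ∈ E)) :
    b (pos i) ∣ MvPolynomial.aeval (fun k : Fin n => placeSeq E' k) f -
      MvPolynomial.aeval (fun k : Fin n => placeSeq E k) f := by
  refine dvd_aeval_sub_aeval (fun k => ?_) f
  by_cases k1 : k = ⟨i.natPred, natPred_lt hi⟩
  · have h := dvd_of_oplus_eq_zero (b_oplus_b_bar (pos i))
    rw [k1, placeSeq_natPred, placeSeq_natPred]
    split_ifs <;> simp [h]
  · rw [placeSeq_congr (hoff _ (succPNat_ne hi k1)), sub_self]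
    exact dvd_zero _

theorem oplus_self_dvd_remove (hf : f ∈ GGammaPlusFin n) (hi : (i : ℕ) ≤ n)
    (hoff : ∀ k, k ≠ i → (k ∈ E' ↔ k ∈ E)) (h1 : i ∈ E) (h2 : i ∉ E') :
    oplus (b (pos i)) (b (pos i)) ∣ MvPolynomial.aeval (fun k : Fin n => placeSeq E' k) f -
      MvPolynomial.aeval (fun k : Fin n => placeSeq E k) f := by
  rw [dvd_sub_comm]
  refine oplus_bar_dvd ?_
  set i' : Fin n := ⟨i.natPred, natPred_lt hi⟩ with hi'
  have h := map_dvd (MvPolynomial.aeval (R := ZBeta) (fun k : Fin n => placeSeq E k)) (hf.2 i')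
  rw [map_oplus, MvPolynomial.aeval_X, map_sub, setZero, MvPolynomial.comp_aeval_apply] at h
  have e1 : (fun k => (MvPolynomial.aeval (R := ZBeta) (fun k : Fin n => placeSeq E k))
      (if k = i' then 0 else MvPolynomial.X k)) = fun k : Fin n => placeSeq E' k := by
    funext k
    by_cases k1 : k = i'
    · rw [if_pos k1, map_zero, k1, hi', placeSeq_natPred, if_neg h2]
    · rw [if_neg k1, MvPolynomial.aeval_X, placeSeq_congr (hoff _ (succPNat_ne hi k1))]
  rw [e1] at h
  simp only [hi'] at h
  rwa [placeSeq_natPred, if_pos h1] at h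

theorem oplus_self_dvd_toggle (hf : f ∈ GGammaPlusFin n) (hi : (i : ℕ) ≤ n)
    (hoff : ∀ k, k ≠ i → (k ∈ E' ↔ k ∈ E)) (h1 : i ∈ E' ↔ i ∉ E) :
    oplus (b (pos i)) (b (pos i)) ∣ MvPolynomial.aeval (fun k : Fin n => placeSeq E' k) f -
      MvPolynomial.aeval (fun k : Fin n => placeSeq E k) f := by
  by_cases k1 : i ∈ E
  · exact oplus_self_dvd_remove hf hi hoff k1 (by tauto)
  · rw [dvd_sub_comm]
    exact oplus_self_dvd_remove hf hi (fun k hk => (hoff k hk).symm) (by tauto) k1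

end Moves

theorem natAbs_pos (i : ℕ+) : (pos i).1.natAbs = i := by simp [pos]

theorem natAbs_bar (z : SNum) : (bar z).1.natAbs = z.1.natAbs := by simp [bar]

/-- If p and q have the same sign, s exchanges two places; if they have opposite signs, s toggles
two places when both are filled or both are empty. The resulting divisors agree with e(t_q - t_p) up
to ⊖, that is, up to a unit. -/
theorem oplus_dvd_reflection {s : signedPerm} {p q : SNum} (hpq : p ≠ q) (hpq' : p ≠ bar q)
    (h1 : s.1.symm p = q) (h2 : s.1.symm q = p)
    (h3 : ∀ z, z ≠ p → z ≠ q → z ≠ bar p → z ≠ bar q → s.1.symm z = z) (E : SP) {n : ℕ}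
    (hp : p.1.natAbs ≤ n) (hq : q.1.natAbs ≤ n) {f : MvPolynomial (Fin n) ZBeta}
    (hf : f ∈ GGammaFin n) : oplus (b q) (b (bar p)) ∣
      MvPolynomial.aeval (fun k : Fin n => placeSeq (actBC s E) k) f -
        MvPolynomial.aeval (fun k : Fin n => placeSeq E k) f := by
  have hbp : ∀ k l : ℕ+, bar (pos k) ≠ pos l := bar_pos_ne_pos
  have hpb : ∀ k l : ℕ+, pos k ≠ bar (pos l) := fun k l => (bar_pos_ne_pos l k).symm
  have hbb : ∀ k l : ℕ+, bar (pos k) = bar (pos l) ↔ k = l :=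
    fun k l => (bar_injective.comp pos_injective).eq_iff
  rcases pos_or_bar_pos p with ⟨i, rfl⟩ | ⟨i, rfl⟩ <;>
    rcases pos_or_bar_pos q with ⟨j, rfl⟩ | ⟨j, rfl⟩
  · rw [natAbs_pos] at hp hq
    rw [oplus_comm]
    refine oplus_dvd_swap hf hp hq (fun h => hpq (by rw [h])) (fun k ki kj => ?_) ?_ ?_
    · rw [mem_actBC, h3 _ (hbp _ _) (hbp _ _) (by rwa [Ne, hbb]) (by rwa [Ne, hbb]),
        bar_pos_mem_halfSet]
    · rw [mem_actBC, symm_bar, h1, bar_pos_mem_halfSet]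
    · rw [mem_actBC, symm_bar, h2, bar_pos_mem_halfSet]
  · rw [natAbs_pos] at hp
    rw [natAbs_bar, natAbs_pos] at hq
    rw [oplus_comm]
    refine oplus_dvd_toggle hf hp hq (fun h => hpq' (by rw [h, bar_bar])) (fun k ki kj => ?_) ?_ ?_
    · rw [mem_actBC, h3 _ (hbp _ _) (by rwa [Ne, hbb]) (by rwa [Ne, hbb])
        (by rw [bar_bar]; exact hbp _ _), bar_pos_mem_halfSet]
    · rw [mem_actBC, symm_bar, h1, bar_bar, pos_mem_halfSet]
    · rw [mem_actBC, h2, pos_mem_halfSet]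
  · rw [natAbs_pos] at hq
    rw [natAbs_bar, natAbs_pos] at hp
    rw [bar_bar, oplus_comm]
    refine oplus_bar_dvd (oplus_dvd_toggle hf hp hq (fun h => hpq' (by rw [h]))
      (fun k ki kj => ?_) ?_ ?_)
    · rw [mem_actBC, h3 _ (by rwa [Ne, hbb]) (hbp _ _) (by rw [bar_bar]; exact hbp _ _)
        (by rwa [Ne, hbb]), bar_pos_mem_halfSet]
    · rw [mem_actBC, h1, pos_mem_halfSet]
    · rw [mem_actBC, symm_bar, h2, bar_bar, pos_mem_halfSet]
  · rw [natAbs_bar, natAbs_pos] at hp hq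
    rw [bar_bar, oplus_comm]
    refine oplus_bar_dvd ?_
    rw [bar_bar]
    refine oplus_dvd_swap hf hp hq (fun h => hpq (by rw [h])) (fun k ki kj => ?_) ?_ ?_
    · rw [mem_actBC, h3 _ (by rwa [Ne, hbb]) (by rwa [Ne, hbb])
        (by rw [bar_bar]; exact hbp _ _) (by rw [bar_bar]; exact hbp _ _), bar_pos_mem_halfSet]
    · rw [mem_actBC, h1, bar_pos_mem_halfSet]
    · rw [mem_actBC, h2, bar_pos_mem_halfSet]

/-- The sets `E` and `w E` differ at most at `|p|`, if `w` is the sign change at `p`. -/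
theorem mem_actBC_signChange {s : signedPerm} {p : SNum} (h1 : s.1.symm p = bar p)
    (h3 : ∀ z, z ≠ p → z ≠ bar p → s.1.symm z = z) (E : SP) :
    ∃ i : ℕ+, (p = pos i ∨ p = bar (pos i)) ∧ (∀ k, k ≠ i → (k ∈ actBC s E ↔ k ∈ E)) ∧
      (i ∈ actBC s E ↔ i ∉ E) := by
  have hbb : ∀ k l : ℕ+, bar (pos k) = bar (pos l) ↔ k = l :=
    fun k l => (bar_injective.comp pos_injective).eq_iff
  rcases pos_or_bar_pos p with ⟨i, rfl⟩ | ⟨i, rfl⟩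
  · refine ⟨i, Or.inl rfl, fun k hk => ?_, ?_⟩
    · rw [mem_actBC, h3 _ (bar_pos_ne_pos _ _) (by rwa [Ne, hbb]), bar_pos_mem_halfSet]
    · rw [mem_actBC, symm_bar, h1, bar_bar, pos_mem_halfSet]
  · refine ⟨i, Or.inr rfl, fun k hk => ?_, ?_⟩
    · rw [mem_actBC, h3 _ (by rwa [Ne, hbb]) (by rw [bar_bar]; exact bar_pos_ne_pos _ _),
        bar_pos_mem_halfSet]
    · rw [mem_actBC, h1, bar_bar, pos_mem_halfSet]

theorem evalAt_sub_dvd {n : ℕ} {x y : Fin n → CoefRing} {d : CoefRing}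
    (h : ∀ f ∈ GGamma X, d ∣ MvPolynomial.aeval x (f n) - MvPolynomial.aeval y (f n))
    (F : GGammaR X) : d ∣ evalAt X n x F - evalAt X n y F := by
  induction F using TensorProduct.induction_on with
  | zero => simp
  | tmul r f =>
    rw [evalAt_tmul, evalAt_tmul, ← mul_sub]
    exact (h f.1 f.2).mul_left _
  | add F G hF hG =>
    rw [map_add, map_add, add_sub_add_comm]
    exact dvd_add hF hG

theorem exists_bound (E : SP) : ∃ n : ℕ, ∀ i ∈ E, (i : ℕ) ≤ n :=
  ⟨E.sup fun i => (i : ℕ), fun _ hi => Finset.le_sup (f := fun i : ℕ+ => (i : ℕ)) hi⟩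

/-- A simple reflection that exchanges two elements. -/
theorem simpleRefl_swap (X : ClType) (i : ℕ) : (∃ p q : SNum, p ≠ q ∧ p ≠ bar q ∧
    simpleRoot X i = t q - t p ∧ (simpleRefl X i).1 p = q ∧ (simpleRefl X i).1 q = p ∧
    ∀ z, z ≠ p → z ≠ q → z ≠ bar p → z ≠ bar q → (simpleRefl X i).1 z = z) ∨
    (X ≠ .D ∧ i = 0) := by
  cases i with
  | succ k =>
    left
    refine ⟨pos k.succPNat, pos (k.succPNat + 1), ?_, (bar_pos_ne_pos _ _).symm, ?_, ?_, ?_, ?_⟩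
    · rw [Ne, pos_injective.eq_iff]
      exact (PNat.lt_add_right _ 1).ne
    · cases X <;> rfl
    · rw [simpleRefl_succ]
      change sFun _ _ = _
      rw [sFun, if_pos rfl]
    · rw [simpleRefl_succ]
      change sFun _ _ = _
      rw [sFun, if_neg, if_pos rfl]
      rw [pos_injective.eq_iff]
      exact (PNat.lt_add_right _ 1).ne'
    · intro z h1 h2 h3 h4
      rw [simpleRefl_succ]
      change sFun _ _ = _
      rw [sFun, if_neg h1, if_neg h2, if_neg h3, if_neg h4]
  | zero =>
    by_cases hX : X = .D
    · subst hX
      left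
      refine ⟨bar (pos 1), pos 2, bar_pos_ne_pos _ _, ?_, ?_, ?_, ?_, ?_⟩
      · exact fun h => absurd (pos_injective (bar_injective h)) (by decide)
      · rw [t_bar, sub_neg_eq_add, add_comm]; rfl
      · apply Subtype.ext
        rw [sHat_val]
        rfl
      · apply Subtype.ext
        rw [sHat_val]
        rfl
      · intro z h1 h2 h3 h4
        have h5 : ((2 : ℕ+) : ℕ) = 2 := rfl
        simp only [Ne, Subtype.ext_iff, bar, pos, PNat.one_coe, h5] at h1 h2 h3 h4
        push_cast at h1 h2 h3 h4
        apply Subtype.ext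
        rw [sHat_val]
        split_ifs <;> omega
    · exact Or.inr ⟨hX, rfl⟩

theorem s0_pos_one : s0.1 (pos 1) = bar (pos 1) := by
  apply Subtype.ext
  exact (sFunZero_val _).trans rfl

theorem s0_of_ne {z : SNum} (h1 : z ≠ pos 1) (h2 : z ≠ bar (pos 1)) : s0.1 z = z := by
  simp only [Ne, Subtype.ext_iff, bar, pos, PNat.one_coe] at h1 h2
  push_cast at h1 h2
  apply Subtype.ext
  refine (sFunZero_val _).trans ?_
  split_ifs <;> omega

theorem conj_symm_apply (X : ClType) (w : signedPerm) (i : ℕ) (z : SNum) :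
    (w * simpleRefl X i * w⁻¹).1.symm (w.1 z) = w.1 ((simpleRefl X i).1 z) := by
  rw [Equiv.symm_apply_eq]
  have h1 : (simpleRefl X i).1 ((simpleRefl X i).1 z) = z := by
    have := simpleRefl_mul_self X i
    exact DFunLike.congr_fun (congrArg Subtype.val this) z
  have h2 : ∀ y, (w⁻¹).1 (w.1 y) = y := fun y => w.1.symm_apply_apply y
  change _ = w.1 ((simpleRefl X i).1 ((w⁻¹).1 (w.1 ((simpleRefl X i).1 z))))
  rw [h2, h1]

/-- The conjugate of a simple reflection by w exchanges w(p) with w(q), or changes the sign at w(1).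
The first case uses `oplus_dvd_reflection`; the second occurs in types B and C only, and there type
C needs the condition that defines `GΓ₊`. -/
theorem localization_mem_gkmRing (F : GGammaR X) : localization X F ∈ gkmRing X := by
  intro w hw i _ mu
  have hs : w * simpleRefl X i * w⁻¹ ∈ weyl X :=
    mul_mem (mul_mem hw (simpleRefl_mem X i)) (inv_mem hw)
  obtain ⟨n₁, hn₁⟩ := exists_bound (rep X mu)
  obtain ⟨n₂, hn₂⟩ := exists_bound (rep X (act X (w * simpleRefl X i * w⁻¹) mu))
  have hloc : ∀ n, n₁ ≤ n → n₂ ≤ n →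
      localization X F (act X (w * simpleRefl X i * w⁻¹) mu) - localization X F mu =
      evalAt X n (fun k : Fin n => placeSeq (actBC (w * simpleRefl X i * w⁻¹) (rep X mu)) k) F -
        evalAt X n (fun k : Fin n => placeSeq (rep X mu) k) F := by
    intro n h1 h2
    rw [← rep_act hs]
    exact congrArg₂ _ (localizationAt_eq_placeSeq _ F fun i hi => (hn₂ i hi).trans h2)
      (localizationAt_eq_placeSeq _ F fun i hi => (hn₁ i hi).trans h1)
  have hsymm : ∀ z, (w * simpleRefl X i * w⁻¹).1.symm z =
      w.1 ((simpleRefl X i).1 (w.1.symm z)) := fun z => by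
    rw [← conj_symm_apply, Equiv.apply_symm_apply]
  have hne : ∀ {z a}, z ≠ w.1 a → w.1.symm z ≠ a := fun h h' => h (by rw [← h', Equiv.apply_symm_apply])
  rcases simpleRefl_swap X i with ⟨p, q, hpq, hpq', hroot, hp, hq, hfix⟩ | ⟨hX, rfl⟩
  · rw [hloc (n₁ ⊔ n₂ ⊔ (w.1 p).1.natAbs ⊔ (w.1 q).1.natAbs) (by simp) (by simp), hroot, map_sub,
      actLat_t, actLat_t, e_t_sub_t]
    refine evalAt_sub_dvd (fun f hf => ?_) F
    refine oplus_dvd_reflection (fun h => hpq (w.1.injective h))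
      (fun h => hpq' (w.1.injective (by rw [h, w.2.1]))) (by rw [conj_symm_apply, hp])
      (by rw [conj_symm_apply, hq]) (fun z h1 h2 h3 h4 => ?_) _ (by simp) (by simp)
      (GGamma_mem_fin hf _)
    rw [← w.2.1] at h3 h4
    rw [hsymm, hfix _ (hne h1) (hne h2) (hne h3) (hne h4), Equiv.apply_symm_apply]
  · have h1 : (w * simpleRefl X 0 * w⁻¹).1.symm (w.1 (pos 1)) = bar (w.1 (pos 1)) := by
      rw [conj_symm_apply, simpleRefl_zero hX, s0_pos_one, w.2.1]
    obtain ⟨k, hk, hoff, hon⟩ := mem_actBC_signChange h1 (fun z h1 h2 => by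
      rw [← w.2.1] at h2
      rw [hsymm, simpleRefl_zero hX, s0_of_ne (hne h1) (hne h2), Equiv.apply_symm_apply]) (rep X mu)
    rw [hloc (n₁ ⊔ n₂ ⊔ k) (by simp) (by simp)]
    refine evalAt_sub_dvd (fun f hf => ?_) F
    cases X
    · have h2 : simpleRoot .B 0 = t (pos 1) := rfl
      rw [h2, actLat_t, e_t]
      have h3 := b_dvd_toggle (f := f (n₁ ⊔ n₂ ⊔ k)) (by simp) hoff
      rcases hk with hk | hk
      · rw [hk]; exact h3
      · rw [hk]
        refine (dvd_of_oplus_eq_zero ?_).trans h3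
        rw [oplus_comm, b_oplus_b_bar]
    · have h2 : simpleRoot .C 0 = t (pos 1) + t (pos 1) := two_smul ℕ _
      rw [h2, map_add, actLat_t, e_add, e_t]
      have h3 := oplus_self_dvd_toggle (hf.1 (n₁ ⊔ n₂ ⊔ k)) (by simp) hoff hon
      rcases hk with hk | hk
      · rw [hk]; exact h3
      · rw [hk]
        refine oplus_bar_dvd ?_
        rw [bar_bar]
        exact h3
    · exact absurd rfl hX

/-! ### Injectivity of the localization map -/

open scoped TensorProduct

variable {X : ClType}

/-- The map `GΓ[b₁, b₂, …] → GΓ_𝓡`. -/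
def ofGamma (X : ClType) : MvPolynomial ℕ+ (GGamma X) →+* GGammaR X :=
  MvPolynomial.eval₂Hom
    ((Algebra.TensorProduct.includeRight : GGamma X →ₐ[ZBeta] GGammaR X) : GGamma X →+* GGammaR X)
    fun i => b (pos i) ⊗ₜ 1

theorem ofGamma_C (f : GGamma X) : ofGamma X (MvPolynomial.C f) = 1 ⊗ₜ f :=
  MvPolynomial.eval₂Hom_C _ _ _

theorem ofGamma_map (a : MvPolynomial ℕ+ ZBeta) :
    ofGamma X (MvPolynomial.map (algebraMap ZBeta (GGamma X)) a) = fromPoly a ⊗ₜ 1 := by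
  induction a using MvPolynomial.induction_on with
  | C r =>
    rw [MvPolynomial.map_C, ofGamma_C, Algebra.algebraMap_eq_smul_one, TensorProduct.tmul_smul,
      TensorProduct.smul_tmul', fromPoly, MvPolynomial.aeval_C, Algebra.algebraMap_eq_smul_one]
  | add p q hp hq => rw [map_add, map_add, hp, hq, map_add, TensorProduct.add_tmul]
  | mul_X p i hp =>
    rw [map_mul, map_mul, hp, map_mul, MvPolynomial.map_X, ofGamma, MvPolynomial.eval₂Hom_X',
      Algebra.TensorProduct.tmul_mul_tmul, one_mul]
    simp [fromPoly]

/-- Denominators are cleared as in `exists_num_den`, so that finitely many independent b_i remain.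
-/
theorem exists_ofGamma (F : GGammaR X) : ∃ (v : MvPolynomial ℕ+ ZBeta)
    (P : MvPolynomial ℕ+ (GGamma X)), IsUnit (fromPoly v) ∧ fromPoly v ⊗ₜ 1 * F = ofGamma X P := by
  induction F using TensorProduct.induction_on with
  | zero => exact ⟨1, 0, by simp, by simp⟩
  | tmul r f =>
    obtain ⟨u, a, hu, h⟩ := exists_num_den r
    refine ⟨u, MvPolynomial.map (algebraMap ZBeta (GGamma X)) a * MvPolynomial.C f, hu, ?_⟩
    rw [map_mul, ofGamma_map, ofGamma_C, Algebra.TensorProduct.tmul_mul_tmul,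
      Algebra.TensorProduct.tmul_mul_tmul, h, mul_one, one_mul]
  | add F G hF hG =>
    obtain ⟨u, P, hu, h⟩ := hF
    obtain ⟨v, Q, hv, h'⟩ := hG
    refine ⟨u * v, MvPolynomial.map (algebraMap ZBeta (GGamma X)) v * P +
      MvPolynomial.map (algebraMap ZBeta (GGamma X)) u * Q, by rw [map_mul]; exact hu.mul hv, ?_⟩
    have e1 : (fromPoly (u * v) ⊗ₜ 1 : GGammaR X) = fromPoly u ⊗ₜ 1 * fromPoly v ⊗ₜ 1 := by
      rw [Algebra.TensorProduct.tmul_mul_tmul, map_mul, one_mul]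
    rw [e1, map_add, map_mul, map_mul, ofGamma_map, ofGamma_map, ← h, ← h']
    ring

/-- Homomorphisms from `𝓡` to a field with prescribed values of one of `b_i` and `b_ī`, for
each `i`. -/
theorem exists_coefHom {K : Type*} [Field K] [Algebra ZBeta K] (S : Set ℕ+) (g : ℕ+ → K)
    (hg : ∀ j, 1 + beta K * g j ≠ 0) : ∃ χ : CoefRing →ₐ[ZBeta] K,
      (∀ j ∈ S, χ (b (bar (pos j))) = g j) ∧ ∀ j ∉ S, χ (b (pos j)) = g j := by
  let c : SNum → K := fun z =>
    let j : ℕ+ := ⟨z.1.natAbs, Int.natAbs_pos.2 z.2⟩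
    if (j ∈ S ↔ z.1 < 0) then g j else -g j / (1 + beta K * g j)
  have hjpos : ∀ j : ℕ+, (⟨(pos j).1.natAbs, Int.natAbs_pos.2 (pos j).2⟩ : ℕ+) = j := fun j =>
    PNat.eq (natAbs_pos j)
  have hjbar : ∀ j : ℕ+,
      (⟨(bar (pos j)).1.natAbs, Int.natAbs_pos.2 (bar (pos j)).2⟩ : ℕ+) = j := fun j =>
    PNat.eq ((natAbs_bar _).trans (natAbs_pos j))
  have hneg : ∀ j : ℕ+, ¬ (pos j).1 < 0 := fun j => by simp [pos]
  have hneg' : ∀ j : ℕ+, (bar (pos j)).1 < 0 := fun j => by simp [pos, bar]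
  have hc : ∀ j, c (pos j) = if j ∈ S then -g j / (1 + beta K * g j) else g j := by
    intro j
    simp only [c, hjpos, hneg, iff_false]
    by_cases h : j ∈ S <;> simp [h]
  have hc' : ∀ j, c (bar (pos j)) = if j ∈ S then g j else -g j / (1 + beta K * g j) := by
    intro j
    simp only [c, hjbar, hneg', iff_true]
  have hrel : ∀ j, oplus (c (pos j)) (c (bar (pos j))) = 0 := by
    intro j
    rw [hc, hc']
    split_ifs
    · rw [oplus_comm]; exact oplus_neg_div (hg j)
    · exact oplus_neg_div (hg j)
  refine ⟨coefLiftAlg c fun z => ?_, fun j hj => ?_, fun j hj => ?_⟩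
  · rcases pos_or_bar_pos z with ⟨j, rfl⟩ | ⟨j, rfl⟩
    · exact hrel j
    · rw [bar_bar, oplus_comm]; exact hrel j
  · rw [coefLiftAlg_b, hc', if_pos hj]
  · rw [coefLiftAlg_b, hc, if_neg hj]

theorem localizationAt_tmul {mu : SP} {n : ℕ} (hn : (rep X mu).card = n) (r : CoefRing)
    (f : GGamma X) : localizationAt X mu (r ⊗ₜ f) =
      r * MvPolynomial.aeval (fun i : Fin n => bSeq X mu i) (f.1 n) := by
  subst hn
  rw [localizationAt, evalAt_tmul]
  rfl

/-- For suitable μ the entries of b_μ involve none of the b_i occurring in P. They can then be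
specialized to the variables x_i, with the other b_j left free, and the vanishing of the
localization becomes the vanishing of P in n variables. Even n is needed for μ to exist in type D.
-/
theorem eval_level_eq_zero {P : MvPolynomial ℕ+ (GGamma X)}
    (hP : ∀ mu, localizationAt X mu (ofGamma X P) = 0) {n : ℕ} (hn : Even n) :
    MvPolynomial.map ((Pi.evalRingHom (fun n : ℕ => MvPolynomial (Fin n) ZBeta) n).comp
      (GGamma X).val.toRingHom) P = 0 := by
  obtain ⟨N, hN⟩ := exists_bound P.vars
  -- n consecutive indices beyond all variables of P.
  let E : SP := (Finset.range n).image fun k => (N + k).succPNat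
  have hE : E.card = n := by
    rw [Finset.card_image_of_injective, Finset.card_range]
    intro k l h
    have := Nat.succPNat_injective h
    omega
  have hrep : rep X (unrep X E) = E := rep_unrep (by cases X <;> simp [IsRep, hE, hn])
  have hgt : ∀ i ∈ E, N < (i : ℕ) := by
    intro i hi
    obtain ⟨k, -, rfl⟩ := Finset.mem_image.1 hi
    simp only [Nat.succPNat_coe]
    omega
  have hlen : (E.sort (· ≥ ·)).length = n := by rw [Finset.length_sort, hE]
  let p : Fin n → ℕ+ := fun i => (E.sort (· ≥ ·))[(i : ℕ)]'(by rw [hlen]; exact i.2)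
  have hp : Function.Injective p := fun i j h =>
    Fin.ext ((List.Nodup.getElem_inj_iff (Finset.sort_nodup E (· ≥ ·))).1 h)
  have hpE : ∀ i, p i ∈ E := fun i => (Finset.mem_sort _).1 (List.getElem_mem _)
  obtain ⟨K, _, _, ι, hι⟩ :=
    exists_field_embedding (MvPolynomial ℕ+ (MvPolynomial (Fin n) ZBeta))
  let g : ℕ+ → MvPolynomial ℕ+ (MvPolynomial (Fin n) ZBeta) := fun j =>
    if h : ∃ i, p i = j then MvPolynomial.C (MvPolynomial.X h.choose) else MvPolynomial.X j
  have hgp : ∀ i, g (p i) = MvPolynomial.C (MvPolynomial.X i) := by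
    intro i
    have h : ∃ i', p i' = p i := ⟨i, rfl⟩
    simp only [g]
    rw [dif_pos h, hp h.choose_spec]
  have hgn : ∀ j, j ∉ Set.range p → g j = MvPolynomial.X j := fun j hj => dif_neg hj
  have hg : ∀ j, 1 + beta K * ι (g j) ≠ 0 := by
    intro j h
    rw [beta, ← ι.commutes, ← map_mul, ← map_one ι, ← map_add] at h
    have h1 := hι (h.trans (map_zero ι).symm)
    have h2 := congrArg (fun x => MvPolynomial.constantCoeff (MvPolynomial.constantCoeff x)) h1
    have h3 : MvPolynomial.constantCoeff (MvPolynomial.constantCoeff (g j)) = 0 := by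
      simp only [g]
      split_ifs <;> simp
    simp only [map_add, map_mul, map_one, map_zero, h3, mul_zero, add_zero] at h2
    exact one_ne_zero h2
  obtain ⟨χ, hχ, hχ'⟩ := exists_coefHom (Set.range p) (fun j => ι (g j)) hg
  have hseq : ∀ i : Fin n, χ (bSeq X (unrep X E) i) = ι (MvPolynomial.C (MvPolynomial.X i)) := by
    intro i
    rw [bSeq_of_lt (by rw [hrep, hE]; exact i.2), ← hgp i, ← hχ (p i) ⟨i, rfl⟩]
    simp only [hrep, p]
  have hcard : (rep X (unrep X E)).card = n := by rw [hrep, hE]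
  apply hι
  rw [map_zero]
  have h0 : χ (localizationAt X (unrep X E) (ofGamma X P)) = 0 := by rw [hP, map_zero]
  rw [← h0]
  refine MvPolynomial.hom_congr_vars
    (f₁ := (ι.toRingHom).comp (MvPolynomial.map ((Pi.evalRingHom
      (fun n : ℕ => MvPolynomial (Fin n) ZBeta) n).comp (GGamma X).val.toRingHom)))
    (f₂ := (χ.toRingHom.comp (localizationAt X (unrep X E)).toRingHom).comp (ofGamma X))
    ?_ (fun i hi _ => ?_) rfl
  · refine RingHom.ext fun f => ?_
    change ι (MvPolynomial.map _ (MvPolynomial.C f)) =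
      χ (localizationAt X (unrep X E) (ofGamma X (MvPolynomial.C f)))
    rw [ofGamma_C, MvPolynomial.map_C, localizationAt_tmul hcard, one_mul,
      MvPolynomial.comp_aeval_apply]
    simp only [hseq]
    exact aeval_generic (ι.comp (IsScalarTower.toAlgHom ZBeta (MvPolynomial (Fin n) ZBeta)
      (MvPolynomial ℕ+ (MvPolynomial (Fin n) ZBeta)))) (f.1 n)
  · change ι (MvPolynomial.map _ (MvPolynomial.X i)) =
      χ (localizationAt X (unrep X E) (ofGamma X (MvPolynomial.X i)))
    have hi' : i ∉ Set.range p := by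
      rintro ⟨k, rfl⟩
      have := hgt _ (hpE k)
      have := hN _ hi
      omega
    rw [ofGamma, MvPolynomial.eval₂Hom_X', localizationAt_tmul hcard, MvPolynomial.map_X,
      ← hgn i hi', ← hχ' i hi']
    have h1 : ((1 : GGamma X).1 n) = 1 := rfl
    rw [h1, map_one, mul_one]

theorem localization_injective (X : ClType) : Function.Injective (localization X) := by
  rw [injective_iff_map_eq_zero]
  intro F hF
  obtain ⟨v, P, hv, h⟩ := exists_ofGamma F
  have hloc : ∀ mu, localizationAt X mu (ofGamma X P) = 0 := by
    intro mu
    have h1 : localizationAt X mu F = 0 := congrFun hF mu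
    rw [← h, map_mul, h1, mul_zero]
  have hcoeff : ∀ m, MvPolynomial.coeff m P = 0 := by
    intro m
    have heven : ∀ n, Even n → (MvPolynomial.coeff m P).1 n = 0 := by
      intro n hn
      have := congrArg (MvPolynomial.coeff m) (eval_level_eq_zero hloc hn)
      rw [MvPolynomial.coeff_map, MvPolynomial.coeff_zero] at this
      exact this
    apply Subtype.ext
    funext n
    by_cases hn : Even n
    · exact heven n hn
    · rw [← GGamma_dropLast (MvPolynomial.coeff m P).2 n, heven _ (Nat.even_add_one.2 hn), map_zero]
      rfl
  have hP : P = 0 := MvPolynomial.ext _ _ fun m => by rw [hcoeff, MvPolynomial.coeff_zero]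
  rw [hP, map_zero] at h
  obtain ⟨u, hu⟩ := hv
  have h2 : (((↑u⁻¹ : CoefRing) ⊗ₜ 1 : GGammaR X) * (fromPoly v ⊗ₜ 1)) * F = 0 := by
    rw [mul_assoc, h, mul_zero]
  rwa [Algebra.TensorProduct.tmul_mul_tmul, ← hu, Units.inv_mul, one_mul,
    ← Algebra.TensorProduct.one_def, one_mul] at h2

theorem IsGXFin.unique {la : SP} {n : ℕ} {p q : MvPolynomial (Fin n) CoefRing}
    (hp : IsGXFin X la n p) (hq : IsGXFin X la n q) : p = q := by
  obtain ⟨P, h1, rfl⟩ := hp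
  obtain ⟨Q, h2, rfl⟩ := hq
  rw [IsFractionRing.injective (PolyRing (numVars X n)) (FractionRing (PolyRing (numVars X n)))
    (h1.trans h2.symm)]

theorem evalAt_eq_aeval_level {S : Type} [CommRing S] [Algebra ZBeta S] [Algebra CoefRing S]
    [IsScalarTower ZBeta CoefRing S] {n : ℕ} (x : Fin n → S) (F : GGammaR X) :
    evalAt X n x F = MvPolynomial.aeval x (level X n F) := by
  rw [level, map_evalAt]
  simp only [MvPolynomial.aeval_X]

/-- Each localization factors through the polynomial in sufficiently many variables, so injectivity
of localization gives the uniqueness. -/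
theorem IsGX.unique {la : SP} {F G : GGammaR X} (hF : IsGX X la F) (hG : IsGX X la G) : F = G := by
  apply localization_injective X
  funext mu
  obtain ⟨n, hn⟩ := exists_bound (rep X mu)
  have h := fun H => localizationAt_eq_placeSeq (X := X) mu H (n := n ⊔ la.card)
    fun i hi => (hn i hi).trans le_sup_left
  change localizationAt X mu F = localizationAt X mu G
  rw [h F, h G, evalAt_eq_aeval_level, evalAt_eq_aeval_level,
    (hF _ le_sup_right).unique (hG _ le_sup_right)]

/-! ### The localizations of the elements `GX_λ(x|b)` -/

/-- The values of the `b_z` in a field, with no relations but `b_z ⊕ b_z̄ = 0`. -/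
structure IsGeneric {K : Type*} [Field K] [Algebra ZBeta K] (c : SNum → K) : Prop where
  oplus_bar : ∀ z, oplus (c z) (c (bar z)) = 0
  oplus_ne : ∀ z w, w ≠ bar z → oplus (c z) (c w) ≠ 0

namespace IsGeneric

variable {K : Type*} [Field K] [Algebra ZBeta K] {c : SNum → K} (hc : IsGeneric c)

include hc

theorem oplus_self_ne (z : SNum) : oplus (c z) (c z) ≠ 0 :=
  hc.oplus_ne z z (bar_ne_self z).symm

theorem ne_zero (z : SNum) : c z ≠ 0 := fun h => hc.oplus_self_ne z (by rw [h, oplus_zero])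

theorem injective : Function.Injective c := by
  intro z w h
  by_contra hne
  refine hc.oplus_ne z (bar w) (fun h' => hne (bar_injective h').symm) ?_
  rw [h, hc.oplus_bar]

theorem one_add_ne (z : SNum) : 1 + beta K * c z ≠ 0 := (isUnit_one_add (hc.oplus_bar z)).ne_zero

end IsGeneric

theorem isGeneric_of_injective {K : Type*} [Field K] [Algebra ZBeta K] {φ : CoefRing →ₐ[ZBeta] K}
    (hφ : Function.Injective φ) : IsGeneric fun z => φ (b z) where
  oplus_bar z := by rw [← map_oplus, b_oplus_b_bar, map_zero]
  oplus_ne z w h h0 := oplus_b_ne_zero h (hφ (by rw [map_oplus, h0, map_zero]))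

/-! ### Entries indexed by `rep X λ` and the localization formula -/

theorem sort_eq_of_mem_iff {E : SP} {l : List ℕ+} (h : l.Pairwise (· > ·))
    (hm : ∀ x, x ∈ l ↔ x ∈ E) : E.sort (· ≥ ·) = l := by
  have hn : l.Nodup := h.imp fun h => h.ne'
  have hp : List.Perm (E.sort (· ≥ ·)) l :=
    (List.perm_ext_iff_of_nodup (Finset.sort_nodup E _) hn).2 fun x => by
      rw [Finset.mem_sort, hm]
  exact hp.eq_of_pairwise' (Finset.pairwise_sort E _) (h.imp fun h => h.le)

theorem sort_pairwise_gt (E : SP) : (E.sort (· ≥ ·)).Pairwise (· > ·) := by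
  have h := (Finset.pairwise_sort E (· ≥ ·)).and (Finset.sort_nodup E (· ≥ ·))
  exact h.imp fun h => lt_of_le_of_ne h.1 h.2.symm

theorem sort_split (k : ℕ+) (E : SP) : E.sort (· ≥ ·) =
    (E.filter (k + 1 < ·)).sort (· ≥ ·) ++ ((if k + 1 ∈ E then [k + 1] else []) ++
      ((if k ∈ E then [k] else []) ++ (E.filter (· < k)).sort (· ≥ ·))) := by
  have hk := PNat.lt_add_right k 1
  have m1 : ∀ x, x ∈ (if k + 1 ∈ E then [k + 1] else []) ↔ x = k + 1 ∧ k + 1 ∈ E := by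
    intro x; split_ifs with h <;> simp [h]
  have m2 : ∀ x, x ∈ (if k ∈ E then [k] else []) ↔ x = k ∧ k ∈ E := by
    intro x; split_ifs with h <;> simp [h]
  apply sort_eq_of_mem_iff
  · refine List.pairwise_append.2 ⟨sort_pairwise_gt _, List.pairwise_append.2 ⟨?_,
      List.pairwise_append.2 ⟨?_, sort_pairwise_gt _, ?_⟩, ?_⟩, ?_⟩
    · split_ifs <;> simp
    · split_ifs <;> simp
    · intro x hx y hy
      rw [Finset.mem_sort, Finset.mem_filter] at hy
      rw [((m2 x).1 hx).1]
      exact hy.2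
    · intro x hx y hy
      rw [((m1 x).1 hx).1]
      rcases List.mem_append.1 hy with hy | hy
      · rw [((m2 y).1 hy).1]; exact hk
      · rw [Finset.mem_sort, Finset.mem_filter] at hy
        exact hy.2.trans hk
    · intro x hx y hy
      rw [Finset.mem_sort, Finset.mem_filter] at hx
      rcases List.mem_append.1 hy with hy | hy
      · rw [((m1 y).1 hy).1]; exact hx.2
      · rcases List.mem_append.1 hy with hy | hy
        · rw [((m2 y).1 hy).1]; exact hk.trans hx.2
        · rw [Finset.mem_sort, Finset.mem_filter] at hy
          exact (hy.2.trans hk).trans hx.2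
  · intro x
    simp only [List.mem_append, m1, m2, Finset.mem_sort, Finset.mem_filter]
    constructor
    · rintro (h | ⟨rfl, h⟩ | ⟨rfl, h⟩ | h)
      · exact h.1
      · exact h
      · exact h
      · exact h.1
    · intro h
      rcases lt_trichotomy x k with h1 | rfl | h1
      · exact Or.inr (Or.inr (Or.inr ⟨h, h1⟩))
      · exact Or.inr (Or.inr (Or.inl ⟨rfl, h⟩))
      · rcases (PNat.add_one_le_iff.2 h1).eq_or_lt with rfl | h2
        · exact Or.inr (Or.inl ⟨rfl, h⟩)
        · exact Or.inl ⟨h, h2⟩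

variable {K : Type} [Field K] [Algebra ZBeta K]

/-- The factor of `repEntry` that does not involve the parameters. -/
def headFactor (X : ClType) (a : K) : K :=
  match X with
  | .B => a
  | .C => oplus a a
  | .D => 1

/-- The entry that belongs to the element `p` of `rep X λ`. -/
def repEntry (X : ClType) (c : SNum → K) (p : ℕ+) (a : K) : K :=
  headFactor X a * ∏ j ∈ Finset.range p.natPred, oplus a (c (pos j.succPNat))

/-- The entries that belong to the elements of `rep X λ`. -/
def repEntries (X : ClType) (c : SNum → K) (E : SP) : List (K → K) :=
  (E.sort (· ≥ ·)).map (repEntry X c)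

/-- The points `b_ī` for `i ∈ E`. -/
def barPts (c : SNum → K) (E : SP) : Finset K := E.image fun i => c (bar (pos i))

omit [Field K] [Algebra ZBeta K] in
theorem mem_barPts {c : SNum → K} {E : SP} {a : K} :
    a ∈ barPts c E ↔ ∃ i ∈ E, c (bar (pos i)) = a := Finset.mem_image

theorem mem_barPts_iff {c : SNum → K} (hc : IsGeneric c) {E : SP} {z : SNum} :
    c z ∈ barPts c E ↔ ∃ i ∈ E, bar (pos i) = z := by
  simp only [mem_barPts, hc.injective.eq_iff]

theorem card_barPts {c : SNum → K} (hc : IsGeneric c) (E : SP) : (barPts c E).card = E.card :=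
  Finset.card_image_of_injective _ (hc.injective.comp (bar_injective.comp pos_injective))

/-- In type D the element 1 that `toEven` adds gives a last entry equal to 1. It sees an odd number
of remaining points, and the one-row sum with weight 1 is then 1. -/
theorem repEntries_append_one {c : SNum → K} (hc : IsGeneric c) [CharZero K] (hβ : beta K ≠ 0)
    (L : List (K → K)) {M : SP} (h : Odd (M.card + L.length)) :
    hsum (L ++ [fun _ => 1]) (barPts c M) = hsum L (barPts c M) := by
  have := hsum_append_congr (L := L) (M₁ := [fun _ => (1 : K)]) (M₂ := []) (S := barPts c M) ?_
  · rwa [List.append_nil] at this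
  · intro S' hS' hcard
    rw [card_barPts hc] at hcard
    simp only [hsum_cons, hsum_nil, mul_one, one_mul]
    refine sum_prod_rr_of_odd hβ S' (fun a ha => ?_) (fun a ha => ?_) ?_
    · obtain ⟨i, -, rfl⟩ := mem_barPts.1 (hS' ha)
      exact hc.one_add_ne _
    · obtain ⟨i, -, rfl⟩ := mem_barPts.1 (hS' ha)
      exact hc.oplus_self_ne _
    · rw [← hcard, add_assoc, Nat.odd_add] at h
      exact h.2 (Even.add_self _)

theorem entries_eq_repEntries {X : ClType} (hX : X ≠ .D) (φ : CoefRing →ₐ[ZBeta] K) (la : SP) :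
    entries X (fun j => φ (params X j)) la = repEntries X (fun z => φ (b z)) la := by
  refine List.map_congr_left fun p _ => ?_
  funext a
  have hp : (p : ℕ) = p.natPred + 1 := (PNat.natPred_add_one p).symm
  cases X
  · have hn : numFactors .B p = p.natPred + 1 := hp
    rw [entry, repEntry, hn, Finset.prod_range_succ']
    have h0 : φ (params .B (Nat.succPNat 0)) = 0 := map_zero φ
    have hs : ∀ j : ℕ, params .B (Nat.succPNat (j + 1)) = b (pos j.succPNat) := by
      intro j
      have h1 : Nat.succPNat (j + 1) = j.succPNat + 1 := rfl
      rw [h1, params, if_neg (add_one_ne_one _), PNat.add_sub]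
    simp only [h0, hs, oplus_zero, preFactor, headFactor]
    ring
  · rfl
  · exact absurd rfl hX

theorem repEntries_toEven (c : SNum → K) (la : SP) : repEntries .D c (toEven la) =
    ((la.sort (· ≥ ·)).map fun p => repEntry .D c (p + 1)) ++
      if Odd la.card then [fun _ => 1] else [] := by
  have h : (toEven la).sort (· ≥ ·) =
      (la.sort (· ≥ ·)).map (· + 1) ++ if Odd la.card then [1] else [] := by
    apply sort_eq_of_mem_iff
    · refine List.pairwise_append.2 ⟨?_, ?_, ?_⟩
      · rw [List.pairwise_map]
        exact (sort_pairwise_gt la).imp fun h => add_lt_add_left h 1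
      · split_ifs <;> simp
      · intro x hx y hy
        obtain ⟨p, -, rfl⟩ := List.mem_map.1 hx
        have hy' : y = 1 := by split_ifs at hy <;> simp_all
        rw [hy']
        exact PNat.lt_add_left 1 p
    · intro x
      rcases eq_one_or_add_one x with rfl | ⟨j, rfl⟩
      · rw [one_mem_toEven]
        split_ifs with h
        · simp [h]
        · simp [h, add_one_ne_one]
      · rw [add_one_mem_toEven]
        split_ifs with h
        · simp [add_one_ne_one]
        · simp
  rw [repEntries, h, List.map_append, List.map_map]
  congr 1
  split_ifs
  · rw [List.map_singleton]
    congr 1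
    funext a
    have h1 : PNat.natPred 1 = 0 := rfl
    simp [repEntry, headFactor, h1]
  · rfl

theorem entries_eq_repEntry (φ : CoefRing →ₐ[ZBeta] K) (la : SP) :
    entries .D (fun j => φ (params .D j)) la =
      (la.sort (· ≥ ·)).map fun p => repEntry .D (fun z => φ (b z)) (p + 1) := by
  refine List.map_congr_left fun p _ => ?_
  funext a
  rfl

/-- The entries of b_μ are distinct and nonzero, so the sum formula applies. Rewriting it in terms
of `rep X λ` makes the three types uniform: the entry of p has the factors a ⊕ b_j for j < p. -/
theorem localizationAt_gx [CharZero K] (hβ : beta K ≠ 0) {φ : CoefRing →ₐ[ZBeta] K}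
    (hφ : Function.Injective φ) (X : ClType) (la mu : SP) :
    φ (localizationAt X mu (gx X la)) = hsum (repEntries X (fun z => φ (b z)) (rep X la))
      (barPts (fun z => φ (b z)) (rep X mu)) := by
  have hc := isGeneric_of_injective hφ
  let alg : Algebra CoefRing K := φ.toRingHom.toAlgebra
  have tow : IsScalarTower ZBeta CoefRing K :=
    IsScalarTower.of_algebraMap_eq fun r => (φ.commutes r).symm
  set E := rep X mu with hE
  have hlen : (E.sort (· ≥ ·)).length = E.card := Finset.length_sort _
  have hval : ∀ i : Fin E.card, φ (bSeq X mu i) =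
      φ (b (bar (pos ((E.sort (· ≥ ·))[(i : ℕ)]'(by rw [hlen]; exact i.2))))) := by
    intro i
    rw [bSeq_of_lt (X := X) (mu := mu) i.2]
  have hinj : Function.Injective fun i : Fin E.card => φ (bSeq X mu i) := by
    intro i j h
    simp only [hval] at h
    have h1 := pos_injective (bar_injective (hc.injective h))
    exact Fin.ext ((List.Nodup.getElem_inj_iff (Finset.sort_nodup E (· ≥ ·))).1 h1)
  have hne : ∀ i : Fin E.card, φ (bSeq X mu i) ≠ 0 := fun i => by
    rw [hval]; exact hc.ne_zero _
  have hpts : pts (fun i : Fin E.card => φ (bSeq X mu i)) = barPts (fun z => φ (b z)) E := by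
    ext a
    rw [mem_pts, mem_barPts]
    constructor
    · rintro ⟨i, rfl⟩
      exact ⟨_, (Finset.mem_sort _).1 (List.getElem_mem _), (hval i).symm⟩
    · rintro ⟨p, hp, rfl⟩
      obtain ⟨m, hm, h⟩ := List.getElem_of_mem ((Finset.mem_sort (· ≥ ·)).2 hp)
      exact ⟨⟨m, by rwa [hlen] at hm⟩, (hval ⟨m, by rwa [hlen] at hm⟩).trans (by simp only [h])⟩
  have h1 : φ (localizationAt X mu (gx X la)) =
      evalAt X E.card (fun i => φ (bSeq X mu i)) (gx X la) :=
    map_evalAt (Algebra.ofId CoefRing K) _ _ _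
  have h2 := evalAt_gx (X := X) (la := la) (n := E.card) (E := K)
    (y := fun i => φ (bSeq X mu i)) (by
      cases X
      · exact Or.inl (by simp)
      · exact Or.inl (by simp)
      · exact Or.inr (isRep_rep .D mu)) hinj hne
  rw [h1, h2, hpts]
  by_cases hX : X = .D
  · subst hX
    change hsum (entries .D (fun j => φ (params .D j)) la) _ = _
    have hev : Even E.card := isRep_rep .D mu
    rw [entries_eq_repEntry]
    change _ = hsum (repEntries .D _ (toEven la)) _
    rw [repEntries_toEven]
    split_ifs with hodd
    · rw [repEntries_append_one hc hβ]
      rw [List.length_map, Finset.length_sort]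
      exact hev.add_odd hodd
    · rw [List.append_nil]
  · change hsum (entries X (fun j => φ (params X j)) la) _ = _
    rw [entries_eq_repEntries hX]
    congr 2
    cases X
    · rfl
    · rfl
    · exact absurd rfl hX

/-! ### Divided differences of the sums `hsum` -/

variable {X : ClType} {K : Type} [Field K] [Algebra ZBeta K] {c : SNum → K}

theorem repEntry_one (c : SNum → K) (a : K) : repEntry X c 1 a = headFactor X a := by
  have h1 : PNat.natPred 1 = 0 := rfl
  rw [repEntry, h1, Finset.prod_range_zero, mul_one]

theorem repEntry_succ (c : SNum → K) (k : ℕ+) (a : K) :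
    repEntry X c (k + 1) a = repEntry X c k a * oplus a (c (pos k)) := by
  have h1 : PNat.natPred (k + 1) = k.natPred + 1 := by
    have := k.natPred_add_one
    have := (k + 1).natPred_add_one
    rw [PNat.add_coe, PNat.one_coe] at this
    omega
  rw [repEntry, h1, Finset.prod_range_succ, PNat.succPNat_natPred, ← mul_assoc]
  rfl

/-! ### The reflections `s_k`, k ≥ 1 -/

theorem sPos_pos (k : ℕ+) : (sPos k).1 (pos k) = pos (k + 1) := if_pos rfl

theorem sPos_pos_succ (k : ℕ+) : (sPos k).1 (pos (k + 1)) = pos k := by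
  rw [← sPos_pos]
  exact (sPos k).1.symm_apply_apply _

theorem sPos_of_ne {k i : ℕ+} (h1 : i ≠ k) (h2 : i ≠ k + 1) : (sPos k).1 (pos i) = pos i := by
  change sFun k (pos i) = pos i
  have h3 : ∀ j : ℕ+, pos i ≠ bar (pos j) := fun j => (bar_pos_ne_pos j i).symm
  simp only [sFun, pos_injective.eq_iff, h1, h2, h3, if_false]

/-- The entry of p involves b_1, …, b_{p-1} symmetrically, so only p = k + 1 separates b_k from
b_{k+1}. -/
theorem repEntry_sPos (c : SNum → K) {k p : ℕ+} (hp : p ≠ k + 1) :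
    repEntry X (fun z => c ((sPos k).1 z)) p = repEntry X c p := by
  funext a
  rw [repEntry, repEntry]
  congr 1
  have hk := k.natPred_add_one
  have hp' := p.natPred_add_one
  have hne : p.natPred ≠ k.natPred + 1 := fun h => hp (PNat.eq (by
    rw [PNat.add_coe, PNat.one_coe]; omega))
  refine Finset.prod_equiv (Equiv.swap k.natPred (k.natPred + 1)) (fun j => ?_) (fun j _ => ?_)
  · simp only [Finset.mem_range, Equiv.swap_apply_def]
    split_ifs <;> omega
  · by_cases h1 : j = k.natPred
    · rw [h1, Equiv.swap_apply_left, PNat.succPNat_natPred, sPos_pos]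
      congr 3
      exact PNat.eq (by rw [Nat.succPNat_coe, PNat.add_coe, PNat.one_coe]; omega)
    · by_cases h2 : j = k.natPred + 1
      · have h3 : (k.natPred + 1).succPNat = k + 1 :=
          PNat.eq (by rw [Nat.succPNat_coe, PNat.add_coe, PNat.one_coe]; omega)
        rw [h2, Equiv.swap_apply_right, h3, sPos_pos_succ, PNat.succPNat_natPred]
      · rw [Equiv.swap_apply_of_ne_of_ne h1 h2, sPos_of_ne]
        · intro h; apply h1; rw [← h, Nat.natPred_succPNat]
        · intro h
          apply h2
          have h3 := congrArg PNat.val h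
          change ((j.succPNat : ℕ+) : ℕ) = ((k + 1 : ℕ+) : ℕ) at h3
          rw [Nat.succPNat_coe, PNat.add_coe, PNat.one_coe] at h3
          omega

theorem repEntries_split (c : SNum → K) (k : ℕ+) (E : SP) : repEntries X c E =
    repEntries X c (E.filter (k + 1 < ·)) ++ ((if k + 1 ∈ E then [repEntry X c (k + 1)] else []) ++
      ((if k ∈ E then [repEntry X c k] else []) ++ repEntries X c (E.filter (· < k)))) := by
  rw [repEntries, sort_split k E, List.map_append, List.map_append, List.map_append]
  simp only [apply_ite (List.map (repEntry X c)), List.map_singleton, List.map_nil]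
  rfl

theorem repEntries_sPos (c : SNum → K) {k : ℕ+} {E : SP} (h : k + 1 ∉ E) :
    repEntries X (fun z => c ((sPos k).1 z)) E = repEntries X c E := by
  refine List.map_congr_left fun p hp => repEntry_sPos c ?_
  rintro rfl
  exact h ((Finset.mem_sort _).1 hp)

/-- As l = k ⊕ x, this is y ⊕ l = (y ⊕ k) ⊕ x. For k, l equal to b_k, b_{k+1}, the element x is
e(α_k). -/
theorem oplus_succ_eq {k l z : K} {x y : K} (h : oplus z k = 0) (hx : x = oplus l z) :
    oplus y l = (1 + beta K * x) * oplus y k + x := by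
  subst hx
  unfold oplus at *
  linear_combination (-(1 + beta K * l) * (1 + beta K * y)) * h

/-- If E contains k + 1 and k, the twist changes the entry of k + 1 by a multiple of (1 + βa)g(a),
where g is the next entry. In the two chosen points a, d this gives g(a)g(d)(1 + βa)(1 + βd)(a ⊕
d)/(a - d), which is antisymmetric. -/
theorem hsum_sPos_ge [CharZero K] (hc : IsGeneric c) {k : ℕ+} {E : SP} (h : k + 1 ∈ E → k ∈ E)
    (S : Finset K) : hsum (repEntries X (fun z => c ((sPos k).1 z)) E) S =
      hsum (repEntries X c E) S := by
  by_cases h1 : k + 1 ∈ E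
  · have h2 := h h1
    rw [repEntries_split _ k E, repEntries_split c k E, repEntries_sPos c (by simp),
      repEntries_sPos c (by simp [(PNat.lt_add_right k 1).le]), if_pos h1, if_pos h1, if_pos h2,
      if_pos h2,
      repEntry_sPos c (PNat.lt_add_right k 1).ne]
    simp only [List.singleton_append]
    set A := repEntries X c (E.filter (k + 1 < ·))
    set B := repEntries X c (E.filter (· < k))
    set g := repEntry X c k with hg
    have hz := (hc.oplus_bar (pos k))
    have h3 := hsum_linear A (g :: B) (S := S) (f := repEntry X (fun z => c ((sPos k).1 z)) (k + 1))
      (g := repEntry X c (k + 1)) (k := fun a => (1 + beta K * a) * g a) (c := 1)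
      (d := oplus (c (pos (k + 1))) (c (bar (pos k))) * (1 + beta K * c (pos k))) (fun a _ => by
        have e := oplus_succ_eq (y := a) (l := c (pos (k + 1))) (by rw [oplus_comm]; exact hz) rfl
        rw [repEntry_succ, repEntry_succ, sPos_pos, repEntry_sPos c (PNat.lt_add_right k 1).ne, e]
        unfold oplus; ring)
    have h4 := hsum_antisymm A B (g := fun a => (1 + beta K * a) * g a) (k := g) (S := S)
      (fun a _ d _ hne => by
        have := sub_ne_zero.2 hne
        have := sub_ne_zero.2 hne.symm
        rw [rr_eq, rr_eq, oplus_comm d a]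
        field_simp
        ring)
    rw [h3, h4]
    ring
  · rw [repEntries_sPos c h1]

/-- By `oplus_succ_eq` the twisted entry of k + 1 is a combination of the entries of k + 1 and of k,
and the latter is the entry of s_k E. -/
theorem hsum_sPos_lower (hc : IsGeneric c) {k : ℕ+} {E : SP} (h : k ∉ E) (h' : k + 1 ∈ E)
    (S : Finset K) : hsum (repEntries X (fun z => c ((sPos k).1 z)) E) S =
      (1 + beta K * oplus (c (pos (k + 1))) (c (bar (pos k)))) * hsum (repEntries X c E) S +
        oplus (c (pos (k + 1))) (c (bar (pos k))) *
          hsum (repEntries X c (actBC (sPos k) E)) S := by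
  have hk := PNat.lt_add_right k 1
  have e1 : (actBC (sPos k) E).filter (k + 1 < ·) = E.filter (k + 1 < ·) := by
    ext i
    rw [Finset.mem_filter, Finset.mem_filter, mem_actBC_sPos]
    refine and_congr_left fun hi => ?_
    rw [if_neg (hk.trans hi).ne', if_neg hi.ne']
  have e2 : (actBC (sPos k) E).filter (· < k) = E.filter (· < k) := by
    ext i
    rw [Finset.mem_filter, Finset.mem_filter, mem_actBC_sPos]
    refine and_congr_left fun hi => ?_
    rw [if_neg hi.ne, if_neg (hi.trans hk).ne]
  have e3 : k ∈ actBC (sPos k) E := by rw [mem_actBC_sPos, if_pos rfl]; exact h'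
  have e4 : k + 1 ∉ actBC (sPos k) E := by
    rw [mem_actBC_sPos, if_neg hk.ne', if_pos rfl]; exact h
  rw [repEntries_split _ k E, repEntries_split c k E, repEntries_split c k (actBC (sPos k) E), e1,
    e2, repEntries_sPos c (by simp), repEntries_sPos c (by simp [hk.le]), if_pos h', if_pos h', if_neg h,
    if_neg h, if_pos e3, if_neg e4]
  simp only [List.singleton_append, List.nil_append]
  refine hsum_linear _ _ fun a _ => ?_
  have e := oplus_succ_eq (y := a) (l := c (pos (k + 1)))
    (by rw [oplus_comm]; exact hc.oplus_bar (pos k)) rfl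
  rw [repEntry_succ, repEntry_succ, sPos_pos, repEntry_sPos c hk.ne, e]
  ring

omit [Field K] [Algebra ZBeta K] in
theorem barPts_sPos (c : SNum → K) (k : ℕ+) (M : SP) :
    barPts (fun z => c ((sPos k).1 z)) (actBC (sPos k) M) = barPts c M := by
  have key : ∀ (c : SNum → K) (M : SP),
      barPts (fun z => c ((sPos k).1 z)) (actBC (sPos k) M) ⊆ barPts c M := by
    intro c M a ha
    obtain ⟨i, hi, rfl⟩ := mem_barPts.1 ha
    rw [mem_actBC_sPos] at hi
    rw [mem_barPts]
    by_cases h1 : i = k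
    · rw [if_pos h1] at hi
      exact ⟨k + 1, hi, by rw [(sPos k).2.1, h1, sPos_pos]⟩
    · rw [if_neg h1] at hi
      by_cases h2 : i = k + 1
      · rw [if_pos h2] at hi
        exact ⟨k, hi, by rw [(sPos k).2.1, h2, sPos_pos_succ]⟩
      · rw [if_neg h2] at hi
        exact ⟨i, hi, by rw [(sPos k).2.1, sPos_of_ne h1 h2]⟩
  refine Finset.Subset.antisymm (key c M) ?_
  have h := key (fun z => c ((sPos k).1 z)) (actBC (sPos k) M)
  rw [← actBC_mul, sPos_mul_self, actBC_one] at h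
  have h1 : ∀ z, (sPos k).1 ((sPos k).1 z) = z := (sPos k).1.symm_apply_apply
  simpa only [h1] using h

/-! The reflection `s₀`. -/

theorem sort_split_one (E : SP) : E.sort (· ≥ ·) =
    (E.filter (1 < ·)).sort (· ≥ ·) ++ if 1 ∈ E then [1] else [] := by
  have m1 : ∀ x : ℕ+, x ∈ (if 1 ∈ E then [1] else []) ↔ x = 1 ∧ 1 ∈ E := by
    intro x; split_ifs with h <;> simp [h]
  apply sort_eq_of_mem_iff
  · refine List.pairwise_append.2 ⟨sort_pairwise_gt _, ?_, fun x hx y hy => ?_⟩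
    · split_ifs <;> simp
    · rw [Finset.mem_sort, Finset.mem_filter] at hx
      rw [((m1 y).1 hy).1]
      exact hx.2
  · intro x
    rw [List.mem_append, m1, Finset.mem_sort, Finset.mem_filter]
    constructor
    · rintro (h | ⟨rfl, h⟩)
      · exact h.1
      · exact h
    · intro h
      rcases eq_or_ne x 1 with rfl | h1
      · exact Or.inr ⟨rfl, h⟩
      · exact Or.inl ⟨h, lt_of_le_of_ne one_le h1.symm⟩

theorem repEntries_split_one (c : SNum → K) (E : SP) : repEntries X c E =
    repEntries X c (E.filter (1 < ·)) ++ if 1 ∈ E then [headFactor X] else [] := by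
  rw [repEntries, sort_split_one, List.map_append]
  simp only [apply_ite (List.map (repEntry X c)), List.map_singleton, List.map_nil]
  have h : repEntry X c 1 = headFactor X := funext (repEntry_one c)
  rw [h]
  rfl

/-- a ⊕ z' is a multiple of a - z and cancels the denominator of `rr a z`. Thus an entry with b_1̄
in place of b_1 becomes the original entry once the point b_1 is absorbed. -/
theorem oplus_mul_rr {a z z' : K} (hz : oplus z z' = 0) (ha : a ≠ z) :
    oplus a z' * rr a z = oplus a z := by
  have h1 := one_add_mul_one_add hz
  have h2 := sub_ne_zero.2 ha
  rw [rr_eq, mul_div_assoc', div_eq_iff h2]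
  unfold oplus at *
  linear_combination (a + z + beta K * a * z) * (hz + a * h1)

theorem s0_of_one_lt {i : ℕ+} (h : 1 < i) : s0.1 (pos i) = pos i :=
  s0_of_ne (fun h' => h.ne' (pos_injective h')) (bar_pos_ne_pos 1 i).symm

theorem repEntry_s0 (c : SNum → K) {p : ℕ+} (hp : 1 < p) : ∃ R : K → K, ∀ a,
    repEntry X c p a = R a * oplus a (c (pos 1)) ∧
    repEntry X (fun z => c (s0.1 z)) p a = R a * oplus a (c (bar (pos 1))) := by
  obtain ⟨q, rfl⟩ := (eq_one_or_add_one p).resolve_left hp.ne'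
  have h1 : PNat.natPred (q + 1) = q.natPred + 1 := by
    have := q.natPred_add_one
    have := (q + 1).natPred_add_one
    rw [PNat.add_coe, PNat.one_coe] at this
    omega
  refine ⟨fun a => headFactor X a * ∏ j ∈ Finset.range q.natPred, oplus a (c (pos (j + 1).succPNat)),
    fun a => ?_⟩
  have h2 : ∀ j : ℕ, s0.1 (pos (j + 1).succPNat) = pos (j + 1).succPNat := fun j =>
    s0_of_one_lt (PNat.coe_lt_coe _ _ |>.1 (by rw [Nat.succPNat_coe, PNat.one_coe]; omega))
  have h3 : Nat.succPNat 0 = 1 := rfl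
  rw [repEntry, repEntry, h1, Finset.prod_range_succ', Finset.prod_range_succ']
  simp only [h2, h3, s0_pos_one]
  exact ⟨(mul_assoc _ _ _).symm, (mul_assoc _ _ _).symm⟩

/-- For p > 1 the twisted entry contains a ⊕ b_1̄: it vanishes at b_1 and absorbs the factor `rr a
b_1`. -/
theorem forall₂_s0 (hc : IsGeneric c) (E : SP) {S : Finset K} (hS : c (pos 1) ∉ S) :
    List.Forall₂ (fun g g' => (∀ z ∈ ({c (pos 1)} : Finset K), g z = 0) ∧
      ∀ a ∈ S, g' a = g a * ∏ z ∈ {c (pos 1)}, rr a z)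
      (repEntries X (fun z => c (s0.1 z)) (E.filter (1 < ·)))
      (repEntries X c (E.filter (1 < ·))) := by
  unfold repEntries
  rw [List.forall₂_map_left_iff, List.forall₂_map_right_iff, List.forall₂_same]
  intro p hp
  rw [Finset.mem_sort, Finset.mem_filter] at hp
  obtain ⟨R, hR⟩ := repEntry_s0 (X := X) c hp.2
  refine ⟨fun z hz => ?_, fun a ha => ?_⟩
  · rw [Finset.mem_singleton.1 hz, (hR _).2, hc.oplus_bar, mul_zero]
  · rw [Finset.prod_singleton, (hR a).1, (hR a).2, mul_assoc,
      oplus_mul_rr (hc.oplus_bar _) fun h => hS (h ▸ ha)]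

theorem hsum_s0_ge (hc : IsGeneric c) {E : SP} (h : 1 ∉ E) {S : Finset K} (hS : c (pos 1) ∉ S) :
    hsum (repEntries X (fun z => c (s0.1 z)) E) (insert (c (pos 1)) S) =
      hsum (repEntries X c E) S := by
  have := hsum_append_linear (T := {c (pos 1)}) (M₁ := []) (M₂ := []) (M₃ := []) (c₁ := 1)
    (c₂ := -1) (c₃ := 0) (Finset.disjoint_singleton_right.2 hS) (forall₂_s0 (X := X) hc E hS)
    (fun S' _ _ => by simp)
  rw [repEntries_split_one _ E, repEntries_split_one c E, if_neg h, Finset.insert_eq,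
    Finset.union_comm]
  linear_combination this

theorem hsum_one_add_ne (hc : IsGeneric c) {S : Finset K} (hS : ∀ a ∈ S, ∃ z, c z = a) :
    ∀ a ∈ S, 1 + beta K * a ≠ 0 := by
  intro a ha
  obtain ⟨z, rfl⟩ := hS a ha
  exact hc.one_add_ne z

theorem hsum_oplus_self_ne (hc : IsGeneric c) {S : Finset K} (hS : ∀ a ∈ S, ∃ z, c z = a) :
    ∀ a ∈ S, oplus a a ≠ 0 := by
  intro a ha
  obtain ⟨z, rfl⟩ := hS a ha
  exact hc.oplus_self_ne z

/-- The multiplicative form of the one-row sum: adding the point b_1 multiplies it by 1 + βe(α_0).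
-/
theorem hsum_headFactor (hβ : beta K ≠ 0) (hc : IsGeneric c) (hX : X ≠ .D) {S : Finset K}
    (hS : ∀ a ∈ S, ∃ z, c z = a) : beta K * hsum [headFactor X] S + 1 =
      ∏ a ∈ S, (1 + beta K * headFactor X a) := by
  have h0 := hsum_one_add_ne hc hS
  simp only [hsum_cons, hsum_nil, mul_one]
  cases X
  · simp only [headFactor]
    rw [sum_mul_prod_rr hβ S h0 (hsum_oplus_self_ne hc hS)]
    field_simp
    ring
  · simp only [headFactor]
    rw [sum_oplus_self_prod_rr hβ S h0, ← Finset.prod_pow]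
    have : ∀ a ∈ S, 1 + beta K * oplus a a = (1 + beta K * a) ^ 2 := fun a _ => by
      unfold oplus; ring
    rw [Finset.prod_congr rfl this]
    field_simp
    ring
  · exact absurd rfl hX

/-- The entries of p > 1 absorb b_1, and the last entry is governed by `hsum_headFactor`; without
that entry the list belongs to s_0 E. -/
theorem hsum_s0_lower (hβ : beta K ≠ 0) (hc : IsGeneric c) (hX : X ≠ .D) {E : SP} (h : 1 ∈ E)
    {S : Finset K} (hS : c (pos 1) ∉ S) (hS' : ∀ a ∈ S, ∃ z, c z = a) :
    hsum (repEntries X (fun z => c (s0.1 z)) E) (insert (c (pos 1)) S) =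
      (1 + beta K * headFactor X (c (pos 1))) * hsum (repEntries X c E) S +
        headFactor X (c (pos 1)) * hsum (repEntries X c (actBC s0 E)) S := by
  have e1 : (actBC s0 E).filter (1 < ·) = E.filter (1 < ·) := by
    ext i
    rw [Finset.mem_filter, Finset.mem_filter, mem_actBC_s0]
    refine and_congr_left fun hi => ?_
    rw [if_neg hi.ne']
  have e2 : 1 ∉ actBC s0 E := by rw [mem_actBC_s0, if_pos rfl, not_not]; exact h
  have key := hsum_append_linear (T := {c (pos 1)}) (M₁ := [headFactor X]) (M₂ := [headFactor X])
    (M₃ := []) (c₁ := 1) (c₂ := -(1 + beta K * headFactor X (c (pos 1))))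
    (c₃ := -headFactor X (c (pos 1))) (Finset.disjoint_singleton_right.2 hS)
    (forall₂_s0 (X := X) hc E hS) (fun S' hS'' _ => by
      have h1 := hsum_headFactor hβ hc hX (S := S') fun a ha => hS' a (hS'' ha)
      have h2 := hsum_headFactor hβ hc hX (S := S' ∪ {c (pos 1)}) fun a ha => by
        rcases Finset.mem_union.1 ha with ha | ha
        · exact hS' a (hS'' ha)
        · exact ⟨_, (Finset.mem_singleton.1 ha).symm⟩
      rw [Finset.prod_union (Finset.disjoint_singleton_right.2 fun h => hS (hS'' h)),
        Finset.prod_singleton, ← h1] at h2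
      apply mul_left_cancel₀ hβ
      rw [hsum_nil]
      linear_combination h2)
  rw [repEntries_split_one _ E, repEntries_split_one c E, repEntries_split_one c (actBC s0 E), e1,
    if_pos h, if_neg e2, Finset.insert_eq, Finset.union_comm]
  linear_combination key

omit [Field K] [Algebra ZBeta K] in
theorem barPts_congr {c c' : SNum → K} {M : SP}
    (h : ∀ i ∈ M, c (bar (pos i)) = c' (bar (pos i))) : barPts c M = barPts c' M :=
  Finset.image_congr h

theorem pos_notMem_barPts (hc : IsGeneric c) (i : ℕ+) (M : SP) : c (pos i) ∉ barPts c M := by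
  rw [mem_barPts_iff hc]
  rintro ⟨j, -, h⟩
  exact bar_pos_ne_pos j i h

theorem bar_notMem_barPts (hc : IsGeneric c) {i : ℕ+} {M : SP} (h : i ∉ M) :
    c (bar (pos i)) ∉ barPts c M := by
  rw [mem_barPts_iff hc]
  rintro ⟨j, hj, h'⟩
  rw [pos_injective (bar_injective h')] at hj
  exact h hj

omit [Field K] [Algebra ZBeta K] in
theorem barPts_insert (c : SNum → K) (i : ℕ+) (M : SP) :
    barPts c (insert i M) = insert (c (bar (pos i))) (barPts c M) := by
  rw [barPts, Finset.image_insert]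
  rfl

theorem hsum_insert_bar_pair (hc : IsGeneric c) (L : List (K → K)) {i : ℕ+} {S : Finset K}
    (h : c (pos i) ∉ S) (h' : c (bar (pos i)) ∉ S) :
    hsum L (insert (c (pos i)) (insert (c (bar (pos i))) S)) = hsum L S :=
  hsum_insert_pair (hc.oplus_bar _) (fun h => bar_ne_self _ (hc.injective h).symm) L h h'

/-- If 1 ∉ M, the twisted set gains the point b_1. If 1 ∈ M, it loses b_1̄, which has the same
effect, because b_1 and b_1̄ cancel. -/
theorem hsum_barPts_s0 (hc : IsGeneric c) (L : List (K → K)) (M : SP) :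
    hsum L (barPts (fun z => c (s0.1 z)) (actBC s0 M)) =
      hsum L (insert (c (pos 1)) (barPts c M)) := by
  have hcongr : ∀ N : SP, 1 ∉ N → barPts (fun z => c (s0.1 z)) N = barPts c N := fun N hN =>
    barPts_congr fun i hi => by
      rw [s0.2.1, s0_of_one_lt (lt_of_le_of_ne one_le fun h => hN (h ▸ hi))]
  by_cases h : 1 ∈ M
  · rw [actBC_s0_lower h, hcongr _ (Finset.notMem_erase _ _)]
    conv_rhs => rw [← Finset.insert_erase h, barPts_insert]
    rw [hsum_insert_bar_pair hc L (pos_notMem_barPts hc _ _)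
      (bar_notMem_barPts hc (Finset.notMem_erase _ _))]
  · rw [actBC_s0_raise h, barPts_insert, hcongr _ h, s0.2.1, s0_pos_one, bar_bar]

/-! The reflection `s_1̂`. -/

theorem sHat_pos_one : (simpleRefl .D 0).1 (pos 1) = bar (pos 2) := by
  apply Subtype.ext; rw [sHat_val]; rfl

theorem sHat_pos_two : (simpleRefl .D 0).1 (pos 2) = bar (pos 1) := by
  apply Subtype.ext; rw [sHat_val]; rfl

theorem sHat_of_two_lt {i : ℕ+} (h : 2 < i) : (simpleRefl .D 0).1 (pos i) = pos i := by
  have h2 : ((2 : ℕ+) : ℕ) = 2 := rfl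
  have h1 : ((2 : ℕ+) : ℕ) < (i : ℕ) := h
  rw [h2] at h1
  apply Subtype.ext
  rw [sHat_val]
  simp only [pos]
  split_ifs <;> first | omega | contradiction

theorem repEntry_sHat (c : SNum → K) {p : ℕ+} (hp : 2 < p) : ∃ R : K → K, ∀ a,
    repEntry .D c p a = R a * (oplus a (c (pos 1)) * oplus a (c (pos 2))) ∧
    repEntry .D (fun z => c ((simpleRefl .D 0).1 z)) p a =
      R a * (oplus a (c (bar (pos 1))) * oplus a (c (bar (pos 2)))) := by
  obtain ⟨m, hm⟩ : ∃ m, p.natPred = m + 2 := by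
    have h1 : 2 < (p : ℕ) := hp
    have := p.natPred_add_one
    exact ⟨p.natPred - 2, by omega⟩
  refine ⟨fun a => headFactor .D a * ∏ j ∈ Finset.range m, oplus a (c (pos (j + 1 + 1).succPNat)),
    fun a => ?_⟩
  have h2 : ∀ j : ℕ, (simpleRefl .D 0).1 (pos (j + 1 + 1).succPNat) = pos (j + 1 + 1).succPNat :=
    fun j => sHat_of_two_lt (PNat.coe_lt_coe _ _ |>.1 (by
      have : ((2 : ℕ+) : ℕ) = 2 := rfl
      rw [Nat.succPNat_coe, this]; omega))
  have h3 : Nat.succPNat 0 = 1 := rfl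
  have h4 : Nat.succPNat (0 + 1) = 2 := rfl
  rw [repEntry, repEntry, hm, Finset.prod_range_succ', Finset.prod_range_succ',
    Finset.prod_range_succ', Finset.prod_range_succ']
  simp only [h2, h3, h4, sHat_pos_one, sHat_pos_two]
  exact ⟨by ring, by ring⟩

theorem pos_one_ne_pos_two : pos 1 ≠ pos 2 := fun h => absurd (pos_injective h) (by decide)

theorem forall₂_sHat (hc : IsGeneric c) (E : SP) {S : Finset K} (h1 : c (pos 1) ∉ S)
    (h2 : c (pos 2) ∉ S) :
    List.Forall₂ (fun g g' => (∀ z ∈ ({c (pos 1), c (pos 2)} : Finset K), g z = 0) ∧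
      ∀ a ∈ S, g' a = g a * ∏ z ∈ {c (pos 1), c (pos 2)}, rr a z)
      (repEntries .D (fun z => c ((simpleRefl .D 0).1 z)) (E.filter (2 < ·)))
      (repEntries .D c (E.filter (2 < ·))) := by
  unfold repEntries
  rw [List.forall₂_map_left_iff, List.forall₂_map_right_iff, List.forall₂_same]
  intro p hp
  rw [Finset.mem_sort, Finset.mem_filter] at hp
  obtain ⟨R, hR⟩ := repEntry_sHat c hp.2
  refine ⟨fun z hz => ?_, fun a ha => ?_⟩
  · rw [(hR _).2]
    rcases Finset.mem_insert.1 hz with rfl | hz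
    · rw [hc.oplus_bar, zero_mul, mul_zero]
    · rw [Finset.mem_singleton.1 hz, hc.oplus_bar, mul_zero, mul_zero]
  · rw [Finset.prod_pair fun h => pos_one_ne_pos_two (hc.injective h), (hR a).1, (hR a).2,
      ← oplus_mul_rr (hc.oplus_bar (pos 1)) fun h => h1 (h ▸ ha),
      ← oplus_mul_rr (hc.oplus_bar (pos 2)) fun h => h2 (h ▸ ha)]
    ring

theorem repEntries_split_two (c : SNum → K) (E : SP) : repEntries .D c E =
    repEntries .D c (E.filter (2 < ·)) ++ ((if 2 ∈ E then [fun a => oplus a (c (pos 1))] else []) ++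
      if 1 ∈ E then [fun _ => 1] else []) := by
  have h := repEntries_split (X := .D) c 1 E
  have h1 : E.filter (· < 1) = ∅ := by simp
  have h2 : (1 : ℕ+) + 1 = 2 := rfl
  have h3 : repEntry .D c 1 = fun _ => 1 := funext fun a => repEntry_one c a
  have h4 : repEntry .D c (1 + 1) = fun a => oplus a (c (pos 1)) := funext fun a => by
    rw [repEntry_succ, h3, one_mul]
  have h5 : repEntries .D c ∅ = [] := by simp [repEntries]
  rw [h1, h5, List.append_nil, h3, h4] at h
  exact h

theorem length_repEntries (c : SNum → K) (E : SP) : (repEntries X c E).length = E.card := by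
  rw [repEntries, List.length_map, Finset.length_sort]

/-! ### Tails with one or two entries, for type D -/

section RowValues

variable [CharZero K] (hβ : beta K ≠ 0) (hc : IsGeneric c) {S : Finset K}
  (hS : ∀ a ∈ S, ∃ z, c z = a)

include hβ hc hS

theorem hsum_singleton_one (h : Odd S.card) : hsum [fun _ => 1] S = 1 := by
  simp only [hsum_cons, hsum_nil, mul_one, one_mul]
  exact sum_prod_rr_of_odd hβ S (hsum_one_add_ne hc hS) (hsum_oplus_self_ne hc hS) h

theorem hsum_singleton_oplus (h : Odd S.card) (w : K) : beta K * hsum [fun a => oplus a w] S + 1 =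
    (1 + beta K * w) * ∏ a ∈ S, (1 + beta K * a) := by
  simp only [hsum_cons, hsum_nil, mul_one]
  rw [sum_oplus_prod_rr_of_odd hβ S (hsum_one_add_ne hc hS) (hsum_oplus_self_ne hc hS) h]
  field_simp
  ring

theorem hsum_oplus_one (h : Even S.card) (w : K) :
    beta K * hsum [fun a => oplus a w, fun _ => 1] S + 1 = ∏ a ∈ S, (1 + beta K * a) := by
  have h1 : hsum [fun a => oplus a w, fun _ => 1] S =
      ∑ a ∈ S, oplus a w * ∏ d ∈ S.erase a, rr a d := by
    rw [hsum_cons]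
    refine Finset.sum_congr rfl fun a ha => ?_
    rw [hsum_singleton_one hβ hc (fun d hd => hS d (Finset.mem_of_mem_erase hd)), mul_one]
    rw [← Finset.card_erase_add_one ha, Nat.even_add_one, Nat.not_even_iff_odd] at h
    exact h
  rw [h1, sum_oplus_prod_rr_of_even hβ S (hsum_one_add_ne hc hS) (hsum_oplus_self_ne hc hS) h]
  field_simp
  ring

end RowValues

/-- The entries of p > 2 absorb the points b_1 and b_2. The tail made of the entries of 2 and 1 sees
a number of points whose parity is fixed by E and M, so the one-row identities apply. With both
entries present, the two points multiply the tail by (1 + βb_1)(1 + βb_2) = 1 + βe(α_1̂) in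
multiplicative form; with only one, the tail does not change. -/
theorem hsum_sHat [CharZero K] (hβ : beta K ≠ 0) (hc : IsGeneric c) {E : SP} {M : SP}
    (hEM : Even (E.card + M.card)) :
    hsum (repEntries .D (fun z => c ((simpleRefl .D 0).1 z)) E)
        (insert (c (pos 1)) (insert (c (pos 2)) (barPts c M))) =
      if 1 ∈ E ∧ 2 ∈ E then
        (1 + beta K * oplus (c (pos 1)) (c (pos 2))) * hsum (repEntries .D c E) (barPts c M) +
          oplus (c (pos 1)) (c (pos 2)) * hsum (repEntries .D c ((E.erase 1).erase 2)) (barPts c M)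
      else hsum (repEntries .D c E) (barPts c M) := by
  set S := barPts c M with hS
  have h1 : c (pos 1) ∉ S := pos_notMem_barPts hc _ _
  have h2 : c (pos 2) ∉ S := pos_notMem_barPts hc _ _
  have h12 : c (pos 1) ≠ c (pos 2) := fun h => pos_one_ne_pos_two (hc.injective h)
  set T : Finset K := {c (pos 1), c (pos 2)} with hT
  have hd : ∀ S' ⊆ S, Disjoint S' T := by
    intro S' hS'
    rw [Finset.disjoint_left]
    intro a ha ha'
    rcases Finset.mem_insert.1 ha' with rfl | ha'
    · exact h1 (hS' ha)
    · exact h2 (by rw [← Finset.mem_singleton.1 ha']; exact hS' ha)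
  have hins : insert (c (pos 1)) (insert (c (pos 2)) S) = S ∪ T := by
    rw [hT, Finset.union_comm, Finset.insert_union, Finset.singleton_union]
  have hpt : ∀ S' ⊆ S, ∀ a ∈ S', ∃ z, c z = a := fun S' hS' a ha => by
    obtain ⟨i, -, rfl⟩ := mem_barPts.1 (hS' ha)
    exact ⟨_, rfl⟩
  have hptT : ∀ S' ⊆ S, ∀ a ∈ S' ∪ T, ∃ z, c z = a := fun S' hS' a ha => by
    rcases Finset.mem_union.1 ha with ha | ha
    · exact hpt S' hS' a ha
    · rcases Finset.mem_insert.1 ha with rfl | ha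
      · exact ⟨_, rfl⟩
      · exact ⟨_, (Finset.mem_singleton.1 ha).symm⟩
  have hcT : ∀ S' ⊆ S, (S' ∪ T).card = S'.card + 2 := fun S' hS' => by
    rw [Finset.card_union_of_disjoint (hd S' hS'), hT, Finset.card_pair h12]
  have hprod : ∀ S' ⊆ S, ∏ a ∈ S' ∪ T, (1 + beta K * a) = (∏ a ∈ S', (1 + beta K * a)) *
      ((1 + beta K * c (pos 1)) * (1 + beta K * c (pos 2))) := fun S' hS' => by
    rw [Finset.prod_union (hd S' hS'), hT, Finset.prod_pair h12]
  have hu1 := one_add_mul_one_add (hc.oplus_bar (pos 1))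
  have hu2 := one_add_mul_one_add (hc.oplus_bar (pos 2))
  have hE := congrArg List.length (repEntries_split_two c E)
  rw [length_repEntries, List.length_append] at hE
  have hSM : S.card = M.card := card_barPts hc M
  rw [hins]
  set L := repEntries .D (fun z => c ((simpleRefl .D 0).1 z)) (E.filter (2 < ·)) with hL
  set L' := repEntries .D c (E.filter (2 < ·)) with hL'
  have hLL : L.length = L'.length := by rw [hL, hL', length_repEntries, length_repEntries]
  have master : ∀ {M₁ M₂ M₃ : List (K → K)} {c₁ c₂ c₃ : K}, _ →
      c₁ * hsum (L ++ M₁) (S ∪ T) + c₂ * hsum (L' ++ M₂) S + c₃ * hsum (L' ++ M₃) S = 0 :=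
    fun h => hsum_append_linear (hd S subset_rfl) (forall₂_sHat hc E h1 h2) h
  rw [repEntries_split_two _ E, repEntries_split_two c E]
  simp only [sHat_pos_one]
  by_cases k1 : 1 ∈ E <;> by_cases k2 : 2 ∈ E
  · have e1 : ((E.erase 1).erase 2).filter (2 < ·) = E.filter (2 < ·) := by
      ext i
      simp only [Finset.mem_filter, Finset.mem_erase]
      refine ⟨fun h => ⟨h.1.2.2, h.2⟩, fun h => ⟨⟨h.2.ne', ?_, h.1⟩, h.2⟩⟩
      exact (lt_trans (by decide) h.2 : (1 : ℕ+) < i).ne'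
    rw [repEntries_split_two c ((E.erase 1).erase 2), e1]
    simp only [k1, k2, and_self, if_true, Finset.mem_erase, ne_eq, not_true_eq_false, false_and,
      and_false, if_false, List.append_nil, List.singleton_append, List.length_cons,
      List.length_nil] at hE ⊢
    have key := master (M₁ := [fun a => oplus a (c (bar (pos 2))), fun _ => 1])
      (M₂ := [fun a => oplus a (c (pos 1)), fun _ => 1]) (M₃ := []) (c₁ := 1)
      (c₂ := -(1 + beta K * oplus (c (pos 1)) (c (pos 2))))
      (c₃ := -oplus (c (pos 1)) (c (pos 2))) (fun S' hS' hcard => by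
        have hev : Even S'.card := by
          rw [Nat.even_iff] at hEM ⊢
          omega
        have v1 := hsum_oplus_one hβ hc (hpt S' hS') hev (c (pos 1))
        have v2 := hsum_oplus_one hβ hc (hptT S' hS') (by
          rw [hcT S' hS']; exact hev.add even_two) (c (bar (pos 2)))
        rw [hprod S' hS', ← v1] at v2
        apply mul_left_cancel₀ hβ
        rw [hsum_nil]
        unfold oplus at v2 ⊢
        linear_combination v2)
    rw [List.append_nil] at key
    linear_combination key
  · simp only [k1, k2, and_false, if_true, if_false, List.nil_append, List.length_cons,
      List.length_nil] at hE ⊢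
    have key := master (M₁ := [fun _ => 1]) (M₂ := [fun _ => 1]) (M₃ := []) (c₁ := 1)
      (c₂ := -1) (c₃ := 0) (fun S' hS' hcard => by
        have hodd : Odd S'.card := by
          rw [Nat.even_iff] at hEM
          rw [Nat.odd_iff]
          omega
        rw [hsum_singleton_one hβ hc (hpt S' hS') hodd, hsum_singleton_one hβ hc (hptT S' hS') (by
          rw [hcT S' hS']; exact hodd.add_even even_two)]
        ring)
    linear_combination key
  · simp only [k1, k2, false_and, if_true, if_false, List.append_nil, List.length_cons,
      List.length_nil] at hE ⊢
    have key := master (M₁ := [fun a => oplus a (c (bar (pos 2)))])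
      (M₂ := [fun a => oplus a (c (pos 1))]) (M₃ := []) (c₁ := 1)
      (c₂ := -1) (c₃ := 0) (fun S' hS' hcard => by
        have hodd : Odd S'.card := by
          rw [Nat.even_iff] at hEM
          rw [Nat.odd_iff]
          omega
        have v1 := hsum_singleton_oplus hβ hc (hpt S' hS') hodd (c (pos 1))
        have v2 := hsum_singleton_oplus hβ hc (hptT S' hS') (by
          rw [hcT S' hS']; exact hodd.add_even even_two) (c (bar (pos 2)))
        rw [hprod S' hS'] at v2
        apply mul_left_cancel₀ hβ
        linear_combination v2 - v1 +
          (∏ a ∈ S', (1 + beta K * a)) * (1 + beta K * c (pos 1)) * hu2)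
    linear_combination key
  · simp only [k1, k2, and_self, if_false, List.append_nil]
    have key := master (M₁ := []) (M₂ := []) (M₃ := []) (c₁ := 1)
      (c₂ := -1) (c₃ := 0) (fun S' hS' hcard => by simp)
    rw [List.append_nil, List.append_nil] at key
    linear_combination key

/-- As for s_0: the four cases for 1, 2 ∈ M differ by pairs b_i, b_ī, which can be removed. -/
theorem hsum_barPts_sHat (hc : IsGeneric c) (L : List (K → K)) (M : SP) :
    hsum L (barPts (fun z => c ((simpleRefl .D 0).1 z)) (actBC (simpleRefl .D 0) M)) =
      hsum L (insert (c (pos 1)) (insert (c (pos 2)) (barPts c M))) := by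
  have h21 : (2 : ℕ+) ≠ 1 := by decide
  have h12 : c (pos 1) ≠ c (pos 2) := fun h => pos_one_ne_pos_two (hc.injective h)
  have hne : ∀ i j : ℕ+, c (bar (pos i)) ≠ c (pos j) := fun i j h =>
    bar_pos_ne_pos i j (hc.injective h)
  have hcongr : ∀ N : SP, 1 ∉ N → 2 ∉ N →
      barPts (fun z => c ((simpleRefl .D 0).1 z)) N = barPts c N := fun N h1 h2 =>
    barPts_congr fun i hi => by
      rw [(simpleRefl .D 0).2.1, sHat_of_two_lt]
      have e1 : (i : ℕ) ≠ 1 := fun h => h1 (PNat.eq (m := i) (n := 1) h ▸ hi)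
      have e2 : (i : ℕ) ≠ 2 := fun h => h2 (PNat.eq (m := i) (n := 2) h ▸ hi)
      have := i.pos
      exact PNat.coe_lt_coe _ _ |>.1 (by
        have : ((2 : ℕ+) : ℕ) = 2 := rfl
        omega)
  set N := (M.erase 1).erase 2 with hN
  have n1 : 1 ∉ N := by simp [hN]
  have n2 : 2 ∉ N := by simp [hN]
  have p1 := pos_notMem_barPts hc 1 N
  have p2 := pos_notMem_barPts hc 2 N
  have q1 := bar_notMem_barPts hc n1
  have q2 := bar_notMem_barPts hc n2
  have hb1 : (simpleRefl .D 0).1 (bar (pos 1)) = pos 2 := by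
    rw [(simpleRefl .D 0).2.1, sHat_pos_one, bar_bar]
  have hb2 : (simpleRefl .D 0).1 (bar (pos 2)) = pos 1 := by
    rw [(simpleRefl .D 0).2.1, sHat_pos_two, bar_bar]
  by_cases k1 : 1 ∈ M <;> by_cases k2 : 2 ∈ M
  · have hM : M = insert 1 (insert 2 N) := by
      rw [hN, Finset.insert_erase (by simp [k2, h21]), Finset.insert_erase k1]
    rw [actBC_sHat_lower k1 k2, hcongr _ n1 n2]
    rw [hM, barPts_insert, barPts_insert, Finset.insert_comm (c (pos 2)),
      hsum_insert_bar_pair hc L, hsum_insert_bar_pair hc L p2 q2]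
    · simp [p1, h12, (hne _ _).symm]
    · simp [q1, hne, hc.injective.eq_iff,
        bar_injective.eq_iff, pos_one_ne_pos_two]
  · have hM : M = insert 1 N := by
      rw [hN, Finset.erase_eq_of_notMem (by simp [k2]), Finset.insert_erase k1]
    rw [actBC_sHat_of_iff (by tauto), hM, barPts_insert, barPts_insert, hcongr _ n1 n2, hb1,
      Finset.insert_comm (c (pos 2)), hsum_insert_bar_pair hc L]
    · simp [p1, h12]
    · simp [q1, hne]
  · have hM : M = insert 2 N := by
      rw [hN, Finset.erase_eq_of_notMem k1, Finset.insert_erase k2]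
    rw [actBC_sHat_of_iff (by tauto), hM, barPts_insert, barPts_insert, hcongr _ n1 n2, hb2,
      Finset.insert_comm (c (pos 1)), Finset.insert_comm (c (pos 1)), hsum_insert_bar_pair hc L]
    · simp [p2, h12.symm]
    · simp [q2, hne]
  · have hM : M = N := by
      rw [hN, Finset.erase_eq_of_notMem k1, Finset.erase_eq_of_notMem k2]
    rw [actBC_sHat_raise k1 k2, barPts_insert, barPts_insert, hM, hcongr _ n1 n2, hb1, hb2,
      Finset.insert_comm]

/-! ### Schubert classes -/

theorem e_simpleRoot_succ (X : ClType) (k : ℕ) : e (simpleRoot X (k + 1)) =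
    oplus (b (pos (k.succPNat + 1))) (b (bar (pos k.succPNat))) := by
  have h : simpleRoot X (k + 1) = t (pos (k.succPNat + 1)) - t (pos k.succPNat) := by
    cases X <;> rfl
  rw [h, e_t_sub_t]

theorem map_e_simpleRoot_zero {K : Type} [Field K] [Algebra ZBeta K] (φ : CoefRing →ₐ[ZBeta] K)
    {X : ClType} (hX : X ≠ .D) : φ (e (simpleRoot X 0)) = headFactor X (φ (b (pos 1))) := by
  cases X
  · exact congrArg φ (e_t _)
  · have h : simpleRoot .C 0 = t (pos 1) + t (pos 1) := two_smul ℕ (t (pos 1))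
    rw [h, e_add, e_t, map_oplus]
    rfl
  · exact absurd rfl hX

theorem e_simpleRoot_zero_D : e (simpleRoot .D 0) = oplus (b (pos 1)) (b (pos 2)) := by
  rw [simpleRoot, e_add, e_t, e_t]

/-! ### Behaviour under an arbitrary simple reflection -/

section DividedDifference

variable {K : Type} [Field K] [Algebra ZBeta K] [CharZero K] (hβ : beta K ≠ 0)
  {φ : CoefRing →ₐ[ZBeta] K} (hφ : Function.Injective φ) {X : ClType} {E M : SP}

include hβ hφ

theorem hsum_simpleRefl_of_lt (hE : IsRep X E) (hM : IsRep X M) (i : ℕ)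
    (h : weight X (actBC (simpleRefl X i) E) < weight X E) :
    hsum (repEntries X (fun z => φ (b ((simpleRefl X i).1 z))) E)
        (barPts (fun z => φ (b ((simpleRefl X i).1 z))) (actBC (simpleRefl X i) M)) =
      (1 + beta K * φ (e (simpleRoot X i))) *
          hsum (repEntries X (fun z => φ (b z)) E) (barPts (fun z => φ (b z)) M) +
        φ (e (simpleRoot X i)) * hsum (repEntries X (fun z => φ (b z)) (actBC (simpleRefl X i) E))
          (barPts (fun z => φ (b z)) M) := by
  have hc := isGeneric_of_injective hφ
  cases i with
  | succ k =>
    rw [simpleRefl_succ] at h ⊢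
    rw [barPts_sPos (fun z => φ (b z)), e_simpleRoot_succ, map_oplus]
    apply hsum_sPos_lower hc
    · intro h1
      by_cases h2 : k.succPNat + 1 ∈ E
      · rw [actBC_sPos_of_iff (by tauto)] at h; exact h.false
      · have := weight_sPos_raise X h1 h2; omega
    · by_contra h2
      by_cases h1 : k.succPNat ∈ E
      · have := weight_sPos_raise X h1 h2; omega
      · rw [actBC_sPos_of_iff (by tauto)] at h; exact h.false
  | zero =>
    by_cases hX : X = .D
    · subst hX
      have h12 : 1 ∈ E ∧ 2 ∈ E := by
        by_contra h0
        by_cases h1 : 1 ∈ E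
        · rw [actBC_sHat_of_iff (by tauto)] at h; exact h.false
        · by_cases h2 : 2 ∈ E
          · rw [actBC_sHat_of_iff (by tauto)] at h; exact h.false
          · have := weight_sHat_raise h1 h2; omega
      rw [hsum_barPts_sHat hc, hsum_sHat hβ hc (Even.add hE hM), if_pos h12,
        actBC_sHat_lower h12.1 h12.2, e_simpleRoot_zero_D, map_oplus]
    · rw [simpleRefl_zero hX] at h ⊢
      rw [hsum_barPts_s0 hc, map_e_simpleRoot_zero φ hX]
      refine hsum_s0_lower hβ hc hX ?_ (pos_notMem_barPts hc _ _) fun a ha => ?_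
      · by_contra h1
        have := weight_s0_raise hX h1; omega
      · obtain ⟨i, -, rfl⟩ := mem_barPts.1 ha
        exact ⟨_, rfl⟩

theorem hsum_simpleRefl_of_le (hE : IsRep X E) (hM : IsRep X M) (i : ℕ)
    (h : weight X E ≤ weight X (actBC (simpleRefl X i) E)) :
    hsum (repEntries X (fun z => φ (b ((simpleRefl X i).1 z))) E)
        (barPts (fun z => φ (b ((simpleRefl X i).1 z))) (actBC (simpleRefl X i) M)) =
      hsum (repEntries X (fun z => φ (b z)) E) (barPts (fun z => φ (b z)) M) := by
  have hc := isGeneric_of_injective hφ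
  cases i with
  | succ k =>
    rw [simpleRefl_succ] at h ⊢
    rw [barPts_sPos (fun z => φ (b z))]
    apply hsum_sPos_ge hc
    intro h2
    by_contra h1
    have := weight_sPos_lower X h1 h2; omega
  | zero =>
    by_cases hX : X = .D
    · subst hX
      have h12 : ¬(1 ∈ E ∧ 2 ∈ E) := by
        rintro ⟨h1, h2⟩
        have := weight_sHat_lower h1 h2; omega
      rw [hsum_barPts_sHat hc, hsum_sHat hβ hc (Even.add hE hM), if_neg h12]
    · rw [simpleRefl_zero hX] at h ⊢
      rw [hsum_barPts_s0 hc]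
      refine hsum_s0_ge hc ?_ (pos_notMem_barPts hc _ _)
      intro h1
      have := weight_s0_lower hX h1; omega

end DividedDifference

/-! ### Existence and uniqueness of the Schubert family -/

theorem actCoef_simpleRefl_self (X : ClType) (i : ℕ) (x : CoefRing) :
    actCoef (simpleRefl X i) (actCoef (simpleRefl X i) x) = x := by
  have h : (actCoef (simpleRefl X i)).comp (actCoef (simpleRefl X i)) = AlgHom.id _ _ :=
    coef_algHom_ext fun z => by
      have h1 : (simpleRefl X i).1 ((simpleRefl X i).1 z) = z :=
        congrArg (fun w : signedPerm => w.1 z) (simpleRefl_mul_self X i)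
      rw [AlgHom.comp_apply, actCoef_b, actCoef_b, h1]
      rfl
  exact DFunLike.congr_fun h x

theorem actCoef_simpleRefl_injective (X : ClType) (i : ℕ) :
    Function.Injective (actCoef (simpleRefl X i)) :=
  Function.LeftInverse.injective (actCoef_simpleRefl_self X i)

/-- An embedding of `𝓡` into a field. -/
theorem exists_coefRing_embedding : ∃ (K : Type) (_ : Field K) (_ : Algebra ZBeta K)
    (_ : CharZero K) (φ : CoefRing →ₐ[ZBeta] K), Function.Injective φ ∧ beta K ≠ 0 := by
  obtain ⟨K, _, _, φ, hφ⟩ := exists_field_embedding CoefRing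
  refine ⟨K, inferInstance, inferInstance, charZero_of_injective_ringHom (f := φ.toRingHom) hφ,
    φ, hφ, ?_⟩
  rw [← map_beta φ]
  exact (map_ne_zero_iff φ hφ).2 beta_coefRing_ne_zero

/-- Composing the embedding φ with s_i gives another embedding, so the localization formula also
computes s_i(ψ(s_i μ)), now with twisted entries and points. -/
theorem isSchubertFamily_gx (X : ClType) :
    IsSchubertFamily X fun la => localization X (gx X la) := by
  obtain ⟨K, _, _, _, φ, hφ, hβ⟩ := exists_coefRing_embedding
  have hloc := fun la mu => localizationAt_gx hβ hφ X la mu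
  have hact : ∀ i la mu, φ (actCoef (simpleRefl X i)
      (localizationAt X (act X (simpleRefl X i) mu) (gx X la))) =
      hsum (repEntries X (fun z => φ (b ((simpleRefl X i).1 z))) (rep X la))
        (barPts (fun z => φ (b ((simpleRefl X i).1 z))) (actBC (simpleRefl X i) (rep X mu))) := by
    intro i la mu
    have h := localizationAt_gx hβ (φ := φ.comp (actCoef (simpleRefl X i)))
      (hφ.comp (actCoef_simpleRefl_injective X i)) X la (act X (simpleRefl X i) mu)
    simpa only [AlgHom.comp_apply, actCoef_b, rep_act (simpleRefl_mem X i)] using h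
  constructor
  · exact fun la => localization_mem_gkmRing _
  · intro i la h mu
    rw [SPlt_act_iff, size, size, rep_act (simpleRefl_mem X i)] at h
    have key := hsum_simpleRefl_of_lt hβ hφ (isRep_rep X la) (isRep_rep X mu) i h
    rw [← hact, ← hloc, ← rep_act (simpleRefl_mem X i), ← hloc] at key
    apply hφ
    change φ (_ * localizationAt X mu _) = φ (actCoef _ (localizationAt X _ _) -
      _ * localizationAt X mu _)
    rw [map_sub, key, map_mul, map_mul, map_add, map_mul, map_one, map_beta]
    ring
  · intro i la h mu
    rw [SPle_act_iff, size, size, rep_act (simpleRefl_mem X i)] at h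
    -- π_i ψ = -βψ amounts to s_i(ψ(s_i μ)) = ψ(μ).
    have key := hsum_simpleRefl_of_le hβ hφ (isRep_rep X la) (isRep_rep X mu) i h
    rw [← hact, ← hloc] at key
    change _ * (-beta CoefRing * localizationAt X mu _) = actCoef _ (localizationAt X _ _) -
      _ * localizationAt X mu _
    rw [hφ key]
    ring
  · intro la
    change localizationAt X ∅ (gx X la) = _
    apply hφ
    rw [hloc, rep_empty]
    split_ifs with h
    · rw [h, rep_empty, map_one]
      have h5 : repEntries X (fun z => φ (b z)) ∅ = [] := by simp [repEntries]
      rw [h5, hsum_nil]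
    · rw [map_zero]
      apply hsum_eq_zero_of_card_lt
      rw [length_repEntries, barPts, Finset.image_empty, Finset.card_empty, Finset.card_pos,
        Finset.nonempty_iff_ne_empty]
      exact fun h0 => h (rep_injective X (h0.trans (rep_empty X).symm))

/-- Read at s_i μ of smaller size, the divided difference relation expresses s_i(ψ_λ(μ)) through
values at s_i μ. Induction on the size of μ, for all λ at once, ends at the prescribed values at ∅.
-/
theorem IsSchubertFamily.unique {X : ClType} {psi psi' : SP → SP → CoefRing}
    (h : IsSchubertFamily X psi) (h' : IsSchubertFamily X psi') : psi = psi' := by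
  have key : ∀ n mu, size X mu = n → ∀ la, psi la mu = psi' la mu := by
    intro n
    induction n with
    | zero =>
      intro mu hmu la
      rw [eq_empty_of_size hmu, h.initial, h'.initial]
    | succ n ih =>
      intro mu hmu la
      have hmu0 : mu ≠ ∅ := fun h0 => by rw [h0, size_empty] at hmu; omega
      obtain ⟨i, hi⟩ := exists_size_lower (X := X) hmu0
      have ih' := ih (act X (simpleRefl X i) mu) (by omega)
      apply actCoef_simpleRefl_injective X i
      rcases lt_or_ge (size X (act X (simpleRefl X i) la)) (size X la) with hla | hla
      · rw [← SPlt_act_iff] at hla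
        have e1 := h.divided_lt i la hla (act X (simpleRefl X i) mu)
        have e2 := h'.divided_lt i la hla (act X (simpleRefl X i) mu)
        rw [act_simple_act, ih', ih'] at e1
        rw [act_simple_act, e1] at e2
        exact sub_left_injective e2
      · rw [← SPle_act_iff] at hla
        have e1 := h.divided_ge i la hla (act X (simpleRefl X i) mu)
        have e2 := h'.divided_ge i la hla (act X (simpleRefl X i) mu)
        rw [Pi.smul_apply, act_simple_act, ih'] at e1
        rw [Pi.smul_apply, act_simple_act, e1] at e2
        exact sub_left_injective e2
  exact funext fun la => funext fun mu => key _ mu rfl la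

end

end KGKM

theorem mainTheorem2 (X : KGKM.ClType) :
    -- for every strict partition `λ`, the function `GX_λ(x|b)` is a well-defined element
    (∀ la : KGKM.SP, ∃! F : KGKM.GGammaR X, KGKM.IsGX X la F) ∧
    -- the localization map takes its values in the GKM ring
    (∀ F : KGKM.GGammaR X, KGKM.localization X F ∈ KGKM.gkmRing X) ∧
    -- the images of the `GX_λ(x|b)` are the unique family of Schubert classes
    (∀ GX : KGKM.SP → KGKM.GGammaR X, (∀ la, KGKM.IsGX X la (GX la)) →
      KGKM.IsSchubertFamily X (fun la => KGKM.localization X (GX la)) ∧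
      ∀ psi : KGKM.SP → KGKM.SP → KGKM.CoefRing, KGKM.IsSchubertFamily X psi →
        psi = fun la => KGKM.localization X (GX la)) ∧
    -- the localization map is injective
    Function.Injective (KGKM.localization X) := by
  refine ⟨fun la => ⟨KGKM.gx X la, KGKM.isGX_gx X la, fun F hF => hF.unique (KGKM.isGX_gx X la)⟩,
    KGKM.localization_mem_gkmRing, fun GX hGX => ?_, KGKM.localization_injective X⟩
  obtain rfl : GX = KGKM.gx X := funext fun la => (hGX la).unique (KGKM.isGX_gx X la)
  exact ⟨KGKM.isSchubertFamily_gx X, fun psi hpsi => hpsi.unique (KGKM.isSchubertFamily_gx X)⟩
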